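/- Let $p=2$, $BP_*=\mathbb Z_{(2)}[v_1,v_2,\dots]$, $BP_*BP=BP_*[t_1,t_2,\dots]$ (Hazewinkel generators) and $I=(2,v_1,v_2,\dots)\subset BP_*$. The cobar complex $C^s=BP_*BP^{\otimes_{BP_*}s}$ is filtered by the subcomplexes $I^kC^\bullet$. The resulting spectral sequence, indexed so that $$E_2^{s,k}=\mathrm{Ext}^s_{BP_*BP}(BP_*,I^k/I^{k+1}),\qquad d_r:E_r^{s,k}\to E_r^{s+1,k+r-1},$$ is the algebraic Novikov spectral sequence (the internal degree is suppressed). Let $q_0:E_r^{s,k}\to E_r^{s,k+1}$ be multiplication by the class of $v_0=2$ in $I/I^2$. Let $A=\mathbb F_2[\xi_1,\xi_2,\dots]$ be the mod $2$ dual Steenrod algebra, $\chi$ its antipode, and $P=\mathbb F_2[\xi_1^2,\xi_2^2,\dots]\subset A$. The Frobenius $A\cong P$ and the isomorphism $P\cong BP_*BP/I$, $\chi(\xi_n^2)\mapsto t_n$, give isomorphisms $$\mathrm{Ext}_A^{s,t}(\mathbb F_2,\mathbb F_2)\cong \mathrm{Ext}_P^{s,2t}(\mathbb F_2,\mathbb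 F_2)\cong E_2^{s,0}\ \text{(in internal degree } 2t),$$ through which elements of $\mathrm{Ext}_A$ name elements of $E_2^{s,0}$ (Cartan–Eilenberg names). Let $h_j\in\mathrm{Ext}_A^{1,2^j}$ be the class of $[\xi_1^{2^j}]$, and let $Sq^0:\mathrm{Ext}_A^{s,t}\to\mathrm{Ext}_A^{s,2t}$ be the operation induced by $[x_1|\cdots|x_s]\mapsto[x_1^2|\cdots|x_s^2]$ on the cobar complex of $A$. **Proposition.** The group $\mathrm{Ext}_A^{4,24}(\mathbb F_2,\mathbb F_2)$ has exactly one nonzero element $g_1$. Put $g_{n+1}=Sq^0(g_n)$ for $n\ge1$, so that $g_n\in\mathrm{Ext}_A^{4,3\cdot2^{n+2}}$. Then, for every $j\ge5$, in the algebraic Novikov spectral sequence the class named $h_j^3$ survives to the $E_4$-page, and $$d_2(h_j^3)=0,\qquad d_3(h_j^3)=0,\qquad d_4(h_j^3)=q_0^3\,g_{j-2}.$$ -/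

import Mathlib

namespace AlgNov

open MvPolynomial
open Finset.HasAntidiagonal (antidiagonal mem_antidiagonal)

noncomputable section

/-- The ring `ℤ_(2)` of rational numbers with odd denominator. -/
def ZLoc : Subring ℚ where
  carrier := {q | Odd q.den}
  mul_mem' := fun {a b} ha hb =>
    Odd.of_dvd_nat (Nat.odd_mul.2 ⟨ha, hb⟩) (Rat.mul_den_dvd a b)
  one_mem' := by simp
  add_mem' := fun {a b} ha hb =>
    Odd.of_dvd_nat (Nat.odd_mul.2 ⟨ha, hb⟩) (Rat.add_den_dvd a b)
  zero_mem' := by simp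
  neg_mem' := fun {a} ha => by simpa using ha

theorem ZLoc.sq_sub_self (c : ZLoc) : ∃ e : ZLoc, c ^ 2 - c = 2 * e := by
  obtain ⟨q, hq⟩ := c
  have hd : Odd q.den := hq
  obtain ⟨k, hk⟩ : ∃ k : ℤ, q.num * (q.num - q.den) = 2 * k := by
    rcases Int.even_or_odd q.num with h | h
    · obtain ⟨a, ha⟩ := h
      exact ⟨a * (q.num - q.den), by rw [ha]; ring⟩
    · have h2 : Even (q.num - q.den) := h.sub_odd (by exact_mod_cast hd)
      obtain ⟨a, ha⟩ := h2
      exact ⟨q.num * a, by rw [ha]; ring⟩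
  have hinv : (1 / (q.den : ℚ)) ∈ ZLoc := by
    show Odd (1 / (q.den : ℚ)).den
    rw [one_div, Rat.inv_natCast_den]
    simp [q.den_nz, hd]
  refine ⟨⟨(k : ℚ) * (1 / q.den * (1 / q.den)), ?_⟩, ?_⟩
  · exact ZLoc.mul_mem (intCast_mem _ k) (ZLoc.mul_mem hinv hinv)
  · apply Subtype.ext
    have hq' : q = q.num / q.den := (Rat.num_div_den q).symm
    have hden : (q.den : ℚ) ≠ 0 := by exact_mod_cast q.den_nz
    have hk' : (q.num : ℚ) * (q.num - q.den) = 2 * k := by exact_mod_cast hk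
    show q ^ 2 - q = 2 * ((k : ℚ) * (1 / q.den * (1 / q.den)))
    have : q ^ 2 - q = (q.num * (q.num - q.den)) * (1 / q.den * (1 / q.den) : ℚ) := by
      conv_lhs => rw [hq']
      field_simp
    rw [this, hk']; ring

/-! ### Substitution of sequences into logarithms -/

section Ghost

variable {R S : Type} [CommRing R] [CommRing S]

/-- `∑_{i+j=n} M_i a_j^{2^i}`: if `M` is the sequence of coefficients of the logarithm of a
`2`-typical formal group law `F`, this is the `n`-th logarithmic coefficient of the power series
`∑^F a_j x^{2^j}`. -/
def ghost (M a : ℕ → R) (n : ℕ) : R :=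
  ∑ p ∈ antidiagonal n, M p.1 * a p.2 ^ 2 ^ p.1

/-- The sequence `a` with `ghost M a = g` (for `M 0 = 1`), obtained by solving recursively. -/
def unghost (M g : ℕ → R) (n : ℕ) : R :=
  g n - ∑ i : Fin n, M (n - i) * unghost M g i ^ 2 ^ (n - i : ℕ)
termination_by n
decreasing_by exact i.2

theorem ghost_eq (M a : ℕ → R) (n : ℕ) (hM : M 0 = 1) :
    ghost M a n = a n + ∑ i : Fin n, M (n - i) * a i ^ 2 ^ (n - i : ℕ) := by
  unfold ghost
  rw [← Finset.Nat.sum_antidiagonal_swap]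
  simp only [Prod.fst_swap, Prod.snd_swap]
  rw [Finset.Nat.sum_antidiagonal_eq_sum_range_succ (fun i k => M k * a i ^ 2 ^ k),
    Finset.sum_range_succ, Finset.sum_range (n := n)]
  simp [hM, add_comm]

theorem ghost_unghost (M g : ℕ → R) (hM : M 0 = 1) : ghost M (unghost M g) = g := by
  funext n
  rw [ghost_eq _ _ _ hM]
  conv_lhs => enter [1]; rw [unghost]
  ring

theorem unghost_ghost (M a : ℕ → R) (hM : M 0 = 1) : unghost M (ghost M a) = a := by
  funext n
  induction n using Nat.strong_induction_on with
  | _ n ih =>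
    rw [unghost, ghost_eq _ _ _ hM]
    have : ∀ i : Fin n, unghost M (ghost M a) i = a i := fun i => ih i i.2
    simp [this]

theorem map_ghost {F : Type} [FunLike F R S] [RingHomClass F R S] (f : F) (M a : ℕ → R) (n : ℕ) :
    f (ghost M a n) = ghost (fun k => f (M k)) (fun k => f (a k)) n := by
  simp [ghost, map_sum]

theorem map_unghost {F : Type} [FunLike F R S] [RingHomClass F R S] (f : F) (M g : ℕ → R) (n : ℕ) :
    f (unghost M g n) = unghost (fun k => f (M k)) (fun k => f (g k)) n := by
  induction n using Nat.strong_induction_on with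
  | _ n ih =>
    rw [unghost, unghost, map_sub, map_sum]
    congr 1
    refine Finset.sum_congr rfl fun i _ => ?_
    rw [map_mul, map_pow, ih i i.2]

theorem sum_antidiagonal_assoc (f : ℕ → ℕ → ℕ → R) (n : ℕ) :
    ∑ p ∈ antidiagonal n, ∑ q ∈ antidiagonal p.2, f p.1 q.1 q.2 =
      ∑ p ∈ antidiagonal n, ∑ q ∈ antidiagonal p.1, f q.1 q.2 p.2 := by
  rw [Finset.sum_sigma', Finset.sum_sigma']
  refine Finset.sum_nbij' (fun x => ⟨(x.1.1 + x.2.1, x.2.2), (x.1.1, x.2.1)⟩)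
    (fun x => ⟨(x.2.1, x.2.2 + x.1.2), (x.2.2, x.1.2)⟩) ?_ ?_ ?_ ?_ ?_
  · rintro ⟨⟨a, b⟩, ⟨c, d⟩⟩ h
    simp only [Finset.mem_sigma, mem_antidiagonal] at h ⊢
    obtain ⟨h1, h2⟩ := h
    constructor <;> first | rfl | (subst h2; subst h1; ring) | trivial
  · rintro ⟨⟨a, b⟩, ⟨c, d⟩⟩ h
    simp only [Finset.mem_sigma, mem_antidiagonal] at h ⊢
    obtain ⟨h1, h2⟩ := h
    constructor <;> first | rfl | (subst h2; subst h1; ring) | trivial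
  · rintro ⟨⟨a, b⟩, ⟨c, d⟩⟩ h
    simp only [Finset.mem_sigma, mem_antidiagonal] at h
    obtain ⟨h1, h2⟩ := h
    simp [h2]
  · rintro ⟨⟨a, b⟩, ⟨c, d⟩⟩ h
    simp only [Finset.mem_sigma, mem_antidiagonal] at h
    obtain ⟨h1, h2⟩ := h
    simp [h2]
  · rintro ⟨⟨a, b⟩, ⟨c, d⟩⟩ h
    rfl

end Ghost

/-! ### The cobar complex of `BP_*BP` -/

/-- Polynomial generators of `BP_*BP ⊗ ⋯ ⊗ BP_*BP` (`s` factors over `BP_*`) over the ground ring: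
`Sum.inl n` is `v_{n+1}` and `Sum.inr (a, n)` is `t_{n+1}` in the `a`-th tensor factor. -/
abbrev Gen (s : ℕ) : Type := ℕ ⊕ Fin s × ℕ

/-- `BP_*BP ⊗_{BP_*} ⋯ ⊗_{BP_*} BP_*BP` (`s` factors), the ring of `s`-cochains of the cobar
complex, where `BP_* = ℤ_(2)[v_1, v_2, …]` and `BP_*BP = BP_*[t_1, t_2, …]`. -/
abbrev Cobar (s : ℕ) : Type := MvPolynomial (Gen s) ZLoc

/-- The rationalisation of `Cobar s`. -/
abbrev QCobar (s : ℕ) : Type := MvPolynomial (Gen s) ℚ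

/-- The inclusion of the cochains in the rational cochains. -/
def toQ (s : ℕ) : Cobar s →+* QCobar s := MvPolynomial.map ZLoc.subtype

theorem toQ_injective (s : ℕ) : Function.Injective (toQ s) :=
  MvPolynomial.map_injective _ Subtype.val_injective

/-- `v_{n+1}`. -/
def v (R : Type) [CommRing R] (s n : ℕ) : MvPolynomial (Gen s) R := X (Sum.inl n)

/-- `t_n` in the `a`-th tensor factor, where `t_0 = 1`. -/
def t (R : Type) [CommRing R] (s : ℕ) (a : Fin s) : ℕ → MvPolynomial (Gen s) R
  | 0 => 1
  | n + 1 => X (Sum.inr (a, n))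

/-- The coefficients of the logarithm of the universal `2`-typical formal group law,
expressed through Hazewinkel's generators:
`m_0 = 1` and `2 m_{n+1} = ∑_{0 ≤ i ≤ n} m_i v_{n+1-i}^{2^i}`. -/
def hazewinkel (s : ℕ) : ℕ → QCobar s
  | 0 => 1
  | n + 1 => C (1 / 2) * ∑ i : Fin (n + 1), hazewinkel s i * v ℚ s (n - i) ^ 2 ^ (i : ℕ)
termination_by n => n
decreasing_by exact i.2

/-- The `s + 1` logarithms on the `s`-cochains, one for each unit map from `BP_*`.
`logs s 0` is that of the left unit, and if `M` is that of the `a`-th unit then the one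
of the next unit has the coefficients `∑_{i+j=n} M_i t_j^{2^i}`, with the `t_j` of the `a`-th
tensor factor. For `s = 1` this is the formula of the right unit,
`η_R(m_n) = ∑_{i+j=n} m_i t_j^{2^i}`. -/
def logs (s : ℕ) : Fin (s + 1) → ℕ → QCobar s :=
  Fin.induction (hazewinkel s) (fun a M => ghost M (t ℚ s a))

/-- The image of `v_{n+1}` under the `b`-th unit, by Hazewinkel's formula for its logarithm:
`2 m_{n+1} = ∑_{i+j=n} m_i v_{j+1}^{2^i}`. -/
def vAt (s : ℕ) (b : Fin (s + 1)) : ℕ → QCobar s :=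
  unghost (logs s b) (fun n => 2 * logs s b (n + 1))

/-- The coefficients `T_n` of the strict isomorphism between the `b`-th and the `b'`-th formal
group law: `m'_n = ∑_{i+j=n} m_i T_j^{2^i}`. For `b' = b + 1` they are the `t_n` of the `b`-th
tensor factor, and for `b' = b + 2` they are the `Δ(t_n)`. -/
def tAt (s : ℕ) (b b' : Fin (s + 1)) : ℕ → QCobar s :=
  unghost (logs s b) (logs s b')

/-- The `i`-th coface map on rational cochains. It is the ring map that relabels the `s + 1`
units along the monotone injection `i.succAbove` which omits `i`. -/
def cofaceQ (s : ℕ) (i : Fin (s + 2)) : QCobar s →ₐ[ℚ] QCobar (s + 1) :=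
  aeval (Sum.elim (vAt (s + 1) (i.succAbove 0))
    (fun p => tAt (s + 1) (i.succAbove p.1.castSucc) (i.succAbove p.1.succ) (p.2 + 1)))

theorem hazewinkel_zero (s : ℕ) : hazewinkel s 0 = 1 := by rw [hazewinkel]

theorem ghost_hazewinkel (s n : ℕ) :
    ghost (hazewinkel s) (v ℚ s) n = 2 * hazewinkel s (n + 1) := by
  conv_rhs => rw [hazewinkel]
  have h2 : (2 : QCobar s) * C (1 / 2) = 1 := by
    rw [show (2 : QCobar s) = C 2 from (map_ofNat C 2).symm, ← C_mul]; norm_num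
  rw [← mul_assoc, h2, one_mul, ghost,
    Finset.Nat.sum_antidiagonal_eq_sum_range_succ (fun i k => hazewinkel s i * v ℚ s k ^ 2 ^ i),
    Finset.sum_range]

theorem logs_zero (s : ℕ) : logs s 0 = hazewinkel s := rfl

theorem logs_succ (s : ℕ) (a : Fin s) :
    logs s a.succ = ghost (logs s a.castSucc) (t ℚ s a) := by
  simp [logs]

theorem ghost_zero {R : Type} [CommRing R] (M a : ℕ → R) : ghost M a 0 = M 0 * a 0 := by
  simp [ghost]

theorem logs_apply_zero (s : ℕ) (b : Fin (s + 1)) : logs s b 0 = 1 := by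
  induction b using Fin.induction with
  | zero => exact hazewinkel_zero s
  | succ a ih => rw [logs_succ, ghost_zero, ih]; simp [t]

theorem tAt_zero (s : ℕ) (b b' : Fin (s + 1)) : tAt s b b' 0 = 1 := by
  rw [tAt, unghost]; simp [logs_apply_zero]

theorem vAt_zero (s : ℕ) : vAt s 0 = v ℚ s := by
  rw [vAt, logs_zero, ← unghost_ghost (hazewinkel s) (v ℚ s) (hazewinkel_zero s)]
  congr 1
  funext n
  rw [ghost_hazewinkel]

theorem tAt_succ (s : ℕ) (a : Fin s) : tAt s a.castSucc a.succ = t ℚ s a := by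
  rw [tAt, logs_succ, unghost_ghost _ _ (logs_apply_zero s _)]

theorem cofaceQ_v (s : ℕ) (i : Fin (s + 2)) (n : ℕ) :
    cofaceQ s i (v ℚ s n) = vAt (s + 1) (i.succAbove 0) n := by
  simp [cofaceQ, v]

theorem cofaceQ_t (s : ℕ) (i : Fin (s + 2)) (a : Fin s) (n : ℕ) :
    cofaceQ s i (t ℚ s a n) =
      tAt (s + 1) (i.succAbove a.castSucc) (i.succAbove a.succ) n := by
  cases n with
  | zero => simp [t, tAt_zero]
  | succ n => simp [cofaceQ, t]

/-- The coface maps relabel the logarithms. -/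
theorem cofaceQ_logs (s : ℕ) (i : Fin (s + 2)) (b : Fin (s + 1)) (n : ℕ) :
    cofaceQ s i (logs s b n) = logs (s + 1) (i.succAbove b) n := by
  induction b using Fin.induction generalizing n with
  | zero =>
    rw [logs_zero]
    induction n using Nat.strong_induction_on with
    | _ n ih =>
      cases n with
      | zero => rw [hazewinkel_zero, logs_apply_zero, map_one]
      | succ n =>
        have h1 := congrArg (cofaceQ s i) (ghost_hazewinkel s n)
        have h2 := map_ghost (cofaceQ s i) (hazewinkel s) (v ℚ s) n
        have h3 : (2 : QCobar (s + 1)) * logs (s + 1) (i.succAbove 0) (n + 1) =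
            ghost (logs (s + 1) (i.succAbove 0)) (vAt (s + 1) (i.succAbove 0)) n := by
          rw [vAt, ghost_unghost _ _ (logs_apply_zero _ _)]
        have h4 : (2 : QCobar (s + 1)) * cofaceQ s i (hazewinkel s (n + 1)) =
            2 * logs (s + 1) (i.succAbove 0) (n + 1) := by
          rw [h3]
          rw [map_mul] at h1
          rw [show (2 : QCobar (s + 1)) = cofaceQ s i 2 from (map_ofNat _ 2).symm, ← h1]
          refine h2.trans ?_
          unfold ghost
          refine Finset.sum_congr rfl fun p hp => ?_
          have hp' : p.1 < n + 1 := by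
            have := mem_antidiagonal.1 hp; omega
          have e1 : cofaceQ s i (hazewinkel s p.1) =
            logs (s + 1) (i.succAbove 0) p.1 := ih _ hp'
          have e2 : cofaceQ s i (v ℚ s p.2) = vAt (s + 1) (i.succAbove 0) p.2 :=
            cofaceQ_v s i p.2
          simp only [e1, e2]
        exact mul_left_cancel₀ two_ne_zero h4
  | succ a ih =>
    rw [logs_succ]
    rw [map_ghost]
    simp only [ih, cofaceQ_t]
    exact congrFun (ghost_unghost (logs (s + 1) (i.succAbove a.castSucc))
      (logs (s + 1) (i.succAbove a.succ)) (logs_apply_zero _ _)) n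

theorem cofaceQ_vAt (s : ℕ) (i : Fin (s + 2)) (b : Fin (s + 1)) (n : ℕ) :
    cofaceQ s i (vAt s b n) = vAt (s + 1) (i.succAbove b) n := by
  refine (map_unghost (cofaceQ s i) _ _ n).trans ?_
  simp only [vAt, cofaceQ_logs, map_mul, map_ofNat]

theorem cofaceQ_tAt (s : ℕ) (i : Fin (s + 2)) (b b' : Fin (s + 1)) (n : ℕ) :
    cofaceQ s i (tAt s b b' n) = tAt (s + 1) (i.succAbove b) (i.succAbove b') n := by
  refine (map_unghost (cofaceQ s i) _ _ n).trans ?_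
  simp only [tAt, cofaceQ_logs]

/-- The cosimplicial identities. -/
theorem cofaceQ_cofaceQ (s : ℕ) (i : Fin (s + 3)) (j : Fin (s + 2)) (x : QCobar s) :
    cofaceQ (s + 1) (i.succAbove j) (cofaceQ s (j.predAbove i) x) =
      cofaceQ (s + 1) i (cofaceQ s j x) := by
  suffices h : (cofaceQ (s + 1) (i.succAbove j)).comp (cofaceQ s (j.predAbove i)) =
      (cofaceQ (s + 1) i).comp (cofaceQ s j) from DFunLike.congr_fun h x
  refine MvPolynomial.algHom_ext fun g => ?_
  rcases g with n | ⟨a, n⟩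
  · have h1 := fun k => cofaceQ_v s k n
    simp only [v] at h1
    simp only [AlgHom.comp_apply, h1, cofaceQ_vAt,
      Fin.succAbove_succAbove_succAbove_predAbove]
  · have h1 := fun k => cofaceQ_t s k a (n + 1)
    simp only [t] at h1
    simp only [AlgHom.comp_apply, h1, cofaceQ_tAt,
      Fin.succAbove_succAbove_succAbove_predAbove]

/-- The invariant ideal `I = (2, v_1, v_2, …)`, extended to the `s`-cochains. -/
def augI (s : ℕ) : Ideal (Cobar s) := Ideal.span (insert 2 (Set.range (v ZLoc s)))

/-! ### Integrality of the coface maps -/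

section Integrality

variable {s : ℕ}

/-- Image of the integral cochains in the rational cochains. -/
def IsInt (x : QCobar s) : Prop := ∃ y : Cobar s, toQ s y = x

/-- Image of `I` in the rational cochains. -/
def IsSmall (x : QCobar s) : Prop := ∃ y ∈ augI s, toQ s y = x

theorem IsSmall.isInt {x : QCobar s} (h : IsSmall x) : IsInt x := by
  obtain ⟨y, -, h⟩ := h; exact ⟨y, h⟩

theorem IsInt.add {x y : QCobar s} (hx : IsInt x) (hy : IsInt y) : IsInt (x + y) := by
  obtain ⟨a, rfl⟩ := hx; obtain ⟨b, rfl⟩ := hy; exact ⟨a + b, map_add _ _ _⟩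

theorem IsInt.sub {x y : QCobar s} (hx : IsInt x) (hy : IsInt y) : IsInt (x - y) := by
  obtain ⟨a, rfl⟩ := hx; obtain ⟨b, rfl⟩ := hy; exact ⟨a - b, map_sub _ _ _⟩

theorem IsInt.mul {x y : QCobar s} (hx : IsInt x) (hy : IsInt y) : IsInt (x * y) := by
  obtain ⟨a, rfl⟩ := hx; obtain ⟨b, rfl⟩ := hy; exact ⟨a * b, map_mul _ _ _⟩

theorem IsInt.pow {x : QCobar s} (hx : IsInt x) (n : ℕ) : IsInt (x ^ n) := by
  obtain ⟨a, rfl⟩ := hx; exact ⟨a ^ n, map_pow _ _ _⟩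

theorem isInt_one : IsInt (1 : QCobar s) := ⟨1, map_one _⟩

theorem isInt_zero : IsInt (0 : QCobar s) := ⟨0, map_zero _⟩

theorem isInt_two : IsInt (2 : QCobar s) := ⟨2, map_ofNat _ 2⟩

theorem isInt_sum {ι : Type} (A : Finset ι) (f : ι → QCobar s) (h : ∀ i ∈ A, IsInt (f i)) :
    IsInt (∑ i ∈ A, f i) := by
  classical
  induction A using Finset.induction_on with
  | empty => simpa using isInt_zero
  | insert a A ha ih =>
    rw [Finset.sum_insert ha]
    exact (h a (Finset.mem_insert_self a A)).add
      (ih fun i hi => h i (Finset.mem_insert_of_mem hi))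

theorem isSmall_zero : IsSmall (0 : QCobar s) := ⟨0, zero_mem _, map_zero _⟩

theorem IsSmall.add {x y : QCobar s} (hx : IsSmall x) (hy : IsSmall y) : IsSmall (x + y) := by
  obtain ⟨a, ha, rfl⟩ := hx; obtain ⟨b, hb, rfl⟩ := hy
  exact ⟨a + b, add_mem ha hb, map_add _ _ _⟩

theorem IsSmall.sub {x y : QCobar s} (hx : IsSmall x) (hy : IsSmall y) : IsSmall (x - y) := by
  obtain ⟨a, ha, rfl⟩ := hx; obtain ⟨b, hb, rfl⟩ := hy
  exact ⟨a - b, sub_mem ha hb, map_sub _ _ _⟩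

theorem IsSmall.mul_left {x y : QCobar s} (hx : IsInt x) (hy : IsSmall y) :
    IsSmall (x * y) := by
  obtain ⟨a, rfl⟩ := hx; obtain ⟨b, hb, rfl⟩ := hy
  exact ⟨a * b, Ideal.mul_mem_left _ _ hb, map_mul _ _ _⟩

theorem isSmall_sum {ι : Type} (A : Finset ι) (f : ι → QCobar s) (h : ∀ i ∈ A, IsSmall (f i)) :
    IsSmall (∑ i ∈ A, f i) := by
  classical
  induction A using Finset.induction_on with
  | empty => simpa using isSmall_zero
  | insert a A ha ih =>
    rw [Finset.sum_insert ha]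
    exact (h a (Finset.mem_insert_self a A)).add
      (ih fun i hi => h i (Finset.mem_insert_of_mem hi))

theorem isSmall_two : IsSmall (2 : QCobar s) :=
  ⟨2, Ideal.subset_span (Set.mem_insert _ _), map_ofNat _ 2⟩

theorem toQ_v (n : ℕ) : toQ s (v ZLoc s n) = v ℚ s n := by simp [toQ, v]

theorem toQ_t (a : Fin s) (n : ℕ) : toQ s (t ZLoc s a n) = t ℚ s a n := by
  cases n <;> simp [toQ, t]

theorem isSmall_v (n : ℕ) : IsSmall (v ℚ s n) :=
  ⟨v ZLoc s n, Ideal.subset_span (Set.mem_insert_of_mem _ ⟨n, rfl⟩), toQ_v n⟩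

theorem isInt_t (a : Fin s) (n : ℕ) : IsInt (t ℚ s a n) := ⟨_, toQ_t a n⟩

theorem IsSmall.pow {x : QCobar s} (hx : IsSmall x) {n : ℕ} (hn : n ≠ 0) : IsSmall (x ^ n) := by
  obtain ⟨m, rfl⟩ := Nat.exists_eq_succ_of_ne_zero hn
  rw [pow_succ]
  exact IsSmall.mul_left (hx.isInt.pow m) hx

theorem IsSmall.pow_sub_pow {x y : QCobar s} (hx : IsInt x) (hy : IsInt y)
    (h : IsSmall (x - y)) (n : ℕ) : IsSmall (x ^ n - y ^ n) := by
  obtain ⟨a, rfl⟩ := hx; obtain ⟨b, rfl⟩ := hy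
  obtain ⟨c, hc, hc'⟩ := h
  rw [← map_sub] at hc'
  have := toQ_injective s hc'
  subst this
  exact ⟨a ^ n - b ^ n, Ideal.mem_of_dvd _ (sub_dvd_pow_sub_pow a b n) hc, by simp⟩

theorem exists_expand_sub_pow (k : ℕ) (y : Cobar s) :
    ∃ z, expand (2 ^ k) y - y ^ 2 ^ k = 2 * z := by
  induction y using MvPolynomial.induction_on with
  | C c =>
    obtain ⟨e, he⟩ : ∃ e : ZLoc, c ^ 2 ^ k - c = 2 * e := by
      induction k with
      | zero => exact ⟨0, by simp⟩
      | succ k ih =>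
        obtain ⟨e, he⟩ := ih
        obtain ⟨e', he'⟩ := ZLoc.sq_sub_self (c ^ 2 ^ k)
        exact ⟨e' + e, by rw [pow_succ, pow_mul, mul_add, ← he', ← he]; ring⟩
    refine ⟨-C e, ?_⟩
    rw [expand_C, ← C_pow, ← C_sub, ← neg_sub, he, C_neg, C_mul, map_ofNat C 2]
    ring
  | add x y hx hy =>
    obtain ⟨a, ha⟩ := hx
    obtain ⟨b, hb⟩ := hy
    obtain ⟨r, hr⟩ := exists_add_pow_prime_pow_eq Nat.prime_two x y k
    refine ⟨a + b - x * y * r, ?_⟩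
    rw [hr, map_add, eq_add_of_sub_eq ha, eq_add_of_sub_eq hb]
    push_cast
    ring
  | mul_X x i hx =>
    obtain ⟨a, ha⟩ := hx
    refine ⟨a * X i ^ 2 ^ k, ?_⟩
    rw [map_mul, expand_X, mul_pow, ← sub_mul, ha, mul_assoc]

theorem IsInt.expand {x : QCobar s} (hx : IsInt x) (k : ℕ) :
    IsInt (MvPolynomial.expand k x) := by
  obtain ⟨a, rfl⟩ := hx
  exact ⟨MvPolynomial.expand k a, map_expand _ _ _⟩

theorem expand_v (k n : ℕ) : expand k (v ℚ s n) = v ℚ s n ^ k := expand_X _ _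

theorem expand_t (k : ℕ) (a : Fin s) (n : ℕ) : expand k (t ℚ s a n) = t ℚ s a n ^ k := by
  cases n with
  | zero => simp [t]
  | succ n => exact expand_X _ _

/-- `1, -v_1/2, -v_2/2, …`. -/
def dworkCoeff (s : ℕ) : ℕ → QCobar s
  | 0 => 1
  | k + 1 => -(C (1 / 2) * v ℚ s k)

/-- `M_n - ∑_{k ≥ 1} (v_k / 2) σ^k(M_{n-k})`, where `σ` squares all `v_i` and `t_i`. -/
def dwork (M : ℕ → QCobar s) (n : ℕ) : QCobar s :=
  ∑ p ∈ antidiagonal n, dworkCoeff s p.1 * expand (2 ^ p.1) (M p.2)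

theorem dwork_apply_zero (M : ℕ → QCobar s) : dwork M 0 = M 0 := by
  simp [dwork, dworkCoeff]

theorem isSmall_aux (k i : ℕ) (a M : QCobar s) (ha : k ≠ 0 → IsInt a) (hM : IsInt (2 ^ i * M)) :
    IsSmall (dworkCoeff s k * expand (2 ^ k) M *
      (a ^ 2 ^ (k + i) - expand (2 ^ k) a ^ 2 ^ i)) := by
  rcases k with _ | k
  · simpa using isSmall_zero
  · obtain ⟨y, rfl⟩ := ha (by simp)
    obtain ⟨z, hz⟩ := exists_expand_sub_pow (k + 1) y
    have h2 : (2 : Cobar s) ∣ y ^ 2 ^ (k + 1) - expand (2 ^ (k + 1)) y :=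
      ⟨-z, by rw [← neg_sub, hz]; ring⟩
    obtain ⟨w, hw⟩ := dvd_sub_pow_of_dvd_sub (p := 2) (by exact_mod_cast h2) i
    have hw' := congrArg (toQ s) hw
    rw [map_sub, map_pow, map_pow, map_pow, show toQ s (expand (2 ^ (k + 1)) y) =
      expand (2 ^ (k + 1)) (toQ s y) from map_expand _ _ _, ← pow_mul, ← pow_add] at hw'
    rw [hw', map_mul, map_pow]
    have hc : (C (1 / 2) : QCobar s) * 2 = 1 := by
      rw [show (2 : QCobar s) = C 2 from (map_ofNat C 2).symm, ← C_mul]; norm_num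
    have he : expand (2 ^ (k + 1)) ((2 : QCobar s) ^ i * M) =
        2 ^ i * expand (2 ^ (k + 1)) M := by rw [map_mul, map_pow, map_ofNat]
    have key : dworkCoeff s (k + 1) * expand (2 ^ (k + 1)) M *
        (toQ s ((2 : ℕ) : Cobar s) ^ (i + 1) * toQ s w) =
        (toQ s (-w) * expand (2 ^ (k + 1)) (2 ^ i * M)) * v ℚ s k := by
      rw [he, map_neg]
      have : toQ s ((2 : ℕ) : Cobar s) = 2 := map_natCast _ 2
      rw [this, dworkCoeff, pow_succ _ i]
      linear_combination (-(v ℚ s k) * expand (2 ^ (k + 1)) M * 2 ^ i * toQ s w) * hc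
    rw [key]
    exact IsSmall.mul_left (IsInt.mul ⟨_, rfl⟩ (hM.expand _)) (isSmall_v k)

theorem ghost_dwork_sub (M a : ℕ → QCobar s) (n : ℕ) :
    ghost (dwork M) a n - dwork (ghost M a) n =
      ∑ p ∈ antidiagonal n, ∑ q ∈ antidiagonal p.2,
        dworkCoeff s p.1 * expand (2 ^ p.1) (M q.1) *
          (a q.2 ^ 2 ^ (p.1 + q.1) - expand (2 ^ p.1) (a q.2) ^ 2 ^ q.1) := by
  have h1 : ghost (dwork M) a n = ∑ p ∈ antidiagonal n, ∑ q ∈ antidiagonal p.2,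
      dworkCoeff s p.1 * expand (2 ^ p.1) (M q.1) * a q.2 ^ 2 ^ (p.1 + q.1) := by
    rw [sum_antidiagonal_assoc (fun k i j =>
      dworkCoeff s k * expand (2 ^ k) (M i) * a j ^ 2 ^ (k + i)), ghost]
    refine Finset.sum_congr rfl fun p _ => ?_
    rw [dwork, Finset.sum_mul]
    refine Finset.sum_congr rfl fun q hq => ?_
    rw [mem_antidiagonal.1 hq]
  rw [h1, dwork, ← Finset.sum_sub_distrib]
  refine Finset.sum_congr rfl fun p _ => ?_
  rw [ghost, map_sum, Finset.mul_sum, ← Finset.sum_sub_distrib]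
  refine Finset.sum_congr rfl fun q _ => ?_
  rw [map_mul, map_pow]
  ring

theorem isSmall_ghost_dwork_sub (M a : ℕ → QCobar s) (n : ℕ) (hM : ∀ i, IsInt (2 ^ i * M i))
    (ha : ∀ j < n, IsInt (a j)) : IsSmall (ghost (dwork M) a n - dwork (ghost M a) n) := by
  rw [ghost_dwork_sub]
  refine isSmall_sum _ _ fun p hp => isSmall_sum _ _ fun q hq => ?_
  refine isSmall_aux _ _ _ _ (fun hk => ha _ ?_) (hM _)
  have h1 := mem_antidiagonal.1 hp
  have h2 := mem_antidiagonal.1 hq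
  omega

theorem dwork_ghost (M a : ℕ → QCobar s) (ha : ∀ k j, expand k (a j) = a j ^ k) :
    dwork (ghost M a) = ghost (dwork M) a := by
  funext n
  symm
  rw [← sub_eq_zero, ghost_dwork_sub]
  refine Finset.sum_eq_zero fun p _ => Finset.sum_eq_zero fun q _ => ?_
  rw [ha, ← pow_mul, ← pow_add, sub_self, mul_zero]

theorem isInt_two_pow_mul (M : ℕ → QCobar s) (h : ∀ n, IsInt (dwork M n)) (n : ℕ) :
    IsInt (2 ^ n * M n) := by
  induction n using Nat.strong_induction_on with
  | _ n ih =>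
    cases n with
    | zero => simpa [dwork_apply_zero] using h 0
    | succ n =>
      have h1 := h (n + 1)
      rw [dwork, Finset.Nat.sum_antidiagonal_succ] at h1
      simp only [dworkCoeff, pow_zero, expand_one_apply, one_mul] at h1
      have h2 : (2 : QCobar s) ^ (n + 1) * M (n + 1) =
          2 ^ (n + 1) * (M (n + 1) + ∑ p ∈ antidiagonal n,
            -(C (1 / 2) * v ℚ s p.1) * expand (2 ^ (p.1 + 1)) (M p.2)) +
          ∑ p ∈ antidiagonal n, (2 ^ p.1 * v ℚ s p.1) *
            expand (2 ^ (p.1 + 1)) (2 ^ p.2 * M p.2) := by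
        rw [mul_add, add_assoc, left_eq_add, Finset.mul_sum, ← Finset.sum_add_distrib]
        refine Finset.sum_eq_zero fun p hp => ?_
        have hc : (C (1 / 2) : QCobar s) * 2 = 1 := by
          rw [show (2 : QCobar s) = C 2 from (map_ofNat C 2).symm, ← C_mul]; norm_num
        rw [← mem_antidiagonal.1 hp, map_mul, map_pow, map_ofNat]
        linear_combination (-(2 ^ (p.1 + p.2) * v ℚ s p.1 *
          expand (2 ^ (p.1 + 1)) (M p.2))) * hc
      rw [h2]
      refine ((isInt_two.pow _).mul h1).add (isInt_sum _ _ fun p hp => ?_)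
      refine ((isInt_two.pow _).mul (isSmall_v _).isInt).mul ((ih _ ?_).expand _)
      have := mem_antidiagonal.1 hp
      omega

theorem isInt_unghost (M g : ℕ → QCobar s) (hM0 : M 0 = 1) (hM : ∀ n, IsInt (dwork M n))
    (hg : ∀ n, IsInt (dwork g n)) (n : ℕ) : IsInt (unghost M g n) := by
  induction n using Nat.strong_induction_on with
  | _ n ih =>
    have h1 := isSmall_ghost_dwork_sub M (unghost M g) n (isInt_two_pow_mul M hM) ih
    rw [ghost_unghost _ _ hM0, ghost_eq _ _ _ (by rw [dwork_apply_zero, hM0])] at h1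
    have h2 := (h1.isInt.add (hg n)).sub (isInt_sum (Finset.univ : Finset (Fin n))
      (fun i => dwork M (n - i) * unghost M g i ^ 2 ^ (n - i : ℕ))
      (fun i _ => (hM _).mul ((ih i i.2).pow _)))
    convert h2 using 1
    ring

theorem isSmall_ghost_unghost (M g : ℕ → QCobar s) (hM0 : M 0 = 1)
    (hM : ∀ n, IsInt (dwork M n)) (hg : ∀ n, IsInt (dwork g n)) (n : ℕ) :
    IsSmall (ghost (dwork M) (unghost M g) n - dwork g n) := by
  have h1 := isSmall_ghost_dwork_sub M (unghost M g) n (isInt_two_pow_mul M hM)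
    (fun j _ => isInt_unghost M g hM0 hM hg j)
  rwa [ghost_unghost _ _ hM0] at h1

theorem dwork_two_mul_shift (M : ℕ → QCobar s) (hM0 : M 0 = 1) (n : ℕ) :
    dwork (fun k => 2 * M (k + 1)) n = 2 * dwork M (n + 1) + v ℚ s n := by
  rw [dwork, dwork, Finset.Nat.sum_antidiagonal_succ']
  have hc : (C (1 / 2) : QCobar s) * 2 = 1 := by
    rw [show (2 : QCobar s) = C 2 from (map_ofNat C 2).symm, ← C_mul]; norm_num
  simp only [hM0, map_one, dworkCoeff, map_mul, map_ofNat]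
  rw [mul_add, Finset.mul_sum, Finset.sum_congr rfl fun p _ => mul_left_comm _ _ _]
  linear_combination (v ℚ s n) * hc

theorem dwork_hazewinkel (n : ℕ) : dwork (hazewinkel s) (n + 1) = 0 := by
  induction n using Nat.strong_induction_on with
  | _ n ih =>
    have h1 := dwork_two_mul_shift (hazewinkel s) (hazewinkel_zero s) n
    have h2 : (fun k => 2 * hazewinkel s (k + 1)) = ghost (hazewinkel s) (v ℚ s) :=
      funext fun k => (ghost_hazewinkel s k).symm
    rw [h2, dwork_ghost _ _ (fun k j => expand_v k j),
      ghost_eq _ _ _ (by rw [dwork_apply_zero, hazewinkel_zero])] at h1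
    have h3 : ∀ i : Fin n, dwork (hazewinkel s) (n - i) = 0 := by
      intro i
      have hi := i.2
      obtain ⟨m, hm⟩ : ∃ m, n - i = m + 1 := ⟨n - i - 1, by omega⟩
      rw [hm]
      exact ih m (by omega)
    simp only [h3, zero_mul, Finset.sum_const_zero, add_zero, right_eq_add] at h1
    simpa using h1

theorem dwork_logs_succ (a : Fin s) :
    dwork (logs s a.succ) = ghost (dwork (logs s a.castSucc)) (t ℚ s a) := by
  rw [logs_succ, dwork_ghost _ _ (fun k j => expand_t k a j)]

theorem isInt_dwork_logs (b : Fin (s + 1)) (n : ℕ) : IsInt (dwork (logs s b) n) := by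
  induction b using Fin.induction generalizing n with
  | zero =>
    rw [logs_zero]
    cases n with
    | zero => rw [dwork_apply_zero, hazewinkel_zero]; exact isInt_one
    | succ n => rw [dwork_hazewinkel]; exact isInt_zero
  | succ a ih =>
    rw [dwork_logs_succ]
    exact isInt_sum _ _ fun p _ => (ih _).mul ((isInt_t _ _).pow _)

/-- `Δ(t_n)` and its analogues are integral. -/
theorem isInt_tAt (b b' : Fin (s + 1)) (n : ℕ) : IsInt (tAt s b b' n) :=
  isInt_unghost _ _ (logs_apply_zero s b) (isInt_dwork_logs b) (isInt_dwork_logs b') n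

/-- The units are integral and map `v_n` into the ideal `I`, which is thus invariant. -/
theorem isSmall_vAt (b : Fin (s + 1)) (n : ℕ) : IsSmall (vAt s b n) := by
  have hg : ∀ n, IsSmall (dwork (fun k => 2 * logs s b (k + 1)) n) := by
    intro n
    rw [dwork_two_mul_shift _ (logs_apply_zero s b), mul_comm]
    exact (IsSmall.mul_left (isInt_dwork_logs b _) isSmall_two).add (isSmall_v n)
  induction n using Nat.strong_induction_on with
  | _ n ih =>
    have h1 := isSmall_ghost_unghost (logs s b) _ (logs_apply_zero s b) (isInt_dwork_logs b)
      (fun n => (hg n).isInt) n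
    change IsSmall (ghost _ (vAt s b) n - _) at h1
    rw [ghost_eq _ _ _ (by rw [dwork_apply_zero, logs_apply_zero])] at h1
    have h2 := (h1.add (hg n)).sub (isSmall_sum (Finset.univ : Finset (Fin n))
      (fun i => dwork (logs s b) (n - i) * vAt s b i ^ 2 ^ (n - i : ℕ))
      (fun i _ => IsSmall.mul_left (isInt_dwork_logs b _) ((ih i i.2).pow (by positivity))))
    convert h2 using 1
    ring

theorem isSmall_of_ghost (N a c : ℕ → QCobar s) (hN0 : N 0 = 1) (hN : ∀ n, IsInt (N n))
    (ha : ∀ n, IsInt (a n)) (hc : ∀ n, IsInt (c n))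
    (h : ∀ n, IsSmall (ghost N a n - ghost N c n)) (n : ℕ) : IsSmall (a n - c n) := by
  induction n using Nat.strong_induction_on with
  | _ n ih =>
    have h1 := h n
    rw [ghost_eq _ _ _ hN0, ghost_eq _ _ _ hN0] at h1
    have h2 := h1.sub (isSmall_sum (Finset.univ : Finset (Fin n))
      (fun i => N (n - i) * (a i ^ 2 ^ (n - i : ℕ) - c i ^ 2 ^ (n - i : ℕ)))
      (fun i _ => IsSmall.mul_left (hN _) (IsSmall.pow_sub_pow (ha i) (hc i) (ih i i.2) _)))
    convert h2 using 1
    simp only [mul_sub, Finset.sum_sub_distrib]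
    ring

theorem isInt_ghost (N a : ℕ → QCobar s) (hN : ∀ n, IsInt (N n)) (ha : ∀ n, IsInt (a n))
    (n : ℕ) : IsInt (ghost N a n) :=
  isInt_sum _ _ fun _ _ => (hN _).mul ((ha _).pow _)

/-- Modulo `I` the coproduct is `Δ(t_n) = ∑_{l+j=n} t_l ⊗ t_j^{2^l}`. -/
theorem isSmall_tAt_sub (a : Fin s) (n : ℕ) :
    IsSmall (tAt (s + 1) a.castSucc.castSucc a.succ.succ n -
      ghost (t ℚ (s + 1) a.castSucc) (t ℚ (s + 1) a.succ) n) := by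
  set N := dwork (logs (s + 1) a.castSucc.castSucc) with hNdef
  have hN0 : N 0 = 1 := by rw [hNdef, dwork_apply_zero, logs_apply_zero]
  have hN : ∀ n, IsInt (N n) := isInt_dwork_logs _
  have hc := isInt_ghost (s := s + 1) _ _ (isInt_t a.castSucc) (isInt_t a.succ)
  refine isSmall_of_ghost N _ _ hN0 hN (isInt_tAt _ _) hc (fun n => ?_) n
  have h1 := isSmall_ghost_unghost (logs (s + 1) a.castSucc.castSucc)
    (logs (s + 1) a.succ.succ) (logs_apply_zero _ _) (isInt_dwork_logs _) (isInt_dwork_logs _) n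
  have h2 : dwork (logs (s + 1) a.succ.succ) n =
      ∑ p ∈ antidiagonal n, N p.1 *
        expand (2 ^ p.1) (ghost (t ℚ (s + 1) a.castSucc) (t ℚ (s + 1) a.succ) p.2) := by
    rw [dwork_logs_succ, show a.succ.castSucc = a.castSucc.succ from rfl, dwork_logs_succ, ghost]
    have : ∀ p ∈ antidiagonal n, ghost (dwork (logs (s + 1) a.castSucc.castSucc))
        (t ℚ (s + 1) a.castSucc) p.1 * t ℚ (s + 1) a.succ p.2 ^ 2 ^ p.1 =
        ∑ q ∈ antidiagonal p.1, N q.1 * (t ℚ (s + 1) a.castSucc q.2 ^ 2 ^ q.1 *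
          t ℚ (s + 1) a.succ p.2 ^ 2 ^ (q.1 + q.2)) := by
      intro p _
      rw [ghost, Finset.sum_mul]
      refine Finset.sum_congr rfl fun q hq => ?_
      rw [mem_antidiagonal.1 hq, mul_assoc]
    rw [Finset.sum_congr rfl this, ← sum_antidiagonal_assoc (fun i l j =>
      N i * (t ℚ (s + 1) a.castSucc l ^ 2 ^ i * t ℚ (s + 1) a.succ j ^ 2 ^ (i + l)))]
    refine Finset.sum_congr rfl fun p _ => ?_
    rw [ghost, map_sum, Finset.mul_sum]
    refine Finset.sum_congr rfl fun q _ => ?_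
    rw [map_mul, map_pow, expand_t, expand_t, ← pow_mul, ← pow_add]
  have h3 : IsSmall (dwork (logs (s + 1) a.succ.succ) n -
      ghost N (ghost (t ℚ (s + 1) a.castSucc) (t ℚ (s + 1) a.succ)) n) := by
    rw [h2, ghost, ← Finset.sum_sub_distrib]
    refine isSmall_sum _ _ fun p _ => ?_
    rw [← mul_sub]
    refine IsSmall.mul_left (hN _) ?_
    obtain ⟨y, hy⟩ := hc p.2
    obtain ⟨z, hz⟩ := exists_expand_sub_pow p.1 y
    rw [← hy, show expand (2 ^ p.1) (toQ (s + 1) y) = toQ (s + 1) (expand (2 ^ p.1) y) from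
      (map_expand _ _ _).symm, ← map_pow, ← map_sub, hz, map_mul, map_ofNat, mul_comm]
    exact IsSmall.mul_left ⟨z, rfl⟩ isSmall_two
  have h4 := h1.add h3
  convert h4 using 1
  change _ = ghost N (tAt (s + 1) a.castSucc.castSucc a.succ.succ) n - _ + _
  ring

theorem exists_coface (i : Fin (s + 2)) (g : Gen s) :
    ∃ y : Cobar (s + 1), toQ (s + 1) y = cofaceQ s i (X g) := by
  rcases g with n | ⟨a, n⟩
  · have := (isSmall_vAt (i.succAbove 0) n).isInt
    rwa [← cofaceQ_v] at this
  · have := isInt_tAt (i.succAbove a.castSucc) (i.succAbove a.succ) (n + 1)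
    rwa [← cofaceQ_t] at this

end Integrality

/-- The `i`-th coface map of the cobar complex of `BP_*BP`: the restriction of `cofaceQ` to the
integral cochains. So `coface s 0` is `x ↦ 1 ⊗ x` (which applies `η_R` to the coefficients),
`coface s i` for `0 < i ≤ s` applies `Δ` to the `i`-th tensor factor, and the last one is
`x ↦ x ⊗ 1`. -/
def coface (s : ℕ) (i : Fin (s + 2)) : Cobar s →ₐ[ZLoc] Cobar (s + 1) :=
  aeval fun g => (exists_coface i g).choose

theorem toQ_coface (s : ℕ) (i : Fin (s + 2)) (x : Cobar s) :
    toQ (s + 1) (coface s i x) = cofaceQ s i (toQ s x) := by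
  suffices h : (toQ (s + 1)).comp (coface s i).toRingHom =
      (cofaceQ s i).toRingHom.comp (toQ s) from DFunLike.congr_fun h x
  refine MvPolynomial.ringHom_ext (fun c => ?_) (fun g => ?_)
  · simp [toQ, coface, cofaceQ, MvPolynomial.algebraMap_eq]
  · have := (exists_coface i g).choose_spec
    simpa [coface, toQ] using this

/-- The differential of the cobar complex. -/
def cobarD (s : ℕ) : Cobar s →+ Cobar (s + 1) :=
  ∑ i : Fin (s + 2), (-1 : ℤ) ^ (i : ℕ) • (coface s i : Cobar s →+* Cobar (s + 1)).toAddMonoidHom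

theorem cobarD_apply (s : ℕ) (x : Cobar s) :
    cobarD s x = ∑ i : Fin (s + 2), (-1 : ℤ) ^ (i : ℕ) • coface s i x := by
  simp [cobarD]

theorem coface_coface (s : ℕ) (i : Fin (s + 3)) (j : Fin (s + 2)) (x : Cobar s) :
    coface (s + 1) (i.succAbove j) (coface s (j.predAbove i) x) =
      coface (s + 1) i (coface s j x) :=
  toQ_injective _ (by simp only [toQ_coface, cofaceQ_cofaceQ])

theorem cobarD_cobarD (s : ℕ) (x : Cobar s) : cobarD (s + 1) (cobarD s x) = 0 := by
  simp only [cobarD_apply, map_sum, map_zsmul, Finset.smul_sum, smul_smul, ← pow_add]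
  rw [Finset.sum_comm, ← Finset.sum_product']
  refine Finset.sum_involution (fun p _ => (p.1.succAbove p.2, p.2.predAbove p.1))
    ?_ ?_ ?_ ?_
  · rintro ⟨i, j⟩ -
    dsimp only
    rw [coface_coface, add_comm (j : ℕ), add_comm (Fin.predAbove j i : ℕ), Fin.neg_one_pow_succAbove_add_predAbove, neg_smul, add_neg_cancel]
  · rintro ⟨i, j⟩ - - h
    exact Fin.succAbove_ne _ _ (congrArg Prod.fst h)
  · simp
  · rintro ⟨i, j⟩ -
    simp [Fin.succAbove_succAbove_predAbove, Fin.predAbove_predAbove_succAbove]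

theorem mem_augI_of_isSmall {s : ℕ} {x : Cobar s} (h : IsSmall (toQ s x)) : x ∈ augI s := by
  obtain ⟨y, hy, hxy⟩ := h
  rwa [← toQ_injective s hxy]

/-- `I` is an invariant ideal. -/
theorem augI_le_comap (s : ℕ) (i : Fin (s + 2)) :
    augI s ≤ (augI (s + 1)).comap (coface s i) := by
  rw [augI, Ideal.span_le]
  rintro x (rfl | ⟨n, rfl⟩)
  · change coface s i 2 ∈ augI (s + 1)
    rw [map_ofNat]
    exact Ideal.subset_span (Set.mem_insert _ _)
  · refine mem_augI_of_isSmall ?_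
    rw [toQ_coface, toQ_v, cofaceQ_v]
    exact isSmall_vAt _ _

theorem coface_mem {s k : ℕ} (i : Fin (s + 2)) {x : Cobar s} (hx : x ∈ augI s ^ k) :
    coface s i x ∈ augI (s + 1) ^ k := by
  have h : augI s ^ k ≤ (augI (s + 1) ^ k).comap (coface s i) :=
    (Ideal.pow_right_mono (augI_le_comap s i) k).trans (Ideal.le_comap_pow _ k)
  exact h hx

theorem cobarD_mem {s k : ℕ} {x : Cobar s} (hx : x ∈ augI s ^ k) :
    cobarD s x ∈ augI (s + 1) ^ k := by
  rw [cobarD_apply]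
  exact sum_mem fun i _ => zsmul_mem (coface_mem i hx) _

/-! ### The algebraic Novikov spectral sequence

The cobar complex of `BP_*BP` is filtered by the powers of `I`. The internal degree is not part
of the notation: everything below is the direct sum over all internal degrees. The page that is
denoted `E_r` is the one for which `E_2^{s,k} = H^s(I^k / I^{k+1})` and
`d_r : E_r^{s,k} → E_r^{s+1,k+r-1}`. -/

/-- `I^k`, as a group of `s`-cochains. -/
def filt (s k : ℕ) : AddSubgroup (Cobar s) := (augI s ^ k).toAddSubgroup

theorem mem_filt {s k : ℕ} {x : Cobar s} : x ∈ filt s k ↔ x ∈ augI s ^ k := Iff.rfl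

theorem filt_anti {s k l : ℕ} (h : k ≤ l) : filt s l ≤ filt s k :=
  fun _ hx => Ideal.pow_le_pow_right h hx

theorem two_mul_mem_filt {s k : ℕ} {x : Cobar s} (hx : x ∈ filt s k) : 2 * x ∈ filt s (k + 1) := by
  rw [mem_filt, pow_succ']
  exact Ideal.mul_mem_mul (Ideal.subset_span (Set.mem_insert _ _)) hx

/-- The cochains in `I^k` whose differential lies in `I^{k+r-1}`. -/
def pageZ (r s k : ℕ) : AddSubgroup (Cobar s) :=
  filt s k ⊓ (filt (s + 1) (k + (r - 1))).comap (cobarD s)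

/-- The differentials of the cochains in `I^l`. -/
def dFilt : (s l : ℕ) → AddSubgroup (Cobar s)
  | 0, _ => ⊥
  | s + 1, l => (filt s l).map (cobarD s)

/-- The elements of `pageZ r s k` that vanish on the page: those in `I^{k+1}`, and the
differentials in `I^k` of cochains in `I^{k+1-(r-1)}` (`I^l` being the unit ideal for `l ≤ 0`). -/
def pageB (r s k : ℕ) : AddSubgroup (Cobar s) :=
  (filt s (k + 1) ⊓ pageZ r s k) ⊔ (dFilt s (k + 1 - (r - 1)) ⊓ filt s k)

/-- The group `E_r^{s,k}` of the algebraic Novikov spectral sequence. -/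
abbrev Page (r s k : ℕ) : Type := pageZ r s k ⧸ (pageB r s k).addSubgroupOf (pageZ r s k)

/-- The class on the `r`-th page of a cochain in `I^k` with differential in `I^{k+r-1}`. -/
def pageMk {r s k : ℕ} (x : Cobar s) (hx : x ∈ pageZ r s k) : Page r s k :=
  QuotientAddGroup.mk ⟨x, hx⟩

theorem cobarD_mem_pageZ {r s k : ℕ} {x : Cobar s} (hx : x ∈ pageZ r s k) :
    cobarD s x ∈ pageZ r (s + 1) (k + (r - 1)) := by
  refine ⟨hx.2, ?_⟩
  change cobarD (s + 1) (cobarD s x) ∈ filt (s + 1 + 1) (k + (r - 1) + (r - 1))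
  rw [cobarD_cobarD]
  exact zero_mem _

theorem cobarD_mem_pageB {r s k : ℕ} {x : Cobar s} (hx : x ∈ pageB r s k) :
    cobarD s x ∈ pageB r (s + 1) (k + (r - 1)) := by
  obtain ⟨a, ha, b, hb, rfl⟩ := AddSubgroup.mem_sup.1 hx
  have hdb : cobarD s b = 0 := by
    cases s with
    | zero => rw [show b = 0 from hb.1, map_zero]
    | succ s =>
      obtain ⟨c, -, rfl⟩ := hb.1
      exact cobarD_cobarD s c
  rw [map_add, hdb, add_zero]
  refine AddSubgroup.mem_sup_right ⟨⟨a, ?_, rfl⟩, ha.2.2⟩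
  rw [show k + (r - 1) + 1 - (r - 1) = k + 1 by omega]
  exact ha.1

/-- The differential `d_r : E_r^{s,k} → E_r^{s+1,k+r-1}`, `[x] ↦ [dx]`. -/
def pageD (r s k : ℕ) : Page r s k →+ Page r (s + 1) (k + (r - 1)) :=
  QuotientAddGroup.map _ _
    (((cobarD s).comp (pageZ r s k).subtype).codRestrict (pageZ r (s + 1) (k + (r - 1)))
      fun x => cobarD_mem_pageZ x.2)
    fun x hx => cobarD_mem_pageB (x := x.1) hx

/-- Multiplication by `q_0` (that is, by `v_0 = 2`), `E_r^{s,k} → E_r^{s,k+1}`. -/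
def q0 {r s k : ℕ} : Page r s k →+ Page r s (k + 1) :=
  QuotientAddGroup.map _ _
    (((AddMonoidHom.mulLeft (2 : Cobar s)).comp (pageZ r s k).subtype).codRestrict
      (pageZ r s (k + 1)) fun x => by
        refine ⟨two_mul_mem_filt x.2.1, ?_⟩
        change cobarD s (2 * x.1) ∈ filt (s + 1) (k + 1 + (r - 1))
        rw [two_mul, map_add, ← two_mul, show k + 1 + (r - 1) = k + (r - 1) + 1 by omega]
        exact two_mul_mem_filt x.2.2)
    fun x hx => by
      obtain ⟨a, ha, b, hb, hab⟩ := AddSubgroup.mem_sup.1 (show x.1 ∈ pageB r s k from hx)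
      change 2 * x.1 ∈ pageB r s (k + 1)
      rw [← hab, mul_add]
      refine AddSubgroup.mem_sup.2 ⟨2 * a, ⟨two_mul_mem_filt ha.1, two_mul_mem_filt ha.2.1, ?_⟩,
        2 * b, ⟨?_, two_mul_mem_filt hb.2⟩, rfl⟩
      · change cobarD s (2 * a) ∈ filt (s + 1) (k + 1 + (r - 1))
        rw [two_mul, map_add, ← two_mul, show k + 1 + (r - 1) = k + (r - 1) + 1 by omega]
        exact two_mul_mem_filt ha.2.2
      · cases s with
        | zero =>
          have hb0 : b = 0 := hb.1
          rw [hb0, mul_zero]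
          exact zero_mem _
        | succ s =>
          obtain ⟨c, hc, rfl⟩ := hb.1
          refine ⟨2 * c, filt_anti ?_ (two_mul_mem_filt hc), ?_⟩
          · omega
          · rw [two_mul, map_add, ← two_mul]

/-- The class `x` on the `E_2`-page survives to the `E_r`-page, where it becomes `x'`. -/
def Survives (r : ℕ) {s k : ℕ} (x : Page 2 s k) (x' : Page r s k) : Prop :=
  ∃ (z : Cobar s) (h2 : z ∈ pageZ 2 s k) (hr : z ∈ pageZ r s k),
    pageMk z h2 = x ∧ pageMk z hr = x'

/-- `d_r(x) = y`, for classes `x`, `y` on the `E_2`-page: both survive to the `E_r`-page, and the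
differential `d_r` there sends the one to the other. -/
def HasDifferential (r : ℕ) {s k : ℕ} (x : Page 2 s k) (y : Page 2 (s + 1) (k + (r - 1))) : Prop :=
  ∃ (x' : Page r s k) (y' : Page r (s + 1) (k + (r - 1))),
    Survives r x x' ∧ Survives r y y' ∧ pageD r s k x' = y'

/-! ### The cohomology of the Steenrod algebra -/

/-- The `s`-cochains of the cobar complex of the mod `2` dual Steenrod algebra
`A = 𝔽_2[ζ_1, ζ_2, …]`, namely `A ⊗ ⋯ ⊗ A` (`s` factors). Here `ζ_n = χ(ξ_n)` is the conjugate of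
Milnor's generator, and the variable `(a, n)` is `ζ_{n+1}` in the `a`-th tensor factor. -/
abbrev SCobar (s : ℕ) : Type := MvPolynomial (Fin s × ℕ) (ZMod 2)

/-- `ζ_n` in the `a`-th tensor factor, where `ζ_0 = 1`. -/
def zeta (s : ℕ) (a : Fin s) : ℕ → SCobar s
  | 0 => 1
  | n + 1 => X (a, n)

/-- The coface maps: `x ↦ 1 ⊗ x` for `i = 0`, the coproduct
`Δ(ζ_n) = ∑_{l+j=n} ζ_l ⊗ ζ_j^{2^l}` on the `i`-th of the `s` tensor factors for `0 < i ≤ s`, and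
`x ↦ x ⊗ 1` for `i = s + 1`. -/
def sCoface (s : ℕ) (i : Fin (s + 2)) : SCobar s →ₐ[ZMod 2] SCobar (s + 1) :=
  aeval fun p =>
    if (i : ℕ) ≤ p.1 then zeta (s + 1) p.1.succ (p.2 + 1)
    else if (i : ℕ) = p.1 + 1 then
      ∑ q ∈ antidiagonal (p.2 + 1),
        zeta (s + 1) p.1.castSucc q.1 * zeta (s + 1) p.1.succ q.2 ^ 2 ^ q.1
    else zeta (s + 1) p.1.castSucc (p.2 + 1)

/-- The differential of the cobar complex of `A`. (There are no signs in characteristic `2`.) -/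
def sCobarD (s : ℕ) : SCobar s →+ SCobar (s + 1) :=
  ∑ i : Fin (s + 2), (sCoface s i : SCobar s →+* SCobar (s + 1)).toAddMonoidHom

theorem sCobarD_apply (s : ℕ) (x : SCobar s) :
    sCobarD s x = ∑ i : Fin (s + 2), sCoface s i x := by
  simp [sCobarD]

/-- The coboundaries. -/
def sBoundary : (s : ℕ) → AddSubgroup (SCobar s)
  | 0 => ⊥
  | s + 1 => (sCobarD s).range

/-- `Ext_A^s(𝔽_2, 𝔽_2)`, the direct sum over all internal degrees. -/
abbrev ExtA (s : ℕ) : Type :=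
  (sCobarD s).ker ⧸ (sBoundary s).addSubgroupOf (sCobarD s).ker

/-- The class of a cocycle. -/
def extMk {s : ℕ} (z : SCobar s) (hz : sCobarD s z = 0) : ExtA s :=
  QuotientAddGroup.mk ⟨z, hz⟩

/-- `Ext_A^{s,t}(𝔽_2, 𝔽_2)`: the classes of cocycles of internal degree `t`, where `ζ_n` has
degree `2^n - 1`. -/
def extDegree (s t : ℕ) : AddSubgroup (ExtA s) :=
  ((weightedHomogeneousSubmodule (ZMod 2) (fun p : Fin s × ℕ => 2 ^ (p.2 + 1) - 1)
    t).toAddSubgroup.addSubgroupOf (sCobarD s).ker).map (QuotientAddGroup.mk' _)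

theorem sCobarD_sq (s : ℕ) (x : SCobar s) : sCobarD s (x ^ 2) = sCobarD s x ^ 2 := by
  rw [sCobarD_apply, sCobarD_apply, sum_pow_char 2]
  exact Finset.sum_congr rfl fun i _ => map_pow _ _ _

/-- The operation `Sq^0 : Ext_A^{s,t} → Ext_A^{s,2t}`, which is induced by the Frobenius
`[x_1|…|x_s] ↦ [x_1²|…|x_s²]` of the cobar complex. -/
def sq0 (s : ℕ) : ExtA s →+ ExtA s :=
  QuotientAddGroup.map _ _
    (((frobenius (SCobar s) 2).toAddMonoidHom.comp (sCobarD s).ker.subtype).codRestrict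
      (sCobarD s).ker fun x => by
        change sCobarD s (x.1 ^ 2) = 0
        rw [sCobarD_sq, show sCobarD s x.1 = 0 from x.2, zero_pow two_ne_zero])
    fun x hx => by
      change x.1 ^ 2 ∈ sBoundary s
      have hx' : x.1 ∈ sBoundary s := hx
      cases s with
      | zero =>
        rw [show x.1 = 0 from hx', zero_pow two_ne_zero]
        exact zero_mem _
      | succ s =>
        obtain ⟨y, hy⟩ := hx'
        exact ⟨y ^ 2, by rw [sCobarD_sq, hy]⟩

theorem sCobarD_cube (j : ℕ) :
    sCobarD 3 (zeta 3 0 1 ^ 2 ^ j * zeta 3 1 1 ^ 2 ^ j * zeta 3 2 1 ^ 2 ^ j) = 0 := by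
  have h2 : (2 : SCobar 4) = 0 := by
    rw [show (2 : SCobar 4) = ((2 : ℕ) : SCobar 4) by norm_num]
    exact CharP.cast_eq_zero _ 2
  rw [sCobarD_apply]
  simp only [Fin.sum_univ_succ, map_mul, map_pow, sCoface, zeta, aeval_X,
    Finset.Nat.antidiagonal_succ]
  simp [add_pow_char_pow]
  linear_combination ((X (1, 0) * X (2, 0) * X (3, 0) : SCobar 4) ^ 2 ^ j +
    (X (0, 0) * X (1, 0) * X (2, 0)) ^ 2 ^ j + (X (0, 0) * X (1, 0) * X (3, 0)) ^ 2 ^ j +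
    (X (0, 0) * X (2, 0) * X (3, 0)) ^ 2 ^ j) * h2

/-- `h_j^3 ∈ Ext_A^{3,3·2^j}`, where `h_j ∈ Ext_A^{1,2^j}` is the class of `[ζ_1^{2^j}]`. Products
in `Ext_A` are given by concatenation of cobar cochains. -/
def hCube (j : ℕ) : ExtA 3 :=
  extMk (zeta 3 0 1 ^ 2 ^ j * zeta 3 1 1 ^ 2 ^ j * zeta 3 2 1 ^ 2 ^ j) (sCobarD_cube j)

/-! ### Cartan–Eilenberg names -/

theorem two_eq_zero_quot (s : ℕ) : (2 : Cobar s ⧸ augI s) = 0 := by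
  have : Ideal.Quotient.mk (augI s) 2 = 0 :=
    Ideal.Quotient.eq_zero_iff_mem.2 (Ideal.subset_span (Set.mem_insert _ _))
  rwa [map_ofNat] at this

/-- The ring map `𝔽_2 → BP_*BP^{⊗ s} / I`. -/
def zmodHom (s : ℕ) : ZMod 2 →+* Cobar s ⧸ augI s :=
  ZMod.castHom (ringChar.dvd (by exact_mod_cast two_eq_zero_quot s) :
    ringChar (Cobar s ⧸ augI s) ∣ 2) _

/-- The identification of the cobar complex of `A` with that of `BP_*BP / I`, through the
Frobenius `A ≅ P`, `ζ_n ↦ ζ_n²`, and the isomorphism `P ≅ BP_*BP / I`, `ζ_n² = χ(ξ_n²) ↦ t_n`. -/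
def frobeniusName (s : ℕ) : SCobar s →+* Cobar s ⧸ augI s :=
  eval₂Hom (zmodHom s) fun p => Ideal.Quotient.mk (augI s) (t ZLoc s p.1 (p.2 + 1))

theorem frobeniusName_zeta (s : ℕ) (a : Fin s) (n : ℕ) :
    frobeniusName s (zeta s a n) = Ideal.Quotient.mk (augI s) (t ZLoc s a n) := by
  cases n with
  | zero => simp [zeta, t]
  | succ n => simp [zeta, frobeniusName]

theorem coface_t_eq {s : ℕ} (i : Fin (s + 2)) (a : Fin s) (n : ℕ) (y : Cobar (s + 1))
    (h : IsSmall (tAt (s + 1) (i.succAbove a.castSucc) (i.succAbove a.succ) n - toQ (s + 1) y)) :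
    Ideal.Quotient.mk (augI (s + 1)) (coface s i (t ZLoc s a n)) =
      Ideal.Quotient.mk (augI (s + 1)) y := by
  rw [Ideal.Quotient.eq]
  refine mem_augI_of_isSmall ?_
  rwa [map_sub, toQ_coface, toQ_t, cofaceQ_t]

theorem quot_coface_t {s : ℕ} (i : Fin (s + 2)) (a : Fin s) (n : ℕ) :
    Ideal.Quotient.mk (augI (s + 1)) (coface s i (t ZLoc s a (n + 1))) =
      frobeniusName (s + 1) (sCoface s i (X (a, n))) := by
  rw [sCoface, aeval_X]
  dsimp only
  split_ifs with h1 h2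
  · rw [frobeniusName_zeta]
    refine coface_t_eq _ _ _ _ ?_
    rw [Fin.succAbove_of_le_castSucc _ _ (by rw [Fin.le_def]; simpa using h1),
      Fin.succAbove_of_le_castSucc _ _ (by rw [Fin.le_def]; simpa using Nat.le_succ_of_le h1),
      toQ_t, show a.castSucc.succ = a.succ.castSucc from rfl, tAt_succ, sub_self]
    exact isSmall_zero
  · have : frobeniusName (s + 1) (∑ q ∈ antidiagonal (n + 1),
        zeta (s + 1) a.castSucc q.1 * zeta (s + 1) a.succ q.2 ^ 2 ^ q.1) =
        Ideal.Quotient.mk (augI (s + 1)) (∑ q ∈ antidiagonal (n + 1),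
          t ZLoc (s + 1) a.castSucc q.1 * t ZLoc (s + 1) a.succ q.2 ^ 2 ^ q.1) := by
      simp only [map_sum, map_mul, map_pow, frobeniusName_zeta]
    rw [this]
    refine coface_t_eq _ _ _ _ ?_
    rw [Fin.succAbove_of_castSucc_lt _ _ (by rw [Fin.lt_def]; simp [h2]),
      Fin.succAbove_of_le_castSucc _ _ (by rw [Fin.le_def]; simp [h2])]
    have h3 : toQ (s + 1) (∑ q ∈ antidiagonal (n + 1),
          t ZLoc (s + 1) a.castSucc q.1 * t ZLoc (s + 1) a.succ q.2 ^ 2 ^ q.1) =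
        ghost (t ℚ (s + 1) a.castSucc) (t ℚ (s + 1) a.succ) (n + 1) := by
      simp only [map_sum, map_mul, map_pow, toQ_t, ghost]
    rw [h3]
    exact isSmall_tAt_sub a (n + 1)
  · rw [frobeniusName_zeta]
    refine coface_t_eq _ _ _ _ ?_
    rw [Fin.succAbove_of_castSucc_lt _ _ (by rw [Fin.lt_def]; simp; omega),
      Fin.succAbove_of_castSucc_lt _ _ (by rw [Fin.lt_def]; simp; omega),
      toQ_t, show a.succ.castSucc = a.castSucc.succ from rfl, tAt_succ, sub_self]
    exact isSmall_zero

theorem quot_coface {s : ℕ} (i : Fin (s + 2)) {x : Cobar s} {z : SCobar s}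
    (h : Ideal.Quotient.mk (augI s) x = frobeniusName s z) :
    Ideal.Quotient.mk (augI (s + 1)) (coface s i x) = frobeniusName (s + 1) (sCoface s i z) := by
  have key : (Ideal.quotientMap (augI (s + 1)) (coface s i : Cobar s →+* Cobar (s + 1))
      (augI_le_comap s i)).comp (frobeniusName s) =
      (frobeniusName (s + 1)).comp (sCoface s i : SCobar s →+* SCobar (s + 1)) := by
    refine MvPolynomial.ringHom_ext' (Subsingleton.elim _ _) fun p => ?_
    have h1 : frobeniusName s (X p) = Ideal.Quotient.mk (augI s) (t ZLoc s p.1 (p.2 + 1)) := by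
      simp [frobeniusName]
    rw [RingHom.comp_apply, h1]
    exact quot_coface_t i p.1 p.2
  have h2 := DFunLike.congr_fun key z
  rw [RingHom.comp_apply, ← h] at h2
  exact h2

/-- The identification is compatible with the differentials. -/
theorem quot_cobarD {s : ℕ} {x : Cobar s} {z : SCobar s}
    (h : Ideal.Quotient.mk (augI s) x = frobeniusName s z) :
    Ideal.Quotient.mk (augI (s + 1)) (cobarD s x) = frobeniusName (s + 1) (sCobarD s z) := by
  rw [cobarD_apply, sCobarD_apply, map_sum, map_sum]
  refine Finset.sum_congr rfl fun i _ => ?_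
  rw [map_zsmul, quot_coface i h]
  rcases neg_one_pow_eq_or ℤ (i : ℕ) with h1 | h1
  · rw [h1, one_smul]
  · rw [h1, neg_one_zsmul, neg_eq_iff_add_eq_zero, ← two_mul, two_eq_zero_quot, zero_mul]

theorem mem_filt_one {s : ℕ} {x : Cobar s} :
    x ∈ filt s 1 ↔ Ideal.Quotient.mk (augI s) x = 0 := by
  rw [mem_filt, pow_one, Ideal.Quotient.eq_zero_iff_mem]

theorem mem_pageZ_of_name {s : ℕ} {x : Cobar s} {z : SCobar s} (hz : sCobarD s z = 0)
    (h : Ideal.Quotient.mk (augI s) x = frobeniusName s z) : x ∈ pageZ 2 s 0 := by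
  refine ⟨?_, ?_⟩
  · change x ∈ filt s 0
    rw [mem_filt, pow_zero, Ideal.one_eq_top]; trivial
  · change cobarD s x ∈ filt (s + 1) 1
    rw [mem_filt_one, quot_cobarD h, hz, map_zero]

theorem mem_pageB_of_boundary {s : ℕ} {x : Cobar s} {z : SCobar s} (hz : z ∈ sBoundary s)
    (hx : x ∈ pageZ 2 s 0) (h : Ideal.Quotient.mk (augI s) x = frobeniusName s z) :
    x ∈ pageB 2 s 0 := by
  cases s with
  | zero =>
    rw [show z = 0 from hz, map_zero] at h
    exact AddSubgroup.mem_sup_left ⟨mem_filt_one.2 h, hx⟩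
  | succ s =>
    obtain ⟨w, rfl⟩ := hz
    obtain ⟨y, hy⟩ := Ideal.Quotient.mk_surjective (frobeniusName s w)
    have hall : ∀ (q : ℕ) (u : Cobar q), u ∈ filt q 0 := fun q u => by
      rw [mem_filt, pow_zero, Ideal.one_eq_top]; trivial
    have h1 : x - cobarD s y ∈ filt (s + 1) 1 := by
      rw [mem_filt_one, map_sub, h, quot_cobarD hy, sub_self]
    refine AddSubgroup.mem_sup.2 ⟨x - cobarD s y, ⟨h1, hall _ _, ?_⟩, cobarD s y,
      ⟨⟨y, hall _ _, rfl⟩, hall _ _⟩, sub_add_cancel _ _⟩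
    change cobarD (s + 1) (x - cobarD s y) ∈ filt (s + 2) 1
    rw [map_sub, cobarD_cobarD, sub_zero]
    exact hx.2

theorem pageMk_eq {s : ℕ} {x y : Cobar s} (hx : x ∈ pageZ 2 s 0) (hy : y ∈ pageZ 2 s 0)
    (h : Ideal.Quotient.mk (augI s) x = Ideal.Quotient.mk (augI s) y) :
    pageMk x hx = pageMk y hy := by
  refine QuotientAddGroup.eq.2 ?_
  change -x + y ∈ pageB 2 s 0
  refine AddSubgroup.mem_sup_left ⟨?_, (pageZ 2 s 0).add_mem ((pageZ 2 s 0).neg_mem hx) hy⟩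
  change -x + y ∈ filt s 1
  rw [mem_filt_one, map_add, map_neg, h, neg_add_cancel]

/-- A lift to the cobar complex of `BP_*BP` of a cochain of `A`. -/
def nameLift {s : ℕ} (z : SCobar s) : Cobar s :=
  (Ideal.Quotient.mk_surjective (frobeniusName s z)).choose

theorem nameLift_spec {s : ℕ} (z : SCobar s) :
    Ideal.Quotient.mk (augI s) (nameLift z) = frobeniusName s z :=
  (Ideal.Quotient.mk_surjective (frobeniusName s z)).choose_spec

/-- The class on the `E_2`-page with the Cartan–Eilenberg name `a`, for `a ∈ Ext_A^s(𝔽_2, 𝔽_2)`: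
this is the map `Ext_A^{s,t}(𝔽_2, 𝔽_2) ≅ Ext_P^{s,2t}(𝔽_2, 𝔽_2) ≅ E_2^{s,0}` that sends the class of
a cocycle `z` to the class of any cochain `x` of `BP_*BP` whose reduction modulo `I` corresponds
to `z`. -/
def ceName {s : ℕ} : ExtA s →+ Page 2 s 0 :=
  QuotientAddGroup.lift _
    (AddMonoidHom.mk' (fun z : (sCobarD s).ker =>
        pageMk (nameLift z.1) (mem_pageZ_of_name z.2 (nameLift_spec z.1)))
      fun z w => by
        refine (pageMk_eq (y := nameLift z.1 + nameLift w.1) _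
          (add_mem (mem_pageZ_of_name z.2 (nameLift_spec z.1))
            (mem_pageZ_of_name w.2 (nameLift_spec w.1))) ?_).trans rfl
        rw [map_add, nameLift_spec, nameLift_spec, nameLift_spec, AddSubgroup.coe_add, map_add])
    fun z hz => by
      refine (QuotientAddGroup.eq_zero_iff _).2 ?_
      exact mem_pageB_of_boundary (z := z.1) hz (mem_pageZ_of_name z.2 (nameLift_spec z.1))
        (nameLift_spec z.1)

theorem ceName_extMk {s : ℕ} {x : Cobar s} {z : SCobar s} (hz : sCobarD s z = 0)
    (h : Ideal.Quotient.mk (augI s) x = frobeniusName s z) :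
    ceName (extMk z hz) = pageMk x (mem_pageZ_of_name hz h) :=
  pageMk_eq _ _ (by rw [h]; exact nameLift_spec z)

/-- The member `g_n = Sq^0(⋯Sq^0(g)⋯)`, for `n ≥ 1`, of the `Sq^0`-family that starts with
`g_1 = g`. -/
def sq0Family (g : ExtA 4) (n : ℕ) : ExtA 4 := (sq0 4)^[n - 1] g

end

end AlgNov

namespace AlgNov

open MvPolynomial
open Finset.HasAntidiagonal (antidiagonal mem_antidiagonal)

noncomputable section

/-! ### The bar complex of an exterior algebra -/

section Exterior

variable {β : Type} [LinearOrder β]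

/-! Write A = ζ_1|ζ_1|ζ_1. There are explicit integral cochains B (`corrOne`) and C (`corrTwo`) in
ζ_1 and ζ_2 such that the alternating sum of the cofaces of A^4 + 2B^2 + 4C, computed with integral
lifts of the coproduct formulas of the dual Steenrod algebra, is divisible by 8
(`corrPow_one_cobar`). Now replace this cochain by A^{4m} + 2B^{2m} + 4C^m with m = 2^{n+1}.
Squaring agrees modulo 2 with the substitution that squares all variables, and the congruence
improves under repeated squaring. Hence the alternating sum for m = 2 is 8G for some G, and for m =
2^{n+1} it is 8G^{2^n} modulo 16 (`sixteen_dvd_altPow_sub`).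

Substituting t_1, t_2 for ζ_1, ζ_2 gives a representative `cubeLift n` of h_{n+3}^3. The cofaces of
the cobar complex of BP_*BP agree with the integral lifts only modulo I, but 2 lies in I and 2-power
exponents turn a congruence modulo I into one modulo a high power of I (`powSum_sub_mem`). Therefore
d(`cubeLift n`) is congruent to 8G^{2^n} modulo I^4 (`cobarD_cubeLift_sub_mem`). This single
congruence contains all three differentials: d_2 and d_3 vanish because 8 lies in I^3, and d_4 is
q_0^3 times the class named G^{2^n} mod 2, which is the n-fold Sq^0 of the class of G mod 2.
Applying d once more shows that G mod 2 is a cocycle (`sCobarD_redTwo`).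

It remains to see that the class of G is the only nonzero element of Ext^{4,24}. The isomorphism
with 𝔽_2 is given by the coefficient of ζ_2²|ζ_2²|ζ_2²|ζ_2² (`squareCoeff`). It vanishes on
coboundaries, essentially because the binomial coefficient 6 of x²y² in (x+y)^4 is even
(`squareCoeff_sCobarD`), and it is 1 on G (`squareCoeff_redTwo`).

That a degree 24 cocycle with vanishing coefficient is a coboundary (`mem_range_sCobarD`) is proved
with the May filtration: each factor ζ_m^{2^j} of a monomial has weight 2m-1. The associated graded
complex is the cobar complex of a primitively generated exterior algebra. Its cohomology is spanned
by the sorted words of single generators (`exists_eq_extD`), and the coefficients there are read off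
by the symmetric sums `symCoeff`, which vanish on coboundaries. So a cochain whose leading part is a
cocycle and whose symmetric sums vanish can be moved to lower weight by a coboundary
(`exists_sub_sCobarD_mem_wtLt`). There are 31 multisets of four bits of degree 24. One is ζ_2² taken
four times; 10 are leading terms of coboundaries (`bounding`); 20 are leading terms of cochains
whose differentials have independent leading terms (`tagged`). Induction on the weight writes the
cocycle as a combination of the latter cochains plus a coboundary (`eq_add_sCobarD_of_wtLt`), and
the combination, being a cocycle, is zero (`eq_zero_of_sCobarD_eq_zero`). -/

/-- The differential of the cobar complex of a primitively generated exterior Hopf algebra over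
`𝔽_2`. A cochain is given by its coefficients on the words in the monomials, and a monomial is the
set of generators that occur in it. -/
def extD : (List (Finset β) → ZMod 2) → List (Finset β) → ZMod 2
  | _, [] => 0
  | _, [_] => 0
  | z, A :: B :: Q =>
    (if Disjoint A B then z ((A ∪ B) :: Q) else 0) + extD (fun l => z (A :: l)) (B :: Q)
termination_by _ l => l.length

theorem extD_nil (z : List (Finset β) → ZMod 2) : extD z [] = 0 := by rw [extD]

theorem extD_single (z : List (Finset β) → ZMod 2) (A : Finset β) : extD z [A] = 0 := by rw [extD]

theorem extD_cons_cons (z : List (Finset β) → ZMod 2) (A B : Finset β) (Q : List (Finset β)) :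
    extD z (A :: B :: Q) =
      (if Disjoint A B then z ((A ∪ B) :: Q) else 0) + extD (fun l => z (A :: l)) (B :: Q) := by
  rw [extD]

theorem extD_add (z w : List (Finset β) → ZMod 2) (l : List (Finset β)) :
    extD (fun l => z l + w l) l = extD z l + extD w l := by
  induction l generalizing z w with
  | nil => simp [extD_nil]
  | cons A l ih =>
    cases l with
    | nil => simp [extD_single]
    | cons B Q =>
      rw [extD_cons_cons, extD_cons_cons, extD_cons_cons, ih]
      split_ifs <;> ring

/-- The differential at a word only sees the merges of two adjacent disjoint entries. This locality
replaces the recursion in most arguments below. -/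
theorem extD_eq_zero (z : List (Finset β) → ZMod 2) (l : List (Finset β))
    (h : ∀ P A B Q, l = P ++ A :: B :: Q → Disjoint A B → z (P ++ (A ∪ B) :: Q) = 0) :
    extD z l = 0 := by
  induction l generalizing z with
  | nil => exact extD_nil z
  | cons A l ih =>
    cases l with
    | nil => exact extD_single z A
    | cons B Q =>
      rw [extD_cons_cons, ih, add_zero]
      · split_ifs with hd
        · exact h [] A B Q rfl hd
        · rfl
      · intro P A' B' Q' he hd
        exact h (A :: P) A' B' Q' (by rw [he]; rfl) hd

theorem extD_congr (z w : List (Finset β) → ZMod 2) (l : List (Finset β))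
    (h : ∀ P A B Q, l = P ++ A :: B :: Q → Disjoint A B →
      z (P ++ (A ∪ B) :: Q) = w (P ++ (A ∪ B) :: Q)) : extD z l = extD w l := by
  have h1 := extD_eq_zero (fun l => z l + w l) l fun P A B Q he hd => by
    rw [h P A B Q he hd]; exact CharTwo.add_self_eq_zero _
  rw [extD_add] at h1
  exact CharTwo.add_eq_zero.1 h1

theorem extD_zero (l : List (Finset β)) : extD (fun _ => 0) l = 0 :=
  extD_eq_zero _ _ fun _ _ _ _ _ _ => rfl

theorem extD_extD (w : List (Finset β) → ZMod 2) (l : List (Finset β)) :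
    extD (extD w) l = 0 := by
  induction l generalizing w with
  | nil => exact extD_nil _
  | cons A l ih =>
    cases l with
    | nil => exact extD_single _ _
    | cons B l =>
      cases l with
      | nil =>
        rw [extD_cons_cons, extD_single, extD_single]
        simp
      | cons C Q =>
        -- Inside the outer differential, A is either merged with the head of the remaining word or
        -- left alone. The latter part vanishes by induction; the former cancels against the terms
        -- that begin with A ∪ B.
        have h1 : extD (fun l => extD w (A :: l)) (B :: C :: Q) =
            extD (fun l => match l with
              | [] => 0
              | B :: Q => if Disjoint A B then w ((A ∪ B) :: Q) else 0) (B :: C :: Q) +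
            extD (extD (fun l => w (A :: l))) (B :: C :: Q) := by
          rw [← extD_add]
          refine extD_congr _ _ _ fun P A' B' Q' _ _ => ?_
          cases P with
          | nil => exact extD_cons_cons _ _ _ _
          | cons P0 P => exact extD_cons_cons _ _ _ _
        have h2 : extD (fun l => if Disjoint A B then w ((A ∪ B) :: l) else 0) (C :: Q) =
            if Disjoint A B then extD (fun l => w ((A ∪ B) :: l)) (C :: Q) else 0 := by
          split_ifs
          · rfl
          · exact extD_zero _
        rw [extD_cons_cons, h1, ih, add_zero, extD_cons_cons, extD_cons_cons]
        dsimp only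
        rw [h2]
        by_cases hAB : Disjoint A B <;> by_cases hBC : Disjoint B C <;>
          by_cases hAC : Disjoint A C <;>
          simp [hAB, hBC, hAC, Finset.disjoint_union_left, Finset.disjoint_union_right,
            Finset.union_assoc, CharTwo.add_self_eq_zero]

/-- Words of length `s` in nonempty subsets of `L`. -/
def IsWord (L : Finset β) (s : ℕ) (l : List (Finset β)) : Prop :=
  l.length = s ∧ ∀ A ∈ l, A.Nonempty ∧ A ⊆ L

theorem IsWord.merge {L : Finset β} {s : ℕ} {P Q : List (Finset β)} {A B : Finset β}
    (h : IsWord L (s + 1) (P ++ A :: B :: Q)) : IsWord L s (P ++ (A ∪ B) :: Q) := by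
  obtain ⟨h1, h2⟩ := h
  refine ⟨by simp at h1 ⊢; omega, fun C hC => ?_⟩
  simp only [List.mem_append, List.mem_cons] at hC h2
  rcases hC with hC | rfl | hC
  · exact h2 C (by tauto)
  · have hA := h2 A (by tauto)
    have hB := h2 B (by tauto)
    exact ⟨hA.1.mono Finset.subset_union_left, Finset.union_subset hA.2 hB.2⟩
  · exact h2 C (by tauto)

/-! ### Eliminating one generator of the exterior algebra -/

/-- No set in the word contains `x`. -/
def Avoids (x : β) (l : List (Finset β)) : Prop := ∀ A ∈ l, x ∉ A

theorem avoids_merge {x : β} {P Q : List (Finset β)} {A B : Finset β} :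
    Avoids x (P ++ (A ∪ B) :: Q) ↔ Avoids x (P ++ A :: B :: Q) := by
  simp only [Avoids, List.mem_append, List.mem_cons, or_imp, forall_and, forall_eq,
    Finset.mem_union, not_or]
  tauto

/-- Auxiliary to `slide`. -/
def slideTail (x : β) : (List (Finset β) → ZMod 2) → List (Finset β) → ZMod 2
  | f, [] => f [{x}]
  | f, A :: Q => f ({x} :: A :: Q) + if x ∈ A then 0 else slideTail x (fun l => f (A :: l)) Q
termination_by _ l => l.length

/-- The cochain whose differential cancels the coefficients on the words in which `x` occurs first
in a set `{x}` that is not at the beginning. -/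
def slide (x : β) : (List (Finset β) → ZMod 2) → List (Finset β) → ZMod 2
  | _, [] => 0
  | z, A :: Q =>
    if x ∈ A then if A = {x} then 0 else slideTail x (fun l => z (A.erase x :: l)) Q
    else slide x (fun l => z (A :: l)) Q
termination_by _ l => l.length

theorem slide_of_avoids {x : β} (z : List (Finset β) → ZMod 2) {l : List (Finset β)}
    (h : Avoids x l) : slide x z l = 0 := by
  induction l generalizing z with
  | nil => rw [slide]
  | cons A l ih =>
    rw [slide, if_neg (h A (by simp)), ih _ fun B hB => h B (by simp [hB])]

theorem slide_singleton {x : β} (z : List (Finset β) → ZMod 2) {P : List (Finset β)}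
    (Q : List (Finset β)) (h : Avoids x P) : slide x z (P ++ {x} :: Q) = 0 := by
  induction P generalizing z with
  | nil => simp [slide]
  | cons A l ih =>
    rw [List.cons_append, slide, if_neg (h A (by simp)), ih _ fun B hB => h B (by simp [hB])]

/-- The value is the sum of z over all words obtained by splitting {x} off from T ∪ {x} and moving
it to the right past sets that do not contain x. -/
theorem slide_insert {x : β} (z : List (Finset β) → ZMod 2) {P : List (Finset β)}
    (Q : List (Finset β)) {T : Finset β} (h : Avoids x P) (hT : x ∉ T) (hT' : T.Nonempty) :
    slide x z (P ++ insert x T :: Q) = slideTail x (fun l => z (P ++ T :: l)) Q := by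
  induction P generalizing z with
  | nil =>
    have : insert x T ≠ {x} := by
      intro h
      obtain ⟨y, hy⟩ := hT'
      have : y ∈ ({x} : Finset β) := h ▸ Finset.mem_insert_of_mem hy
      rw [Finset.mem_singleton] at this
      exact hT (this ▸ hy)
    rw [List.nil_append, slide, if_pos (Finset.mem_insert_self _ _), if_neg this,
      Finset.erase_insert hT]
    rfl
  | cons A l ih =>
    rw [List.cons_append, slide, if_neg (h A (by simp)), ih _ fun B hB => h B (by simp [hB])]
    rfl

/-- Adds `x` to the first set of a word. -/
def insertHead (x : β) (f : List (Finset β) → ZMod 2) : List (Finset β) → ZMod 2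
  | [] => 0
  | A :: Q => if x ∈ A then 0 else f (insert x A :: Q)

/-- The cochain `{x} :: v ↦ w v` that is supported on words beginning with `{x}`. -/
def consSingleton (x : β) (w : List (Finset β) → ZMod 2) : List (Finset β) → ZMod 2
  | [] => 0
  | A :: v => if A = {x} then w v else 0

/-- A merge that does not involve the displayed {x} and takes place to its left or right leaves {x}
as the first occurrence of x, away from the head, where w vanishes. Only the merges of {x} with its
left and its right neighbour survive. -/
theorem extD_expand {L : Finset β} {x : β} {s : ℕ} {w : List (Finset β) → ZMod 2}
    {P : List (Finset β)} {T : Finset β} {Q : List (Finset β)}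
    (H : ∀ P Q, P ≠ [] → Avoids x P → IsWord L s (P ++ {x} :: Q) → w (P ++ {x} :: Q) = 0)
    (hP : Avoids x P) (hT : x ∉ T) (hl : IsWord L (s + 1) (P ++ T :: {x} :: Q)) :
    extD w (P ++ T :: {x} :: Q) = w (P ++ insert x T :: Q) +
      insertHead x (fun l => w (P ++ T :: l)) Q := by
  induction P generalizing w s with
  | nil =>
    rw [List.nil_append, extD_cons_cons, if_pos (by simpa using hT),
      show T ∪ {x} = insert x T by rw [Finset.union_comm]; rfl]
    congr 1
    cases Q with
    | nil => rw [extD_single, insertHead]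
    | cons A Q =>
      rw [extD_cons_cons, insertHead]
      have : extD (fun l => w (T :: {x} :: l)) (A :: Q) = 0 := by
        refine extD_eq_zero _ _ fun P A' B' Q' he hd => ?_
        refine H [T] _ (by simp) (by simpa [Avoids] using hT) ?_
        rw [he] at hl
        exact IsWord.merge (P := T :: {x} :: P) hl
      rw [this, add_zero]
      by_cases hA : x ∈ A <;> simp [hA]
  | cons A P ih =>
    obtain ⟨s, rfl⟩ : ∃ s', s = s' + 1 := by
      refine ⟨s - 1, ?_⟩
      have := hl.1
      simp at this
      omega
    have hA : A.Nonempty ∧ A ⊆ L := hl.2 A (by simp)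
    have hrec := ih (w := fun l => w (A :: l)) (s := s) (fun P' Q' hP' hav hw => by
        refine H (A :: P') Q' (by simp) ?_ ⟨by simpa using hw.1, ?_⟩
        · intro B hB
          rcases List.mem_cons.1 hB with rfl | hB
          · exact hP B (by simp)
          · exact hav B hB
        · intro B hB
          rcases List.mem_cons.1 hB with rfl | hB
          · exact hA
          · exact hw.2 B hB)
      (fun B hB => hP B (by simp [hB]))
      ⟨by simpa using hl.1, fun B hB => hl.2 B (by simp at hB ⊢; tauto)⟩
    have hmain : ∀ B rest, P ++ T :: {x} :: Q = B :: rest → Disjoint A B →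
        w ((A ∪ B) :: rest) = 0 := by
      intro B rest he hd
      rw [List.cons_append, he] at hl
      have hw := IsWord.merge (P := []) hl
      cases P with
      | nil =>
        simp only [List.nil_append, List.cons.injEq] at he
        obtain ⟨rfl, rfl⟩ := he
        refine H [A ∪ T] Q (by simp) ?_ hw
        simpa [Avoids, hT] using hP A (by simp)
      | cons P0 P =>
        simp only [List.cons_append, List.cons.injEq] at he
        obtain ⟨rfl, rfl⟩ := he
        have e : P ++ T :: {x} :: Q = (P ++ [T]) ++ {x} :: Q := by simp
        rw [e] at hw ⊢
        refine H ((A ∪ P0) :: (P ++ [T])) Q (by simp) ?_ hw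
        simp only [Avoids, List.mem_cons, List.mem_append, or_imp, forall_and, forall_eq,
          Finset.mem_union, not_or] at hP ⊢
        simp [hT, hP]
        exact hP.2.2
    obtain ⟨B, rest, he⟩ : ∃ B rest, P ++ T :: {x} :: Q = B :: rest := by
      cases P <;> simp
    have hfirst : (if Disjoint A B then w ((A ∪ B) :: rest) else 0) = 0 := by
      split_ifs with hd
      · exact hmain B rest he hd
      · rfl
    rw [List.cons_append, he, extD_cons_cons, hfirst, zero_add, ← he, hrec]
    rfl

/-- The two surviving terms of `extD_expand` are the sum defining `slide` and the same sum without
its first summand, so they telescope to that summand. -/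
theorem extD_slide {L : Finset β} {x : β} {s : ℕ} (z : List (Finset β) → ZMod 2)
    {P : List (Finset β)} {T : Finset β} {Q : List (Finset β)}
    (hP : Avoids x P) (hT : x ∉ T) (hl : IsWord L (s + 1) (P ++ T :: {x} :: Q)) :
    extD (slide x z) (P ++ T :: {x} :: Q) = z (P ++ T :: {x} :: Q) := by
  have hT' : T.Nonempty := (hl.2 T (by simp)).1
  rw [extD_expand (fun P Q _ h _ => slide_singleton z Q h) hP hT hl, slide_insert _ _ hP hT hT']
  cases Q with
  | nil => rw [slideTail, insertHead, add_zero]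
  | cons A Q =>
    have hA : A.Nonempty := (hl.2 A (by simp)).1
    rw [slideTail, insertHead]
    by_cases hx : x ∈ A
    · simp [hx]
    · have hP' : Avoids x (P ++ [T]) := by
        intro B hB
        rcases List.mem_append.1 hB with h | h
        · exact hP B h
        · rw [List.mem_singleton.1 h]; exact hT
      have := slide_insert z Q hP' hx hA
      simp only [List.append_assoc, List.singleton_append] at this
      rw [if_neg hx, if_neg hx, this, add_assoc, CharTwo.add_self_eq_zero, add_zero]

/-- The cocycle condition at the word with {x} split off behind T moves x from T ∪ {x} into the next
set on the right. Induction on the number of sets to the right ends when there is none or when the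
next one already contains x. -/
theorem eq_zero_of_extD_eq_zero {L : Finset β} {x : β} {s : ℕ} {z : List (Finset β) → ZMod 2}
    (H : ∀ P Q, P ≠ [] → Avoids x P → IsWord L s (P ++ {x} :: Q) → z (P ++ {x} :: Q) = 0)
    (hz : ∀ l, IsWord L (s + 1) l → extD z l = 0) (hx : x ∈ L)
    {P : List (Finset β)} {T : Finset β} {Q : List (Finset β)}
    (hP : Avoids x P) (hT : x ∉ T) (hT' : T.Nonempty) (hl : IsWord L s (P ++ insert x T :: Q)) :
    z (P ++ insert x T :: Q) = 0 := by
  induction Q generalizing P T with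
  | nil =>
    have hw : IsWord L (s + 1) (P ++ T :: {x} :: []) := by
      refine ⟨by have := hl.1; simp at this ⊢; omega, fun B hB => ?_⟩
      simp only [List.mem_append, List.mem_cons, List.not_mem_nil, or_false] at hB
      rcases hB with h | rfl | rfl
      · exact hl.2 B (by simp [h])
      · exact ⟨hT', (Finset.subset_insert x B).trans (hl.2 (insert x B) (by simp)).2⟩
      · simpa using hx
    have := hz _ hw
    rw [extD_expand H hP hT hw, insertHead] at this
    simpa using this
  | cons A Q ih =>
    have hw : IsWord L (s + 1) (P ++ T :: {x} :: A :: Q) := by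
      refine ⟨by have := hl.1; simp at this ⊢; omega, fun B hB => ?_⟩
      simp only [List.mem_append, List.mem_cons] at hB
      rcases hB with h | rfl | rfl | h
      · exact hl.2 B (by simp [h])
      · exact ⟨hT', (Finset.subset_insert x B).trans (hl.2 (insert x B) (by simp)).2⟩
      · simpa using hx
      · exact hl.2 B (by simp; tauto)
    have h1 := hz _ hw
    rw [extD_expand H hP hT hw, insertHead] at h1
    by_cases hA : x ∈ A
    · simpa [hA] using h1
    · have hP' : Avoids x (P ++ [T]) := by
        intro B hB
        rcases List.mem_append.1 hB with h | h
        · exact hP B h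
        · rw [List.mem_singleton.1 h]; exact hT
      have h2 := ih hP' hA (hl.2 A (by simp)).1 (by
        refine ⟨by have := hl.1; simp at this ⊢; omega, fun B hB => ?_⟩
        simp only [List.mem_append, List.mem_cons, List.not_mem_nil, or_false] at hB
        have hTL := (Finset.subset_insert x T).trans (hl.2 (insert x T) (by simp)).2
        have hAL := (hl.2 A (by simp)).2
        rcases hB with (h | rfl) | rfl | h
        · exact hl.2 B (by simp [h])
        · exact ⟨hT', hTL⟩
        · exact ⟨Finset.insert_nonempty _ _, Finset.insert_subset hx hAL⟩
        · exact hl.2 B (by simp [h]))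
      rw [List.append_assoc, List.singleton_append] at h2
      simpa [hA, h2] using h1

/-- A one-element set is not the union of two disjoint nonempty sets, so no merge produces an
initial {x}, and a merge that uses up an initial {x} yields a different head. -/
theorem extD_consSingleton (x : β) (w : List (Finset β) → ZMod 2) (l : List (Finset β))
    (hl : ∀ A ∈ l, A.Nonempty) :
    extD (consSingleton x w) l = consSingleton x (extD w) l := by
  match l, hl with
  | [], _ => exact extD_nil _
  | [A], _ =>
    rw [extD_single, consSingleton, extD_nil, ite_self]
  | A :: B :: Q, hl =>
    rw [extD_cons_cons]
    simp only [consSingleton]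
    have h1 : Disjoint A B → A ∪ B ≠ {x} := by
      intro hd he
      have hA : A = {x} := (Finset.subset_singleton_iff.1
        (he ▸ Finset.subset_union_left : A ⊆ {x})).resolve_left (hl A (by simp)).ne_empty
      have hB : B = {x} := (Finset.subset_singleton_iff.1
        (he ▸ Finset.subset_union_right : B ⊆ {x})).resolve_left (hl B (by simp)).ne_empty
      subst hA hB
      simp at hd
    by_cases hA : A = {x}
    · simp only [hA, if_true]
      rw [add_eq_right]
      split_ifs with h2 h3
      · exact absurd h3 (h1 (hA ▸ h2) |> fun h => by rwa [hA] at h)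
      · rfl
      · rfl
    · simp only [hA, if_false]
      rw [extD_zero, add_zero]
      split_ifs with h2 h3
      · exact absurd h3 (h1 h2)
      · rfl
      · rfl

/-- The cohomology of the cobar complex of a primitively generated exterior Hopf algebra is spanned
by the sorted words in its generators. -/
theorem exists_eq_extD (L : Finset β) (s : ℕ) (z : List (Finset β) → ZMod 2)
    (hz : ∀ l, IsWord L (s + 1) l → extD z l = 0) :
    ∃ w : List (Finset β) → ZMod 2, ∀ l, IsWord L s l →
      (¬ ∃ m : List β, m.Pairwise (· ≤ ·) ∧ l = m.map fun b => {b}) → z l = extD w l := by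
  -- The generator x that is peeled off is the least one, so that putting {x} in front of a sorted
  -- word keeps it sorted.
  induction L using Finset.induction_on_min generalizing s z with
  | empty =>
    refine ⟨0, fun l hl hK => ?_⟩
    cases l with
    | nil => exact absurd ⟨[], by simp⟩ hK
    | cons A l =>
      have := hl.2 A (by simp)
      exact absurd (Finset.subset_empty.1 this.2) this.1.ne_empty
  | insert x L hx ihL =>
    induction s generalizing z with
    | zero =>
      refine ⟨0, fun l hl hK => ?_⟩
      rw [List.length_eq_zero_iff.1 hl.1] at hK
      exact absurd ⟨[], by simp⟩ hK
    | succ s ihs =>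
      classical
      obtain ⟨w0, hw0⟩ := ihL (s + 1) z fun l hl =>
        hz l ⟨hl.1, fun A hA => ⟨(hl.2 A hA).1, (hl.2 A hA).2.trans (Finset.subset_insert _ _)⟩⟩
      -- Merging preserves whether x occurs in the word. Hence the words without x, treated by
      -- induction on L, and the words with x can be handled separately. On the latter, the
      -- correction by `slide` leaves only words that begin with {x}.
      set z2 : List (Finset β) → ZMod 2 := fun l => if Avoids x l then 0 else z l with hz2
      set z3 : List (Finset β) → ZMod 2 := fun l => z2 l + extD (slide x z2) l with hz3
      have hz2c : ∀ l, IsWord (insert x L) (s + 2) l → extD z2 l = 0 := by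
        intro l hl
        by_cases hav : Avoids x l
        · refine extD_eq_zero _ _ fun P A B Q he _ => ?_
          rw [he] at hav
          simp only [hz2]
          rw [if_pos (avoids_merge.2 hav)]
        · rw [← hz l hl]
          refine extD_congr _ _ _ fun P A B Q he _ => ?_
          rw [he] at hav
          simp only [hz2]
          rw [if_neg (mt avoids_merge.1 hav)]
      have hz3c : ∀ l, IsWord (insert x L) (s + 2) l → extD z3 l = 0 := by
        intro l hl
        rw [hz3, extD_add, hz2c l hl, extD_extD, add_zero]
      have hD : ∀ P Q, P ≠ [] → Avoids x P → IsWord (insert x L) (s + 1) (P ++ {x} :: Q) →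
          z3 (P ++ {x} :: Q) = 0 := by
        intro P Q hne hP hl
        obtain ⟨P', T, rfl⟩ : ∃ P' T, P = P' ++ [T] :=
          ⟨_, _, (List.dropLast_append_getLast hne).symm⟩
        rw [List.append_assoc, List.singleton_append] at hl ⊢
        have hP' : Avoids x P' := fun B hB => hP B (by simp [hB])
        have hT : x ∉ T := hP T (by simp)
        simp only [hz3]
        rw [extD_slide z2 hP' hT hl, CharTwo.add_self_eq_zero]
      have hU : ∀ P T Q, Avoids x P → x ∉ T → T.Nonempty →
          IsWord (insert x L) (s + 1) (P ++ insert x T :: Q) → z3 (P ++ insert x T :: Q) = 0 :=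
        fun P T Q hP hT hT' hl =>
          eq_zero_of_extD_eq_zero hD hz3c (Finset.mem_insert_self _ _) hP hT hT' hl
      -- What remains has the form {x} :: v. Its coefficients are a cocycle in v, since a merge of
      -- {x} with the next set lands on a word where z3 vanishes. The induction on the length
      -- applies to v, in which x may occur again.
      obtain ⟨w', hw'⟩ := ihs (fun v => z3 ({x} :: v)) fun v hv => by
        have hword : IsWord (insert x L) (s + 2) ({x} :: v) :=
          ⟨by simpa using hv.1, fun A hA => by
            rcases List.mem_cons.1 hA with rfl | hA
            · simp
            · exact hv.2 A hA⟩
        have h1 := hz3c _ hword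
        cases v with
        | nil => exact extD_nil _
        | cons A v =>
          rw [extD_cons_cons] at h1
          rw [← h1, right_eq_add]
          split_ifs with hd
          · have hA := hv.2 A (by simp)
            exact hU [] A v (by simp [Avoids]) (by simpa using hd) hA.1
              (IsWord.merge (P := []) hword)
          · rfl
      set w0' : List (Finset β) → ZMod 2 := fun l => if Avoids x l then w0 l else 0 with hw0'
      refine ⟨fun l => (w0' l + slide x z2 l) + consSingleton x w' l, fun l hl hK => ?_⟩
      rw [extD_add, extD_add, extD_consSingleton x w' l fun A hA => (hl.2 A hA).1]
      by_cases hav : Avoids x l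
      · have h1 : extD w0' l = extD w0 l := extD_congr _ _ _ fun P A B Q he _ => by
          rw [he] at hav
          simp only [hw0']
          rw [if_pos (avoids_merge.2 hav)]
        have h2 : extD (slide x z2) l = 0 := extD_eq_zero _ _ fun P A B Q he _ => by
          rw [he] at hav
          exact slide_of_avoids _ (avoids_merge.2 hav)
        have h3 : consSingleton x (extD w') l = 0 := by
          cases l with
          | nil => rfl
          | cons A v =>
            have : A ≠ {x} := by
              rintro rfl
              exact hav {x} (by simp) (by simp)
            simp [consSingleton, this]
        rw [h1, h2, h3, add_zero, add_zero]
        refine hw0 l ⟨hl.1, fun A hA => ⟨(hl.2 A hA).1, ?_⟩⟩ hK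
        exact (Finset.subset_insert_iff_of_notMem (hav A hA)).1 (hl.2 A hA).2
      · have h1 : extD w0' l = 0 := extD_eq_zero _ _ fun P A B Q he _ => by
          rw [he] at hav
          simp only [hw0']
          rw [if_neg (mt avoids_merge.1 hav)]
        have h2 : z l = z3 l + extD (slide x z2) l := by
          simp only [hz3, hz2]
          rw [if_neg hav, add_assoc, CharTwo.add_self_eq_zero, add_zero]
        rw [h1, zero_add, h2, add_comm, add_right_inj]
        obtain ⟨P, S, Q, rfl, hP, hS⟩ : ∃ P S Q, l = P ++ S :: Q ∧ Avoids x P ∧ x ∈ S := by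
          clear hl hK h1 h2
          induction l with
          | nil => exact absurd (by simp [Avoids]) hav
          | cons A l ih =>
            by_cases hA : x ∈ A
            · exact ⟨[], A, l, rfl, by simp [Avoids], hA⟩
            · have : ¬ Avoids x l := fun h => hav fun B hB => by
                rcases List.mem_cons.1 hB with rfl | hB
                · exact hA
                · exact h B hB
              obtain ⟨P, S, Q, rfl, hP, hS⟩ := ih this
              refine ⟨A :: P, S, Q, rfl, fun B hB => ?_, hS⟩
              rcases List.mem_cons.1 hB with rfl | hB
              · exact hA
              · exact hP B hB
        have hhead : ∀ A v, P ++ S :: Q = A :: v → A ≠ {x} → z3 (P ++ S :: Q) = 0 →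
            z3 (P ++ S :: Q) = consSingleton x (extD w') (P ++ S :: Q) := by
          intro A v he hA h0
          rw [h0, he]
          simp [consSingleton, hA]
        by_cases hSx : S = {x}
        · subst hSx
          cases P with
          | nil =>
            simp only [List.nil_append, consSingleton, if_true]
            refine hw' Q ⟨by simpa using hl.1, fun A hA => hl.2 A (by simp [hA])⟩ ?_
            rintro ⟨m, hm, rfl⟩
            refine hK ⟨x :: m, List.pairwise_cons.2 ⟨fun b hb => ?_, hm⟩, by simp⟩
            have hb' := (hl.2 {b} (by simp [hb])).2
            rw [Finset.singleton_subset_iff, Finset.mem_insert] at hb'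
            rcases hb' with rfl | hb'
            · exact le_rfl
            · exact (hx b hb').le
          | cons A P =>
            refine hhead A _ rfl ?_ (hD _ _ (by simp) hP hl)
            rintro rfl
            exact hP {x} (by simp) (by simp)
        · have hins : insert x (S.erase x) = S := Finset.insert_erase hS
          have hne : (S.erase x).Nonempty := by
            rw [Finset.nonempty_iff_ne_empty]
            intro h0
            rw [h0] at hins
            exact hSx hins.symm
          have h0 : z3 (P ++ S :: Q) = 0 := by
            have := hU P (S.erase x) Q hP (Finset.notMem_erase _ _) hne (by rwa [hins])
            rwa [hins] at this
          cases P with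
          | nil => exact hhead S Q rfl hSx h0
          | cons A P =>
            refine hhead A _ rfl ?_ h0
            rintro rfl
            exact hP {x} (by simp) (by simp)

end Exterior

/-! ### The monomial basis and the weight filtration of the cobar complex of `A` -/

/-- The pair `(n, j)` stands for `ζ_{n+1}^{2^j}`. Every monomial in the `ζ_n` is a product of
distinct elements of this form in a unique way. -/
abbrev Bit : Type := ℕ ×ₗ ℕ

/-- The exponents of the monomial with the binary digits `w`. -/
def expo {s : ℕ} (w : Fin s → Finset Bit) : Fin s × ℕ →₀ ℕ :=
  ∑ a, ∑ x ∈ w a, Finsupp.single (a, x.1) (2 ^ x.2)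

/-- The product of the elements of `S` in the `a`-th tensor factor. -/
def blk {s : ℕ} (a : Fin s) (S : Finset Bit) : SCobar s := ∏ x ∈ S, X (a, x.1) ^ 2 ^ x.2

/-- The monomial with the binary digits `w`. -/
def mon {s : ℕ} (w : Fin s → Finset Bit) : SCobar s := ∏ a, blk a (w a)

theorem mon_eq {s : ℕ} (w : Fin s → Finset Bit) : mon w = monomial (expo w) 1 := by
  rw [expo, monomial_sum_one]
  refine Finset.prod_congr rfl fun a _ => ?_
  rw [monomial_sum_one, blk]
  exact Finset.prod_congr rfl fun x _ => X_pow_eq_monomial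

/-- The powers of two in this sum are distinct, so it is a binary expansion. Its uniqueness and
existence make `expo` a bijection. -/
theorem expo_apply {s : ℕ} (w : Fin s → Finset Bit) (a : Fin s) (n : ℕ) :
    expo w (a, n) = ∑ j ∈ ((w a).filter fun x => x.1 = n).image (fun x => x.2), 2 ^ j := by
  rw [Finset.sum_image, expo, Finsupp.finsetSum_apply, Finset.sum_eq_single a]
  · rw [Finsupp.finsetSum_apply, Finset.sum_filter]
    refine Finset.sum_congr rfl fun x _ => ?_
    rw [Finsupp.single_apply]
    simp
  · intro b _ hb
    rw [Finsupp.finsetSum_apply]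
    refine Finset.sum_eq_zero fun x _ => ?_
    rw [Finsupp.single_apply, if_neg]
    simp [hb]
  · simp
  · intro x hx y hy h
    simp only [Finset.coe_filter, Set.mem_ofPred_eq] at hx hy
    exact Prod.ext (hx.2.trans hy.2.symm) h

theorem bitIndices_expo {s : ℕ} (w : Fin s → Finset Bit) (a : Fin s) (n : ℕ) :
    (expo w (a, n)).bitIndices.toFinset =
      ((w a).filter fun x => x.1 = n).image (fun x => x.2) := by
  rw [expo_apply, Finset.toFinset_bitIndices_sum_two_pow]

theorem mem_iff_mem_bitIndices {s : ℕ} (w : Fin s → Finset Bit) (a : Fin s) (x : Bit) :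
    x ∈ w a ↔ x.2 ∈ (expo w (a, x.1)).bitIndices := by
  rw [← List.mem_toFinset, bitIndices_expo]
  simp only [Finset.mem_image, Finset.mem_filter]
  constructor
  · intro h
    exact ⟨x, ⟨h, rfl⟩, rfl⟩
  · rintro ⟨y, ⟨hy, h1⟩, h2⟩
    rwa [show x = y from Prod.ext h1.symm h2.symm]

theorem expo_injective (s : ℕ) : Function.Injective (expo (s := s)) := by
  intro w w' h
  funext a
  ext x
  rw [mem_iff_mem_bitIndices, mem_iff_mem_bitIndices, h]

theorem expo_surjective (s : ℕ) : Function.Surjective (expo (s := s)) := by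
  intro e
  refine ⟨fun a => (e.support.filter fun p => p.1 = a).biUnion fun p =>
    (e p).bitIndices.toFinset.image fun j => toLex (p.2, j), ?_⟩
  ext ⟨a, n⟩
  rw [expo_apply]
  have : ((Finset.filter (fun x : Bit => x.1 = n)
      ((e.support.filter fun p => p.1 = a).biUnion fun p =>
        (e p).bitIndices.toFinset.image fun j => toLex (p.2, j))).image fun x => x.2) =
      (e (a, n)).bitIndices.toFinset := by
    ext j
    simp only [Finset.mem_image, Finset.mem_filter, Finset.mem_biUnion, List.mem_toFinset,
      Finsupp.mem_support_iff]
    constructor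
    · rintro ⟨x, ⟨⟨⟨b, m⟩, ⟨-, rfl⟩, ⟨i, hi, rfl⟩⟩, h2⟩, rfl⟩
      simp only at h2
      subst h2
      exact hi
    · intro hj
      refine ⟨toLex (n, j), ⟨⟨(a, n), ⟨?_, rfl⟩, j, hj, rfl⟩, rfl⟩, rfl⟩
      intro h0
      simp [h0] at hj
  rw [this, Finset.sum_toFinset_bitIndices_two_pow]

/-- The weight of a monomial: each `ζ_{n+1}^{2^j}` has weight `2n + 1`. -/
def wt {s : ℕ} (e : Fin s × ℕ →₀ ℕ) : ℕ :=
  e.sum fun p r => (2 * p.2 + 1) * r.bitIndices.length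

/-- Carries in binary addition can only lower the number of digits 1. This makes the weight of a
product of monomials at most the sum of the weights. -/
theorem length_bitIndices_add_le (a b : ℕ) :
    (a + b).bitIndices.length ≤ a.bitIndices.length + b.bitIndices.length := by
  induction h : a + b using Nat.strong_induction_on generalizing a b with
  | _ n ih =>
    subst h
    rcases Nat.even_or_odd' a with ⟨k, rfl | rfl⟩ <;> rcases Nat.even_or_odd' b with ⟨l, rfl | rfl⟩
    · by_cases h0 : k + l = 0
      · have h1 : k = 0 := by omega
        have h2 : l = 0 := by omega
        simp [h1, h2]
      · have := ih (k + l) (by omega) k l rfl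
        rw [← mul_add]
        simpa [Nat.bitIndices_two_mul] using this
    · have := ih (k + l) (by omega) k l rfl
      rw [← add_assoc, ← mul_add]
      simp only [Nat.bitIndices_two_mul, Nat.bitIndices_two_mul_add_one, List.length_map,
        List.length_cons]
      omega
    · have := ih (k + l) (by omega) k l rfl
      rw [add_right_comm, ← mul_add]
      simp only [Nat.bitIndices_two_mul, Nat.bitIndices_two_mul_add_one, List.length_map,
        List.length_cons]
      omega
    · have h1 := ih (k + l + 1) (by omega) (k + l) 1 rfl
      have h2 := ih (k + l) (by omega) k l rfl
      rw [show 2 * k + 1 + (2 * l + 1) = 2 * (k + l + 1) by ring]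
      simp only [Nat.bitIndices_two_mul, Nat.bitIndices_two_mul_add_one, List.length_map,
        List.length_cons]
      have h3 : (1 : ℕ).bitIndices.length = 1 := by simp
      omega

theorem wt_eq_sum {s : ℕ} {e : Fin s × ℕ →₀ ℕ} {T : Finset (Fin s × ℕ)} (h : e.support ⊆ T) :
    wt e = ∑ p ∈ T, (2 * p.2 + 1) * (e p).bitIndices.length :=
  Finsupp.sum_of_support_subset _ h _ (by simp)

theorem wt_add_le {s : ℕ} (e e' : Fin s × ℕ →₀ ℕ) : wt (e + e') ≤ wt e + wt e' := by
  classical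
  rw [wt_eq_sum (T := e.support ∪ e'.support) Finsupp.support_add,
    wt_eq_sum (T := e.support ∪ e'.support) Finset.subset_union_left,
    wt_eq_sum (T := e.support ∪ e'.support) Finset.subset_union_right, ← Finset.sum_add_distrib]
  refine Finset.sum_le_sum fun p _ => ?_
  rw [← mul_add]
  exact Nat.mul_le_mul_left _ (length_bitIndices_add_le _ _)

/-- The weight of a word. -/
def wordWt {s : ℕ} (w : Fin s → Finset Bit) : ℕ := ∑ a, ∑ x ∈ w a, (2 * x.1 + 1)

theorem wt_expo {s : ℕ} (w : Fin s → Finset Bit) : wt (expo w) = wordWt w := by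
  classical
  have hT : (expo w).support ⊆
      Finset.univ.biUnion fun a => (w a).image fun x => ((a, x.1) : Fin s × ℕ) := by
    intro p hp
    obtain ⟨a, n⟩ := p
    rw [Finsupp.mem_support_iff, expo_apply] at hp
    obtain ⟨j, hj, -⟩ := Finset.exists_ne_zero_of_sum_ne_zero hp
    simp only [Finset.mem_image, Finset.mem_filter] at hj
    obtain ⟨x, ⟨hx, rfl⟩, -⟩ := hj
    simp only [Finset.mem_biUnion, Finset.mem_image, Finset.mem_univ, true_and]
    exact ⟨a, x, hx, rfl⟩
  rw [wt_eq_sum hT, Finset.sum_biUnion, wordWt]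
  · refine Finset.sum_congr rfl fun a _ => ?_
    rw [← Finset.sum_fiberwise_of_maps_to (s := w a)
      (t := (w a).image fun x => ((a, x.1) : Fin s × ℕ)) (g := fun x => (a, x.1))
      fun x hx => Finset.mem_image_of_mem _ hx]
    refine Finset.sum_congr rfl fun p hp => ?_
    obtain ⟨y, -, rfl⟩ := Finset.mem_image.1 hp
    have h1 : (expo w (a, y.1)).bitIndices.length =
        ((w a).filter fun x => ((a, x.1) : Fin s × ℕ) = (a, y.1)).card := by
      rw [← List.toFinset_card_of_nodup (Nat.bitIndices_sorted.nodup), bitIndices_expo,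
        Finset.card_image_of_injOn]
      · congr 1
        ext x
        simp
      · intro x hx y hy h
        simp only [Finset.coe_filter, Set.mem_ofPred_eq] at hx hy
        exact Prod.ext (hx.2.trans hy.2.symm) h
    rw [h1, Finset.sum_congr rfl (g := fun _ => 2 * y.1 + 1), Finset.sum_const, smul_eq_mul,
      mul_comm]
    intro x hx
    have := (Finset.mem_filter.1 hx).2
    simp only [Prod.mk.injEq, true_and] at this
    rw [this]
  · intro a _ b _ hab
    rw [Function.onFun, Finset.disjoint_left]
    intro p hp hp'
    obtain ⟨x, -, rfl⟩ := Finset.mem_image.1 hp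
    obtain ⟨y, -, h⟩ := Finset.mem_image.1 hp'
    exact hab (congrArg Prod.fst h).symm

/-- The cochains all of whose monomials have weight less than `N`. -/
def wtLt (s N : ℕ) : Submodule (ZMod 2) (SCobar s) where
  carrier := {z | ∀ e, N ≤ wt e → coeff e z = 0}
  add_mem' := fun {a b} ha hb e he => by rw [coeff_add, ha e he, hb e he, add_zero]
  zero_mem' := fun e _ => coeff_zero e
  smul_mem' := fun c a ha e he => by rw [coeff_smul, ha e he, smul_zero]

theorem wtLt_mono {s M N : ℕ} (h : M ≤ N) : wtLt s M ≤ wtLt s N :=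
  fun _ hz e he => hz e (h.trans he)

/-- The bounds are asymmetric on purpose: an error term of weight less than M times a factor of
weight at most N again has weight less than M + N. -/
theorem mul_mem_wtLt {s M N : ℕ} {z z' : SCobar s} (hz : z ∈ wtLt s M) (hz' : z' ∈ wtLt s (N + 1)) :
    z * z' ∈ wtLt s (M + N) := by
  classical
  intro e he
  rw [coeff_mul]
  refine Finset.sum_eq_zero fun p hp => ?_
  have hp' : p.1 + p.2 = e := mem_antidiagonal.1 hp
  by_cases h1 : M ≤ wt p.1
  · rw [hz _ h1, zero_mul]
  · rw [hz' p.2, mul_zero]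
    have := wt_add_le p.1 p.2
    rw [hp'] at this
    omega

theorem mon_mem_wtLt {s N : ℕ} {w : Fin s → Finset Bit} (h : wordWt w < N) : mon w ∈ wtLt s N := by
  classical
  intro e he
  rw [mon_eq, coeff_monomial, if_neg]
  rintro rfl
  rw [wt_expo] at he
  omega

theorem blk_eq_mon {s : ℕ} (a : Fin s) (S : Finset Bit) :
    blk a S = mon (Function.update (fun _ => ∅) a S) := by
  rw [mon, Finset.prod_eq_single a]
  · rw [Function.update_self]
  · intro b _ hb
    rw [Function.update_of_ne hb, blk, Finset.prod_empty]
  · simp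

theorem blk_mem_wtLt {s N : ℕ} (a : Fin s) {S : Finset Bit} (h : ∑ x ∈ S, (2 * x.1 + 1) < N) :
    blk a S ∈ wtLt s N := by
  rw [blk_eq_mon]
  refine mon_mem_wtLt ?_
  rwa [wordWt, Finset.sum_eq_single a, Function.update_self]
  · intro b _ hb
    rw [Function.update_of_ne hb, Finset.sum_empty]
  · simp

theorem X_pow_mem_wtLt {s : ℕ} (a : Fin s) (n j : ℕ) :
    (X (a, n) ^ 2 ^ j : SCobar s) ∈ wtLt s (2 * n + 1 + 1) := by
  have h := blk_mem_wtLt (N := 2 * n + 1 + 1) a (S := {toLex (n, j)}) <| by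
    rw [Finset.sum_singleton]
    exact Nat.lt_succ_self _
  rwa [blk, Finset.prod_singleton] at h

theorem one_mem_wtLt (s : ℕ) : (1 : SCobar s) ∈ wtLt s (0 + 1) := by
  have := mon_mem_wtLt (s := s) (N := 0 + 1) (w := fun _ => ∅) (by simp [wordWt])
  simpa [mon, blk] using this

theorem prod_mem_wtLt {s : ℕ} {ι : Type} (T : Finset ι) (f : ι → SCobar s) (N : ι → ℕ)
    (h : ∀ i ∈ T, f i ∈ wtLt s (N i + 1)) : ∏ i ∈ T, f i ∈ wtLt s (∑ i ∈ T, N i + 1) := by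
  classical
  induction T using Finset.induction_on with
  | empty => simpa using one_mem_wtLt s
  | insert i T hi ih =>
    rw [Finset.prod_insert hi, Finset.sum_insert hi]
    have := mul_mem_wtLt (h i (by simp)) (ih fun j hj => h j (by simp [hj]))
    exact wtLt_mono (by omega) this

/-- Replacing the factors one at a time, each difference contains one factor of too low weight. -/
theorem prod_sub_prod_mem_wtLt {s : ℕ} {ι : Type} (T : Finset ι) (f g : ι → SCobar s) (N : ι → ℕ)
    (h : ∀ i ∈ T, g i ∈ wtLt s (N i + 1)) (h' : ∀ i ∈ T, f i - g i ∈ wtLt s (N i)) :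
    ∏ i ∈ T, f i - ∏ i ∈ T, g i ∈ wtLt s (∑ i ∈ T, N i) := by
  classical
  induction T using Finset.induction_on with
  | empty => simp
  | insert i T hi ih =>
    rw [Finset.prod_insert hi, Finset.prod_insert hi, Finset.sum_insert hi]
    have h1 := ih (fun j hj => h j (by simp [hj])) (fun j hj => h' j (by simp [hj]))
    have hg := prod_mem_wtLt T g N fun j hj => h j (by simp [hj])
    have hf : f i ∈ wtLt s (N i + 1) := by
      have := (wtLt s (N i + 1)).add_mem (wtLt_mono (Nat.le_succ _) (h' i (by simp)))
        (h i (by simp))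
      simpa using this
    have e : f i * ∏ j ∈ T, f j - g i * ∏ j ∈ T, g j =
        (∏ j ∈ T, f j - ∏ j ∈ T, g j) * f i + (f i - g i) * ∏ j ∈ T, g j := by ring
    rw [e]
    refine (wtLt s _).add_mem ?_ (mul_mem_wtLt (h' i (by simp)) hg)
    rw [add_comm]
    exact mul_mem_wtLt h1 hf

/-! ### The coface maps on the associated graded complex -/

/-- This is why ζ_m gets weight 2m-1: an inner summand ζ_l ⊗ ζ_j^{2^l} with l + j = m and l, j ≥ 1
has weight 2m-2. Up to lower weight every bit is therefore primitive. -/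
theorem sCoface_zeta_pow_sub_mem {s : ℕ} (k : Fin s) (x : Bit) :
    sCoface s k.succ.castSucc (X (k, x.1) ^ 2 ^ x.2) -
      (X (k.castSucc, x.1) ^ 2 ^ x.2 + X (k.succ, x.1) ^ 2 ^ x.2) ∈
      wtLt (s + 1) (2 * x.1 + 1) := by
  obtain ⟨n, j⟩ := x
  dsimp only
  have h0 : sCoface s k.succ.castSucc (X (k, n)) = ∑ q ∈ antidiagonal (n + 1),
      zeta (s + 1) k.castSucc q.1 * zeta (s + 1) k.succ q.2 ^ 2 ^ q.1 := by
    rw [sCoface, aeval_X]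
    dsimp only
    rw [if_neg (by simp), if_pos (by simp)]
  rw [map_pow, h0]
  cases n with
  | zero =>
    rw [show antidiagonal (0 + 1) = {(0, 1), (1, 0)} from rfl, Finset.sum_pair (by simp)]
    simp only [zeta, pow_zero, pow_one, one_mul, one_pow, mul_one]
    rw [add_pow_char_pow, add_comm (X (k.castSucc, 0) ^ 2 ^ j), sub_self]
    exact zero_mem _
  | succ n =>
    rw [show n + 1 + 1 = n + 2 from rfl, Finset.Nat.antidiagonal_succ_succ', Finset.sum_cons,
      Finset.sum_cons, Finset.sum_map, add_pow_char_pow, add_pow_char_pow, sum_pow_char_pow]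
    simp only [zeta, pow_zero, pow_one, one_mul, one_pow, mul_one]
    have e : ∀ a b c : SCobar (s + 1), a + (b + c) - (b + a) = c := fun a b c => by ring
    rw [e]
    refine (wtLt _ _).sum_mem fun q hq => ?_
    have hq' := mem_antidiagonal.1 hq
    simp only [Function.Embedding.coe_prodMap, Function.Embedding.coeFn_mk, Prod.map_fst,
      Prod.map_snd, mul_pow, ← pow_mul, ← pow_add]
    exact wtLt_mono (by omega) (mul_mem_wtLt (X_pow_mem_wtLt k.castSucc q.1 j)
      (X_pow_mem_wtLt k.succ q.2 (q.1.succ + j)))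

/-- Multiplying out the product of the sums x ⊗ 1 + 1 ⊗ x over the bits x of S gives one term for
each subset, which is the coproduct of an exterior algebra on primitive generators. -/
theorem sCoface_blk_self_sub_mem {s : ℕ} (k : Fin s) (S : Finset Bit) :
    sCoface s k.succ.castSucc (blk k S) -
      ∑ A ∈ S.powerset, blk k.castSucc A * blk k.succ (S \ A) ∈
      wtLt (s + 1) (∑ x ∈ S, (2 * x.1 + 1)) := by
  simp only [blk]
  rw [← Finset.prod_add, map_prod]
  refine prod_sub_prod_mem_wtLt S _ _ _ (fun x _ => ?_) fun x _ => sCoface_zeta_pow_sub_mem k x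
  exact add_mem (X_pow_mem_wtLt _ _ _) (X_pow_mem_wtLt _ _ _)

theorem sCoface_blk_of_ne {s : ℕ} {i k : Fin s} (h : i ≠ k) (S : Finset Bit) :
    sCoface s k.succ.castSucc (blk i S) = blk (k.castSucc.succAbove i) S := by
  simp only [blk, map_prod, map_pow]
  refine Finset.prod_congr rfl fun x _ => ?_
  congr 1
  rw [sCoface, aeval_X]
  dsimp only
  rcases lt_or_gt_of_ne h with h1 | h1
  · have h2 : (i : ℕ) < k := h1
    rw [if_neg (by simp; omega), if_neg (by simp; omega), Fin.succAbove_of_castSucc_lt _ _ h1, zeta]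
  · have h2 : (k : ℕ) < i := h1
    rw [if_pos (by simp; omega), Fin.succAbove_of_le_castSucc _ _ (by exact h1.le), zeta]

/-- The word that arises from `w` by replacing the `k`-th entry with the two entries `A` and
`w k \ A`. -/
def splitWord {s : ℕ} (k : Fin s) (w : Fin s → Finset Bit) (A : Finset Bit) :
    Fin (s + 1) → Finset Bit :=
  Fin.insertNth (α := fun _ => Finset Bit) k.castSucc A (Function.update w k (w k \ A))

/-- The word that arises from `u` by merging the `k`-th and the `k+1`-st entry. -/
def mergeWord {s : ℕ} (k : Fin s) (u : Fin (s + 1) → Finset Bit) : Fin s → Finset Bit :=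
  Function.update (fun i => u (k.castSucc.succAbove i)) k (u k.castSucc ∪ u k.succ)

/-- Splitting an entry and merging two adjacent disjoint ones are inverse to each other. This turns
the coproduct of monomials into a formula for coefficients. -/
theorem splitWord_eq_iff {s : ℕ} (k : Fin s) (w : Fin s → Finset Bit) (u : Fin (s + 1) → Finset Bit)
    (A : Finset Bit) : (A ⊆ w k ∧ splitWord k w A = u) ↔
      A = u k.castSucc ∧ Disjoint (u k.castSucc) (u k.succ) ∧ mergeWord k u = w := by
  have hk : k.castSucc.succAbove k = k.succ := Fin.succAbove_castSucc_self k
  have hs : splitWord k w A = u ↔ A = u k.castSucc ∧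
      ∀ i, Function.update w k (w k \ A) i = u (k.castSucc.succAbove i) := by
    rw [splitWord, Fin.insertNth_eq_iff]
    simp only [funext_iff, Fin.removeNth]
  rw [hs]
  constructor
  · rintro ⟨hA, rfl, h⟩
    have hkk := h k
    rw [Function.update_self, hk] at hkk
    refine ⟨rfl, ?_, ?_⟩
    · rw [← hkk]
      exact Finset.disjoint_sdiff
    · funext i
      rw [mergeWord]
      by_cases hi : i = k
      · subst hi
        rw [Function.update_self, ← hkk, Finset.union_sdiff_of_subset hA]
      · rw [Function.update_of_ne hi, ← h i, Function.update_of_ne hi]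
  · rintro ⟨rfl, hd, rfl⟩
    refine ⟨?_, rfl, fun i => ?_⟩
    · rw [mergeWord, Function.update_self]
      exact Finset.subset_union_left
    · by_cases hi : i = k
      · subst hi
        rw [Function.update_self, mergeWord, Function.update_self, hk,
          Finset.union_sdiff_cancel_left hd]
      · rw [Function.update_of_ne hi, mergeWord, Function.update_of_ne hi]

theorem sCoface_mon_sub_mem {s : ℕ} (k : Fin s) (w : Fin s → Finset Bit) :
    sCoface s k.succ.castSucc (mon w) - ∑ A ∈ (w k).powerset, mon (splitWord k w A) ∈
      wtLt (s + 1) (wordWt w) := by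
  have hk : k.castSucc.succAbove k = k.succ := Fin.succAbove_castSucc_self k
  have h1 : sCoface s k.succ.castSucc (mon w) = sCoface s k.succ.castSucc (blk k (w k)) *
      ∏ i ∈ {k}ᶜ, blk (k.castSucc.succAbove i) (w i) := by
    rw [mon, map_prod, Fintype.prod_eq_mul_prod_compl k]
    congr 1
    refine Finset.prod_congr rfl fun i hi => ?_
    exact sCoface_blk_of_ne (by simpa using hi) _
  have h2 : ∀ A, mon (splitWord k w A) = (blk k.castSucc A * blk k.succ (w k \ A)) *
      ∏ i ∈ {k}ᶜ, blk (k.castSucc.succAbove i) (w i) := by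
    intro A
    rw [mon, Fin.prod_univ_succAbove _ k.castSucc, Fintype.prod_eq_mul_prod_compl k, mul_assoc]
    simp only [splitWord, Fin.insertNth_apply_same, Fin.insertNth_apply_succAbove,
      Function.update_self]
    rw [hk]
    congr 2
    refine Finset.prod_congr rfl fun i hi => ?_
    rw [Function.update_of_ne (by simpa using hi)]
  simp only [h1, h2]
  rw [← Finset.sum_mul, ← sub_mul, wordWt, Fintype.sum_eq_add_sum_compl k]
  refine mul_mem_wtLt (sCoface_blk_self_sub_mem k (w k)) (prod_mem_wtLt _ _ _ fun i _ => ?_)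
  exact blk_mem_wtLt _ (Nat.lt_succ_self _)

theorem coeff_sCoface_mon {s : ℕ} (k : Fin s) (w : Fin s → Finset Bit)
    (u : Fin (s + 1) → Finset Bit) (h : wordWt w ≤ wordWt u) :
    coeff (expo u) (sCoface s k.succ.castSucc (mon w)) =
      if Disjoint (u k.castSucc) (u k.succ) ∧ mergeWord k u = w then 1 else 0 := by
  classical
  have h1 := sCoface_mon_sub_mem k w (expo u) (by rwa [wt_expo])
  rw [coeff_sub, sub_eq_zero] at h1
  rw [h1, coeff_sum]
  simp only [mon_eq, coeff_monomial, (expo_injective _).eq_iff]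
  have h2 := splitWord_eq_iff k w u
  split_ifs with hc
  · rw [Finset.sum_eq_single (u k.castSucc)]
    · rw [if_pos ((h2 _).2 ⟨rfl, hc⟩).2]
    · intro A hA hne
      rw [if_neg]
      intro he
      exact hne ((h2 A).1 ⟨Finset.mem_powerset.1 hA, he⟩).1
    · intro hn
      exact absurd (Finset.mem_powerset.2 ((h2 _).2 ⟨rfl, hc⟩).1) hn
  · refine Finset.sum_eq_zero fun A hA => ?_
    rw [if_neg]
    intro he
    exact hc ((h2 A).1 ⟨Finset.mem_powerset.1 hA, he⟩).2

/-- Since z has no monomials heavier than u and the inner cofaces do not raise the weight, only the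
associated graded coproduct contributes to the coefficient at u. -/
theorem coeff_sCoface {s : ℕ} (k : Fin s) (z : SCobar s) (u : Fin (s + 1) → Finset Bit)
    (hz : z ∈ wtLt s (wordWt u + 1)) :
    coeff (expo u) (sCoface s k.succ.castSucc z) =
      if Disjoint (u k.castSucc) (u k.succ) then coeff (expo (mergeWord k u)) z else 0 := by
  classical
  conv_lhs => rw [z.as_sum]
  rw [map_sum, coeff_sum]
  have h1 : ∀ e ∈ z.support, coeff (expo u) (sCoface s k.succ.castSucc (monomial e (coeff e z))) =
      if e = expo (mergeWord k u) ∧ Disjoint (u k.castSucc) (u k.succ) then coeff e z else 0 := by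
    intro e he
    obtain ⟨w, rfl⟩ := expo_surjective s e
    have hw : wordWt w ≤ wordWt u := by
      by_contra hlt
      refine mem_support_iff.1 he (hz _ ?_)
      rw [wt_expo]
      omega
    have h2 : (monomial (expo w) (coeff (expo w) z) : SCobar s) = coeff (expo w) z • mon w := by
      rw [mon_eq, smul_monomial, smul_eq_mul, mul_one]
    rw [h2, map_smul, coeff_smul, coeff_sCoface_mon k w u hw, smul_eq_mul, mul_ite, mul_one,
      mul_zero]
    refine if_congr ?_ rfl rfl
    rw [(expo_injective _).eq_iff, and_comm, eq_comm]
  rw [Finset.sum_congr rfl h1]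
  split_ifs with hd
  · simp only [hd, and_true]
    rw [Finset.sum_ite_eq']
    split_ifs with h3
    · rfl
    · exact (notMem_support_iff.1 h3).symm
  · simp only [hd, and_false, if_false, Finset.sum_const_zero]

/-! ### Reduction to the cobar complex of `A` -/

theorem natCast_eq_one_of_odd {n : ℕ} (h : Odd n) : (n : ZMod 2) = 1 :=
  (ZMod.natCast_eq_one_iff_odd).2 h

/-- The residue map of `ℤ_(2)`. -/
def residue : ZLoc →+* ZMod 2 where
  toFun c := (c.1.num : ZMod 2)
  map_one' := by simp
  map_zero' := by simp
  map_mul' a b := by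
    have h := congrArg (Int.cast : ℤ → ZMod 2) (Rat.mul_num_den' a.1 b.1)
    push_cast at h
    rwa [natCast_eq_one_of_odd a.2, natCast_eq_one_of_odd b.2,
      natCast_eq_one_of_odd (show Odd (a.1 * b.1).den from (a * b).2), mul_one, mul_one,
      mul_one] at h
  map_add' a b := by
    have h := congrArg (Int.cast : ℤ → ZMod 2) (Rat.add_num_den' a.1 b.1)
    push_cast at h
    rwa [natCast_eq_one_of_odd a.2, natCast_eq_one_of_odd b.2,
      natCast_eq_one_of_odd (show Odd (a.1 + b.1).den from (a + b).2), mul_one, mul_one,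
      mul_one, mul_one, mul_one] at h

/-- The reduction of the cobar complex of `BP_*BP` modulo `I`. -/
def redI (s : ℕ) : Cobar s →+* SCobar s :=
  eval₂Hom ((C : ZMod 2 →+* SCobar s).comp residue) (Sum.elim (fun _ => 0) X)

theorem redI_eq_zero {s : ℕ} {x : Cobar s} (h : x ∈ augI s) : redI s x = 0 := by
  have : augI s ≤ RingHom.ker (redI s) := by
    refine Ideal.span_le.2 ?_
    rintro y (rfl | ⟨n, rfl⟩)
    · rw [SetLike.mem_coe, RingHom.mem_ker, map_ofNat]
      exact CharTwo.two_eq_zero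
    · simp [redI, v, RingHom.mem_ker]
  exact this h

/-- `redI` factors through the quotient by I, where it is a left inverse of `frobeniusName`. -/
theorem redI_of_mk_eq {s : ℕ} {x : Cobar s} {z : SCobar s}
    (h : Ideal.Quotient.mk (augI s) x = frobeniusName s z) : redI s x = z := by
  have h1 : (Ideal.Quotient.lift (augI s) (redI s) fun x hx => redI_eq_zero hx).comp
      (frobeniusName s) = RingHom.id _ := by
    refine MvPolynomial.ringHom_ext' (Subsingleton.elim _ _) fun p => ?_
    simp [frobeniusName, redI, t]
  have h2 := congrArg (Ideal.Quotient.lift (augI s) (redI s) fun x hx => redI_eq_zero hx) h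
  rw [Ideal.Quotient.lift_mk] at h2
  exact h2.trans (DFunLike.congr_fun h1 z)

theorem frobeniusName_injective (s : ℕ) : Function.Injective (frobeniusName s) := fun x y hxy => by
  rw [← redI_of_mk_eq (nameLift_spec x), redI_of_mk_eq ((nameLift_spec x).trans hxy)]

/-- Inherited from the cobar complex of BP_*BP, because `frobeniusName` is injective and compatible
with the differentials. -/
theorem sCobarD_sCobarD (s : ℕ) (z : SCobar s) : sCobarD (s + 1) (sCobarD s z) = 0 := by
  refine frobeniusName_injective _ ?_
  rw [← quot_cobarD (quot_cobarD (nameLift_spec z)), cobarD_cobarD, map_zero, map_zero]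

/-! ### The internal degree -/

theorem isWeightedHomogeneous_aeval {σ τ R : Type} [CommRing R] {w : σ → ℕ} {w' : τ → ℕ}
    {f : σ → MvPolynomial τ R} (hf : ∀ i, IsWeightedHomogeneous w' (f i) (w i))
    {p : MvPolynomial σ R} {n : ℕ} (hp : IsWeightedHomogeneous w p n) :
    IsWeightedHomogeneous w' (aeval f p) n := by
  rw [p.as_sum, map_sum]
  refine IsWeightedHomogeneous.sum _ _ _ fun d hd => ?_
  rw [aeval_monomial, algebraMap_eq]
  refine IsWeightedHomogeneous.C_mul ?_ _
  have h1 : ∑ i ∈ d.support, d i • w i = n := hp (mem_support_iff.1 hd)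
  rw [← h1]
  exact IsWeightedHomogeneous.prod _ _ _ fun i _ => (hf i).pow _

/-- The degree of `ζ_{n+1}`, in any of the tensor factors. -/
abbrev dg (s : ℕ) : Fin s × ℕ → ℕ := fun p => 2 ^ (p.2 + 1) - 1

/-- The cochains of internal degree `D`. -/
abbrev homog (s D : ℕ) : Submodule (ZMod 2) (SCobar s) :=
  weightedHomogeneousSubmodule (ZMod 2) (dg s) D

theorem isWeightedHomogeneous_zeta {s : ℕ} (a : Fin s) (n : ℕ) :
    IsWeightedHomogeneous (dg s) (zeta s a n) (2 ^ n - 1) := by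
  cases n with
  | zero => exact isWeightedHomogeneous_one _ _
  | succ n => exact isWeightedHomogeneous_X _ _ (a, n)

theorem degree_coproduct {n l j : ℕ} (h : l + j = n) :
    2 ^ l - 1 + 2 ^ l * (2 ^ j - 1) = 2 ^ n - 1 := by
  rw [← h, pow_add, Nat.mul_sub, mul_one]
  have h1 : 1 ≤ 2 ^ l := Nat.one_le_two_pow
  have h2 : 2 ^ l * 1 ≤ 2 ^ l * 2 ^ j := Nat.mul_le_mul_left _ Nat.one_le_two_pow
  omega

theorem isWeightedHomogeneous_sCoface {s : ℕ} (i : Fin (s + 2)) {z : SCobar s} {D : ℕ}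
    (hz : IsWeightedHomogeneous (dg s) z D) :
    IsWeightedHomogeneous (dg (s + 1)) (sCoface s i z) D := by
  refine isWeightedHomogeneous_aeval (fun p => ?_) hz
  split_ifs with h1 h2
  · exact isWeightedHomogeneous_zeta _ _
  · refine IsWeightedHomogeneous.sum _ _ _ fun q hq => ?_
    have := (isWeightedHomogeneous_zeta (s := s + 1) p.1.castSucc q.1).mul
      ((isWeightedHomogeneous_zeta (s := s + 1) p.1.succ q.2).pow (2 ^ q.1))
    rwa [smul_eq_mul, degree_coproduct (mem_antidiagonal.1 hq)] at this
  · exact isWeightedHomogeneous_zeta _ _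

theorem sCobarD_mem_homog {s D : ℕ} {z : SCobar s} (hz : z ∈ homog s D) :
    sCobarD s z ∈ homog (s + 1) D := by
  rw [sCobarD_apply]
  exact sum_mem fun i _ => isWeightedHomogeneous_sCoface i hz

/-! ### Codegeneracies and normalized cochains -/

/-- The codegeneracies of the cobar complex of `A`: the augmentation on the `j`-th factor. -/
def sCodeg (s : ℕ) (j : Fin (s + 1)) : SCobar (s + 1) →ₐ[ZMod 2] SCobar s :=
  aeval fun p => Fin.insertNth (α := fun _ => SCobar s) j 0 (fun i => X (i, p.2)) p.1

/-- `ζ_n` in the `a`-th tensor factor, with `a` a natural number. -/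
def zetaNat (s a n : ℕ) : SCobar s := if h : a < s then zeta s ⟨a, h⟩ n else 0

theorem zetaNat_val {s : ℕ} (a : Fin s) (n : ℕ) : zetaNat s a n = zeta s a n := by
  rw [zetaNat, dif_pos a.2]

theorem zetaNat_of_lt {s a : ℕ} (h : a < s) (n : ℕ) : zetaNat s a n = zeta s ⟨a, h⟩ n := dif_pos h

theorem sCoface_zetaNat_of_le {s : ℕ} (i : Fin (s + 2)) {a : ℕ} (ha : a < s) (h : (i : ℕ) ≤ a)
    (n : ℕ) : sCoface s i (zetaNat s a n) = zetaNat (s + 1) (a + 1) n := by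
  rw [zetaNat_of_lt ha, zetaNat_of_lt (show a + 1 < s + 1 by omega)]
  cases n with
  | zero => simp [zeta]
  | succ n =>
    rw [zeta, sCoface, aeval_X]
    exact if_pos h

theorem sCoface_zetaNat_of_gt {s : ℕ} (i : Fin (s + 2)) {a : ℕ} (ha : a < s) (h : a + 1 < (i : ℕ))
    (n : ℕ) : sCoface s i (zetaNat s a n) = zetaNat (s + 1) a n := by
  rw [zetaNat_of_lt ha, zetaNat_of_lt (show a < s + 1 by omega)]
  cases n with
  | zero => simp [zeta]
  | succ n =>
    rw [zeta, sCoface, aeval_X]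
    dsimp only
    rw [if_neg (by omega), if_neg (by omega)]
    rfl

theorem sCoface_zetaNat_of_eq {s : ℕ} (i : Fin (s + 2)) {a : ℕ} (ha : a < s) (h : (i : ℕ) = a + 1)
    (n : ℕ) : sCoface s i (zetaNat s a n) =
      ∑ q ∈ antidiagonal n, zetaNat (s + 1) a q.1 * zetaNat (s + 1) (a + 1) q.2 ^ 2 ^ q.1 := by
  rw [zetaNat_of_lt ha]
  simp only [zetaNat_of_lt (show a + 1 < s + 1 by omega), zetaNat_of_lt (show a < s + 1 by omega)]
  cases n with
  | zero => simp [zeta]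
  | succ n =>
    rw [zeta, sCoface, aeval_X]
    dsimp only
    rw [if_neg (by omega), if_pos h]
    rfl

theorem sCodeg_zetaNat_of_lt {s : ℕ} (j : Fin (s + 1)) {a : ℕ} (h : a < (j : ℕ)) (n : ℕ) :
    sCodeg s j (zetaNat (s + 1) a n) = zetaNat s a n := by
  have hj := j.2
  rw [zetaNat_of_lt (show a < s + 1 by omega), zetaNat_of_lt (show a < s by omega)]
  cases n with
  | zero => rw [zeta, zeta, map_one]
  | succ n =>
    have : (⟨a, by omega⟩ : Fin (s + 1)) = j.succAbove ⟨a, by omega⟩ := by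
      rw [Fin.succAbove_of_castSucc_lt _ _ (by exact h)]
      rfl
    rw [zeta, sCodeg, aeval_X, this, Fin.insertNth_apply_succAbove, zeta]

theorem sCodeg_zetaNat_of_eq {s : ℕ} (j : Fin (s + 1)) {a : ℕ} (h : a = (j : ℕ)) (n : ℕ) :
    sCodeg s j (zetaNat (s + 1) a n) = if n = 0 then 1 else 0 := by
  subst h
  rw [zetaNat_val]
  cases n with
  | zero => rw [zeta, map_one, if_pos rfl]
  | succ n => rw [zeta, sCodeg, aeval_X, Fin.insertNth_apply_same, if_neg (Nat.succ_ne_zero n)]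

theorem sCodeg_zetaNat_of_gt {s : ℕ} (j : Fin (s + 1)) {a : ℕ} (ha : a < s) (h : (j : ℕ) ≤ a)
    (n : ℕ) : sCodeg s j (zetaNat (s + 1) (a + 1) n) = zetaNat s a n := by
  rw [zetaNat_of_lt (show a + 1 < s + 1 by omega), zetaNat_of_lt ha]
  cases n with
  | zero => rw [zeta, zeta, map_one]
  | succ n =>
    have : (⟨a + 1, by omega⟩ : Fin (s + 1)) = j.succAbove ⟨a, by omega⟩ := by
      rw [Fin.succAbove_of_le_castSucc _ _ (by exact h)]
      rfl
    rw [zeta, sCodeg, aeval_X, this, Fin.insertNth_apply_succAbove, zeta]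

theorem algHom_ext_zetaNat {s : ℕ} {R : Type} [CommRing R] [Algebra (ZMod 2) R]
    {f g : SCobar s →ₐ[ZMod 2] R} (h : ∀ a < s, ∀ n, f (zetaNat s a n) = g (zetaNat s a n)) :
    f = g := by
  refine MvPolynomial.algHom_ext fun p => ?_
  have := h p.1 p.1.2 (p.2 + 1)
  rwa [zetaNat_val, zeta] at this

/-- This is counitality: of the coproduct of ζ_n only ζ_n ⊗ 1 or 1 ⊗ ζ_n survives the augmentation
of a factor. -/
theorem sCodeg_sCoface_self {s : ℕ} (i : Fin (s + 2)) (j : Fin (s + 1))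
    (h : (i : ℕ) = j ∨ (i : ℕ) = j + 1) (z : SCobar s) : sCodeg s j (sCoface s i z) = z := by
  suffices H : (sCodeg s j).comp (sCoface s i) = AlgHom.id _ _ from DFunLike.congr_fun H z
  refine algHom_ext_zetaNat fun a ha n => ?_
  rw [AlgHom.comp_apply, AlgHom.id_apply]
  rcases lt_trichotomy (i : ℕ) (a + 1) with h1 | h1 | h1
  · rw [sCoface_zetaNat_of_le i ha (by omega), sCodeg_zetaNat_of_gt j ha (by omega)]
  · rw [sCoface_zetaNat_of_eq i ha h1]
    simp only [map_sum, map_mul, map_pow]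
    rcases h with h | h
    · rw [Finset.sum_eq_single (n, 0)]
      · rw [sCodeg_zetaNat_of_lt j (by omega), sCodeg_zetaNat_of_eq j (by omega), if_pos rfl,
          one_pow, mul_one]
      · intro q hq hne
        have : q.2 ≠ 0 := by
          intro h0
          refine hne (Prod.ext ?_ h0)
          have := mem_antidiagonal.1 hq
          simp only at this ⊢
          omega
        rw [sCodeg_zetaNat_of_eq (a := a + 1) j (by omega), if_neg this, zero_pow (by positivity),
          mul_zero]
      · simp
    · rw [Finset.sum_eq_single (0, n)]
      · rw [sCodeg_zetaNat_of_eq j (by omega), sCodeg_zetaNat_of_gt j ha (by omega), if_pos rfl,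
          one_mul, pow_zero, pow_one]
      · intro q hq hne
        have : q.1 ≠ 0 := by
          intro h0
          refine hne (Prod.ext h0 ?_)
          have := mem_antidiagonal.1 hq
          simp only at this ⊢
          omega
        rw [sCodeg_zetaNat_of_eq j (by omega), if_neg this, zero_mul]
      · simp
  · rw [sCoface_zetaNat_of_gt i ha h1, sCodeg_zetaNat_of_lt j (by omega)]

theorem sCodeg_sCoface_of_lt {s : ℕ} (i : Fin (s + 3)) (j : Fin (s + 2)) (i' : Fin (s + 2))
    (j' : Fin (s + 1)) (h : (i : ℕ) < j) (hi : (i' : ℕ) = i) (hj : (j' : ℕ) + 1 = j)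
    (z : SCobar (s + 1)) :
    sCodeg (s + 1) j (sCoface (s + 1) i z) = sCoface s i' (sCodeg s j' z) := by
  suffices H : (sCodeg (s + 1) j).comp (sCoface (s + 1) i) = (sCoface s i').comp (sCodeg s j') from
    DFunLike.congr_fun H z
  refine algHom_ext_zetaNat fun a ha n => ?_
  have hj2 := j'.2
  rw [AlgHom.comp_apply, AlgHom.comp_apply]
  rcases lt_trichotomy a (j' : ℕ) with h1 | h1 | h1
  · rw [sCodeg_zetaNat_of_lt j' h1]
    rcases lt_trichotomy (i : ℕ) (a + 1) with h2 | h2 | h2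
    · rw [sCoface_zetaNat_of_le i ha (by omega), sCoface_zetaNat_of_le i' (by omega) (by omega),
        sCodeg_zetaNat_of_lt j (by omega)]
    · rw [sCoface_zetaNat_of_eq i ha (by omega), sCoface_zetaNat_of_eq i' (by omega) (by omega)]
      simp only [map_sum, map_mul, map_pow]
      refine Finset.sum_congr rfl fun q _ => ?_
      rw [sCodeg_zetaNat_of_lt j (by omega), sCodeg_zetaNat_of_lt j (by omega)]
    · rw [sCoface_zetaNat_of_gt i ha (by omega), sCoface_zetaNat_of_gt i' (by omega) (by omega),
        sCodeg_zetaNat_of_lt j (by omega)]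
  · rw [sCodeg_zetaNat_of_eq j' h1, sCoface_zetaNat_of_le i ha (by omega),
      sCodeg_zetaNat_of_eq j (by omega)]
    split_ifs <;> simp
  · obtain ⟨a, rfl⟩ : ∃ b, a = b + 1 := ⟨a - 1, by omega⟩
    rw [sCodeg_zetaNat_of_gt j' (by omega) (by omega), sCoface_zetaNat_of_le i ha (by omega),
      sCodeg_zetaNat_of_gt j (by omega) (by omega),
      sCoface_zetaNat_of_le i' (by omega) (by omega)]

theorem sCodeg_sCoface_of_gt {s : ℕ} (i : Fin (s + 3)) (j : Fin (s + 2)) (i' : Fin (s + 2))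
    (j' : Fin (s + 1)) (h : (j : ℕ) + 1 < i) (hi : (i' : ℕ) + 1 = i) (hj : (j' : ℕ) = j)
    (z : SCobar (s + 1)) :
    sCodeg (s + 1) j (sCoface (s + 1) i z) = sCoface s i' (sCodeg s j' z) := by
  suffices H : (sCodeg (s + 1) j).comp (sCoface (s + 1) i) = (sCoface s i').comp (sCodeg s j') from
    DFunLike.congr_fun H z
  refine algHom_ext_zetaNat fun a ha n => ?_
  have hj2 := j'.2
  rw [AlgHom.comp_apply, AlgHom.comp_apply]
  rcases lt_trichotomy a (j' : ℕ) with h1 | h1 | h1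
  · rw [sCodeg_zetaNat_of_lt j' h1, sCoface_zetaNat_of_gt i ha (by omega),
      sCoface_zetaNat_of_gt i' (by omega) (by omega), sCodeg_zetaNat_of_lt j (by omega)]
  · rw [sCodeg_zetaNat_of_eq j' h1, sCoface_zetaNat_of_gt i ha (by omega),
      sCodeg_zetaNat_of_eq j (by omega)]
    split_ifs <;> simp
  · obtain ⟨a, rfl⟩ : ∃ b, a = b + 1 := ⟨a - 1, by omega⟩
    rw [sCodeg_zetaNat_of_gt j' (by omega) (by omega)]
    rcases lt_trichotomy (i : ℕ) (a + 2) with h2 | h2 | h2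
    · rw [sCoface_zetaNat_of_le i ha (by omega), sCoface_zetaNat_of_le i' (by omega) (by omega),
        sCodeg_zetaNat_of_gt j (by omega) (by omega)]
    · rw [sCoface_zetaNat_of_eq i ha (by omega), sCoface_zetaNat_of_eq i' (by omega) (by omega)]
      simp only [map_sum, map_mul, map_pow]
      refine Finset.sum_congr rfl fun q _ => ?_
      rw [sCodeg_zetaNat_of_gt j (by omega) (by omega),
        sCodeg_zetaNat_of_gt j (by omega) (by omega)]
    · rw [sCoface_zetaNat_of_gt i ha (by omega), sCoface_zetaNat_of_gt i' (by omega) (by omega),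
        sCodeg_zetaNat_of_gt j (by omega) (by omega)]

theorem sCodeg_sCodeg {s : ℕ} (j k : Fin (s + 2)) (j' k' : Fin (s + 1)) (h : (j : ℕ) ≤ k')
    (hj : (j' : ℕ) = j) (hk : (k' : ℕ) + 1 = k) (z : SCobar (s + 2)) :
    sCodeg s j' (sCodeg (s + 1) k z) = sCodeg s k' (sCodeg (s + 1) j z) := by
  suffices H : (sCodeg s j').comp (sCodeg (s + 1) k) = (sCodeg s k').comp (sCodeg (s + 1) j) from
    DFunLike.congr_fun H z
  refine algHom_ext_zetaNat fun a ha n => ?_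
  have hk2 := k.2
  rw [AlgHom.comp_apply, AlgHom.comp_apply]
  rcases lt_trichotomy a (j : ℕ) with h1 | h1 | h1
  · rw [sCodeg_zetaNat_of_lt k (by omega), sCodeg_zetaNat_of_lt j h1,
      sCodeg_zetaNat_of_lt j' (by omega), sCodeg_zetaNat_of_lt k' (by omega)]
  · rw [sCodeg_zetaNat_of_lt k (by omega), sCodeg_zetaNat_of_eq j h1,
      sCodeg_zetaNat_of_eq j' (by omega)]
    split_ifs <;> simp
  · obtain ⟨a, rfl⟩ : ∃ b, a = b + 1 := ⟨a - 1, by omega⟩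
    rw [sCodeg_zetaNat_of_gt j (by omega) (by omega)]
    rcases lt_trichotomy (a + 1) (k : ℕ) with h2 | h2 | h2
    · rw [sCodeg_zetaNat_of_lt k h2, sCodeg_zetaNat_of_gt j' (by omega) (by omega),
        sCodeg_zetaNat_of_lt k' (by omega)]
    · rw [sCodeg_zetaNat_of_eq k h2, sCodeg_zetaNat_of_eq k' (by omega)]
      split_ifs <;> simp
    · obtain ⟨a, rfl⟩ : ∃ b, a = b + 1 := ⟨a - 1, by omega⟩
      rw [sCodeg_zetaNat_of_gt k (by omega) (by omega),
        sCodeg_zetaNat_of_gt j' (by omega) (by omega),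
        sCodeg_zetaNat_of_gt k' (by omega) (by omega)]

/-- The sum of the coface maps with the two that the codegeneracy cancels left out. -/
theorem sCodeg_sCobarD {s : ℕ} (j : Fin (s + 1)) (z : SCobar s) :
    sCodeg s j (sCobarD s z) =
      ∑ i ∈ Finset.univ.filter fun i : Fin (s + 2) => (i : ℕ) ≠ j ∧ (i : ℕ) ≠ j + 1,
        sCodeg s j (sCoface s i z) := by
  classical
  rw [sCobarD_apply, map_sum, ← Finset.sum_filter_add_sum_filter_not Finset.univ
    (fun i : Fin (s + 2) => (i : ℕ) ≠ j ∧ (i : ℕ) ≠ j + 1), add_eq_left]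
  have : (Finset.univ.filter fun i : Fin (s + 2) => ¬((i : ℕ) ≠ j ∧ (i : ℕ) ≠ j + 1)) =
      {j.castSucc, j.succ} := by
    ext i
    simp only [Finset.mem_filter, Finset.mem_univ, true_and, Finset.mem_insert,
      Finset.mem_singleton, Fin.ext_iff, Fin.val_castSucc, Fin.val_succ]
    omega
  rw [this, Finset.sum_pair (by simp [Fin.ext_iff]), sCodeg_sCoface_self _ _ (by simp),
    sCodeg_sCoface_self _ _ (by simp), CharTwo.add_self_eq_zero]

theorem sCodeg_sCobarD_eq_zero {s : ℕ} {z : SCobar (s + 1)} (h : ∀ j, sCodeg s j z = 0)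
    (j : Fin (s + 2)) : sCodeg (s + 1) j (sCobarD (s + 1) z) = 0 := by
  rw [sCodeg_sCobarD]
  refine Finset.sum_eq_zero fun i hi => ?_
  have hi' := (Finset.mem_filter.1 hi).2
  have h1 := i.2
  have h2 := j.2
  rcases lt_or_ge (i : ℕ) j with h3 | h3
  · rw [sCodeg_sCoface_of_lt i j ⟨i, by omega⟩ ⟨j - 1, by omega⟩ h3 rfl (by simp; omega), h, map_zero]
  · rw [sCodeg_sCoface_of_gt i j ⟨i - 1, by omega⟩ ⟨j, by omega⟩ (by omega) (by simp; omega) rfl,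
      h, map_zero]

/-- Apply the k-th codegeneracy to dz = 0. The cofaces with i < k are annihilated, since an earlier
codegeneracy of z appears; those with i = k and i = k+1 cancel in characteristic 2; each later one
commutes past with its index lowered by one. -/
theorem sum_sCoface_sCodeg_eq_zero {s : ℕ} {z : SCobar (s + 2)} (hz : sCobarD (s + 2) z = 0)
    (k : Fin (s + 2)) (h : ∀ j : Fin (s + 2), (j : ℕ) < k → sCodeg (s + 1) j z = 0) :
    ∑ i ∈ Finset.univ.filter fun i : Fin (s + 3) => (k : ℕ) < i,
      sCoface (s + 1) i (sCodeg (s + 1) k z) = 0 := by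
  have h1 := sCodeg_sCobarD k.castSucc z
  rw [hz, map_zero, Finset.sum_filter, Fin.sum_univ_succ] at h1
  rw [Finset.sum_filter]
  have h2 : ∀ i : Fin (s + 4), (i : ℕ) < k → sCodeg (s + 2) k.castSucc (sCoface (s + 2) i z) = 0 := by
    intro i hi
    have := k.2
    rw [sCodeg_sCoface_of_lt i k.castSucc ⟨i, by omega⟩ ⟨k - 1, by omega⟩ hi rfl (by simp; omega),
      h _ (show (k : ℕ) - 1 < k by omega), map_zero]
  have h3 := k.2
  have h5 : (if ((0 : Fin (s + 4)) : ℕ) ≠ k.castSucc ∧ ((0 : Fin (s + 4)) : ℕ) ≠ k.castSucc + 1 then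
      (sCodeg (s + 2) k.castSucc) ((sCoface (s + 2) 0) z) else 0) = 0 := by
    split_ifs with hc
    · have := hc.1
      exact h2 0 (by rw [Fin.val_zero, Fin.val_castSucc] at *; omega)
    · rfl
  rw [h5, zero_add] at h1
  refine Eq.trans (Finset.sum_congr rfl fun i _ => ?_) h1.symm
  have h4 := i.2
  have h6 := Fin.val_succ i
  have h7 := Fin.val_castSucc k
  by_cases hi : (k : ℕ) < i
  · rw [if_pos hi, if_pos (by omega),
      sCodeg_sCoface_of_gt i.succ k.castSucc i k (by omega) (by omega) (by omega)]
  · rw [if_neg hi]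
    split_ifs with hc
    · exact (h2 i.succ (by omega)).symm
    · rfl

theorem sCodeg_mem_homog {s D : ℕ} (j : Fin (s + 1)) {z : SCobar (s + 1)}
    (hz : z ∈ homog (s + 1) D) : sCodeg s j z ∈ homog s D := by
  refine isWeightedHomogeneous_aeval (fun p => ?_) hz
  obtain ⟨a, n⟩ := p
  rcases Fin.eq_self_or_eq_succAbove j a with rfl | ⟨i, rfl⟩
  · rw [Fin.insertNth_apply_same]
    exact isWeightedHomogeneous_zero _ _ _
  · rw [Fin.insertNth_apply_succAbove]
    exact isWeightedHomogeneous_X (ZMod 2) (dg s) (i, n)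

/-- Normalization, one codegeneracy at a time: if those below k already vanish on a cocycle,
subtracting the differential of its k-th codegeneracy makes the k-th vanish as well and keeps the
earlier ones zero. -/
theorem exists_sCodeg_sub_sCobarD_eq_zero {s D : ℕ} {z : SCobar (s + 2)}
    (hz : sCobarD (s + 2) z = 0) (hD : z ∈ homog (s + 2) D) (n : ℕ) :
    ∃ u ∈ homog (s + 1) D, ∀ j : Fin (s + 2), (j : ℕ) < n →
      sCodeg (s + 1) j (z - sCobarD (s + 1) u) = 0 := by
  induction n with
  | zero => exact ⟨0, zero_mem _, fun j hj => absurd hj (Nat.not_lt_zero _)⟩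
  | succ k ih =>
    obtain ⟨u, huD, hu⟩ := ih
    by_cases hk : k < s + 2
    swap
    · exact ⟨u, huD, fun j _ => hu j (by omega)⟩
    set z₁ := z - sCobarD (s + 1) u with hz₁
    have hdz : sCobarD (s + 2) z₁ = 0 := by rw [hz₁, map_sub, hz, sCobarD_sCobarD, sub_zero]
    set w := sCodeg (s + 1) ⟨k, hk⟩ z₁ with hw
    have hsw : ∀ j : Fin (s + 1), (j : ℕ) < k → sCodeg s j w = 0 := by
      intro j hj
      have := j.2
      rw [hw, sCodeg_sCodeg j.castSucc ⟨k, hk⟩ j ⟨k - 1, by omega⟩ (by simp; omega) rfl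
        (by simp; omega), hu _ (by simpa using hj), map_zero]
    have hlt : ∀ (j : Fin (s + 2)) (i : Fin (s + 3)), (j : ℕ) ≤ k → (i : ℕ) < j →
        sCodeg (s + 1) j (sCoface (s + 1) i w) = 0 := by
      intro j i hj hi
      have h1 := i.2
      have h2 := j.2
      rw [sCodeg_sCoface_of_lt i j ⟨i, by omega⟩ ⟨j - 1, by omega⟩ hi rfl (by simp; omega),
        hsw _ (by simp; omega), map_zero]
    have hgt : ∀ (j : Fin (s + 2)) (i : Fin (s + 3)), (j : ℕ) < k → (j : ℕ) + 1 < i →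
        sCodeg (s + 1) j (sCoface (s + 1) i w) = 0 := by
      intro j i hj hi
      have h1 := i.2
      have h2 := j.2
      rw [sCodeg_sCoface_of_gt i j ⟨i - 1, by omega⟩ ⟨j, by omega⟩ hi (by simp; omega) rfl,
        hsw _ hj, map_zero]
    have hwD : w ∈ homog (s + 1) D :=
      sCodeg_mem_homog _ (sub_mem hD (sCobarD_mem_homog huD))
    refine ⟨u + w, add_mem huD hwD, fun j hj => ?_⟩
    rw [map_add, ← sub_sub, ← hz₁, map_sub, sub_eq_zero]
    rcases Nat.lt_succ_iff_lt_or_eq.1 hj with h | h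
    · rw [hu j h, sCodeg_sCobarD]
      symm
      refine Finset.sum_eq_zero fun i hi => ?_
      have hi' := (Finset.mem_filter.1 hi).2
      rcases lt_or_ge (i : ℕ) j with h3 | h3
      · exact hlt j i h.le h3
      · exact hgt j i h (by omega)
    · obtain rfl : j = ⟨k, hk⟩ := Fin.ext h
      rw [← hw, sCodeg_sCobarD]
      -- Applying the k-th codegeneracy once more to the relation of `sum_sCoface_sCodeg_eq_zero`
      -- expresses w as the sum of the terms with i > k+1. These are the terms of the codegeneracy
      -- of dw that do not cancel or vanish.
      have hA := congrArg (sCodeg (s + 1) ⟨k, hk⟩)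
        (sum_sCoface_sCodeg_eq_zero hdz ⟨k, hk⟩ fun j hj => hu j hj)
      rw [map_zero, map_sum, ← hw, Finset.sum_filter,
        ← Finset.add_sum_erase _ _ (Finset.mem_univ (⟨k + 1, by omega⟩ : Fin (s + 3))),
        if_pos (Nat.lt_succ_self k), sCodeg_sCoface_self _ _ (by simp)] at hA
      rw [Finset.sum_filter,
        ← Finset.add_sum_erase _ _ (Finset.mem_univ (⟨k + 1, by omega⟩ : Fin (s + 3))),
        if_neg (by simp), zero_add]
      rw [CharTwo.add_eq_zero] at hA
      refine hA.trans ?_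
      refine Finset.sum_congr rfl fun i hi => ?_
      have hi' : (i : ℕ) ≠ k + 1 := fun h => (Finset.mem_erase.1 hi).1 (Fin.ext h)
      dsimp only
      by_cases h1 : k < i
      · rw [if_pos h1, if_pos (show (i : ℕ) ≠ k ∧ (i : ℕ) ≠ k + 1 by omega)]
      · rw [if_neg h1]
        split_ifs with hc
        · exact (hlt ⟨k, hk⟩ i le_rfl (show (i : ℕ) < k by omega)).symm
        · rfl

/-- The normalized cochains, that is those in the kernel of all codegeneracies. -/
def normalized : (s : ℕ) → Submodule (ZMod 2) (SCobar s)
  | 0 => ⊤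
  | s + 1 => ⨅ j : Fin (s + 1), (sCodeg s j).toLinearMap.ker

theorem mem_normalized {s : ℕ} {z : SCobar (s + 1)} :
    z ∈ normalized (s + 1) ↔ ∀ j, sCodeg s j z = 0 := by
  simp [normalized]

theorem sCobarD_mem_normalized {s : ℕ} {z : SCobar (s + 1)} (h : z ∈ normalized (s + 1)) :
    sCobarD (s + 1) z ∈ normalized (s + 2) :=
  mem_normalized.2 (sCodeg_sCobarD_eq_zero (mem_normalized.1 h))

theorem exists_sub_sCobarD_mem_normalized {s D : ℕ} {z : SCobar (s + 2)}
    (hz : sCobarD (s + 2) z = 0) (hD : z ∈ homog (s + 2) D) :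
    ∃ u ∈ homog (s + 1) D, z - sCobarD (s + 1) u ∈ normalized (s + 2) := by
  obtain ⟨u, huD, hu⟩ := exists_sCodeg_sub_sCobarD_eq_zero hz hD (s + 2)
  exact ⟨u, huD, mem_normalized.2 fun j => hu j j.2⟩

/-! ### Codegeneracies in the monomial basis -/

theorem sCodeg_blk_same {s : ℕ} (j : Fin (s + 1)) (S : Finset Bit) :
    sCodeg s j (blk j S) = if S = ∅ then 1 else 0 := by
  rw [blk, map_prod]
  split_ifs with h
  · rw [h, Finset.prod_empty]
  · obtain ⟨x, hx⟩ := Finset.nonempty_iff_ne_empty.2 h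
    refine Finset.prod_eq_zero hx ?_
    rw [map_pow, sCodeg, aeval_X, Fin.insertNth_apply_same, zero_pow (by positivity)]

theorem sCodeg_blk_succAbove {s : ℕ} (j : Fin (s + 1)) (i : Fin s) (S : Finset Bit) :
    sCodeg s j (blk (j.succAbove i) S) = blk i S := by
  rw [blk, blk, map_prod]
  refine Finset.prod_congr rfl fun x _ => ?_
  rw [map_pow, sCodeg, aeval_X, Fin.insertNth_apply_succAbove]

theorem sCodeg_mon {s : ℕ} (j : Fin (s + 1)) (w : Fin (s + 1) → Finset Bit) :
    sCodeg s j (mon w) = if w j = ∅ then mon (j.removeNth w) else 0 := by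
  rw [mon, map_prod, Fin.prod_univ_succAbove _ j, sCodeg_blk_same]
  simp only [sCodeg_blk_succAbove, ite_mul, one_mul, zero_mul]
  rfl

theorem coeff_sCodeg {s : ℕ} (j : Fin (s + 1)) (w : Fin s → Finset Bit) (z : SCobar (s + 1)) :
    coeff (expo w) (sCodeg s j z) =
      coeff (expo (Fin.insertNth (α := fun _ => Finset Bit) j ∅ w)) z := by
  induction z using MvPolynomial.induction_on' with
  | add p q hp hq => rw [map_add, coeff_add, coeff_add, hp, hq]
  | monomial e c =>
    obtain ⟨u, rfl⟩ := expo_surjective _ e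
    have h2 : (monomial (expo u) c : SCobar (s + 1)) = c • mon u := by
      rw [mon_eq, smul_monomial, smul_eq_mul, mul_one]
    rw [h2, map_smul, coeff_smul, coeff_smul, sCodeg_mon, mon_eq u, coeff_monomial]
    congr 1
    have h3 : expo u = expo (Fin.insertNth (α := fun _ => Finset Bit) j ∅ w) ↔
        u j = ∅ ∧ j.removeNth u = w := by
      rw [(expo_injective _).eq_iff, eq_comm, Fin.insertNth_eq_iff, eq_comm, @eq_comm _ w]
    by_cases h4 : u j = ∅
    · rw [if_pos h4, mon_eq, coeff_monomial]
      refine if_congr ?_ rfl rfl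
      rw [(expo_injective _).eq_iff, h3]
      simp [h4]
    · rw [if_neg h4, if_neg (by rw [h3]; tauto), coeff_zero]

/-- A codegeneracy reads off the coefficients on the words with an empty entry at the given place.
Normalized cochains thus match the words in nonempty sets used for the exterior algebra. -/
theorem mem_normalized_iff_coeff {s : ℕ} {z : SCobar (s + 1)} :
    z ∈ normalized (s + 1) ↔ ∀ w, (∃ a, w a = ∅) → coeff (expo w) z = 0 := by
  rw [mem_normalized]
  constructor
  · rintro h w ⟨a, ha⟩
    have := coeff_sCodeg a (a.removeNth w) z
    rwa [h, coeff_zero, ← ha, Fin.insertNth_self_removeNth, eq_comm] at this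
  · intro h j
    ext e
    obtain ⟨w, rfl⟩ := expo_surjective _ e
    rw [coeff_sCodeg, coeff_zero]
    exact h _ ⟨j, Fin.insertNth_apply_same _ _ _⟩

/-! ### The differential in the monomial basis -/

theorem sCoface_zero_mon {s : ℕ} (w : Fin s → Finset Bit) :
    sCoface s 0 (mon w) = mon (Fin.cons (α := fun _ => Finset Bit) ∅ w) := by
  rw [mon, mon, map_prod, Fin.prod_univ_succ]
  simp only [Fin.cons_zero, Fin.cons_succ, blk, Finset.prod_empty, one_mul, map_prod, map_pow]
  refine Finset.prod_congr rfl fun a _ => Finset.prod_congr rfl fun x _ => ?_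
  rw [sCoface, aeval_X]
  simp [zeta]

theorem sCoface_last_mon {s : ℕ} (w : Fin s → Finset Bit) :
    sCoface s (Fin.last (s + 1)) (mon w) = mon (Fin.snoc (α := fun _ => Finset Bit) w ∅) := by
  rw [mon, mon, map_prod, Fin.prod_univ_castSucc]
  simp only [Fin.snoc_castSucc, Fin.snoc_last, blk, Finset.prod_empty, mul_one, map_prod, map_pow]
  refine Finset.prod_congr rfl fun a _ => Finset.prod_congr rfl fun x _ => ?_
  have := a.2
  rw [sCoface, aeval_X]
  dsimp only
  rw [if_neg (by simp), if_neg (by simp; omega), zeta]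

theorem coeff_eq_zero_of_mon {s : ℕ} (f : SCobar s →ₐ[ZMod 2] SCobar (s + 1))
    (g : (Fin s → Finset Bit) → Fin (s + 1) → Finset Bit) (hf : ∀ w, f (mon w) = mon (g w))
    {u : Fin (s + 1) → Finset Bit} (hu : ∀ w, g w ≠ u) (z : SCobar s) :
    coeff (expo u) (f z) = 0 := by
  induction z using MvPolynomial.induction_on' with
  | add p q hp hq => rw [map_add, coeff_add, hp, hq, add_zero]
  | monomial e c =>
    obtain ⟨w, rfl⟩ := expo_surjective _ e
    have h2 : (monomial (expo w) c : SCobar s) = c • mon w := by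
      rw [mon_eq, smul_monomial, smul_eq_mul, mul_one]
    rw [h2, map_smul, coeff_smul, hf, mon_eq, coeff_monomial,
      if_neg ((expo_injective _).ne (hu w)), smul_zero]

/-- The two outer cofaces insert an empty entry, so they do not contribute at words with nonempty
entries. The remaining sum is that of `extD_ofFn`. -/
theorem coeff_sCobarD {s : ℕ} (z : SCobar s) (u : Fin (s + 1) → Finset Bit)
    (hz : z ∈ wtLt s (wordWt u + 1)) (hu : ∀ a, u a ≠ ∅) :
    coeff (expo u) (sCobarD s z) = ∑ k : Fin s,
      if Disjoint (u k.castSucc) (u k.succ) then coeff (expo (mergeWord k u)) z else 0 := by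
  rw [sCobarD_apply, Fin.sum_univ_castSucc, Fin.sum_univ_succ, coeff_add, coeff_add, coeff_sum,
    Fin.castSucc_zero, coeff_eq_zero_of_mon _ _ sCoface_zero_mon,
    coeff_eq_zero_of_mon _ _ sCoface_last_mon, zero_add, add_zero]
  · exact Finset.sum_congr rfl fun k _ => coeff_sCoface k z u hz
  · rintro w rfl
    exact hu _ (Fin.snoc_last _ _)
  · rintro w rfl
    exact hu _ (Fin.cons_zero _ _)

/-- The internal degree of a word. -/
def wordDeg {s : ℕ} (w : Fin s → Finset Bit) : ℕ := ∑ a, ∑ x ∈ w a, 2 ^ x.2 * (2 ^ (x.1 + 1) - 1)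

theorem mon_mem_homog {s : ℕ} (w : Fin s → Finset Bit) : mon w ∈ homog s (wordDeg w) := by
  refine IsWeightedHomogeneous.prod _ _ _ fun a _ => IsWeightedHomogeneous.prod _ _ _ fun x _ => ?_
  exact (isWeightedHomogeneous_X (ZMod 2) (dg s) (a, x.1)).pow (2 ^ x.2)

theorem wordDeg_eq_of_coeff_ne_zero {s D : ℕ} {z : SCobar s} (hz : z ∈ homog s D)
    {w : Fin s → Finset Bit} (hw : coeff (expo w) z ≠ 0) : wordDeg w = D := by
  have h1 := hz hw
  have h2 := mon_mem_homog w (d := expo w) (by rw [mon_eq, coeff_monomial, if_pos rfl]; simp)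
  exact h2.symm.trans h1

theorem mon_mem_normalized {s : ℕ} {w : Fin (s + 1) → Finset Bit} (hw : ∀ a, w a ≠ ∅) :
    mon w ∈ normalized (s + 1) := by
  classical
  refine mem_normalized_iff_coeff.2 fun u hu => ?_
  rw [mon_eq, coeff_monomial, if_neg]
  intro h
  obtain ⟨a, ha⟩ := hu
  rw [← expo_injective _ h] at ha
  exact hw a ha

theorem coeff_mon {s : ℕ} (u w : Fin s → Finset Bit) :
    coeff (expo u) (mon w) = if w = u then 1 else 0 := by
  classical
  rw [mon_eq, coeff_monomial]
  exact if_congr (expo_injective _).eq_iff rfl rfl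

/-! ### Merging words -/

theorem sum_mergeWord {s : ℕ} (k : Fin s) (u : Fin (s + 1) → Finset Bit) (f : Bit → ℕ)
    (h : Disjoint (u k.castSucc) (u k.succ)) :
    ∑ a, ∑ x ∈ mergeWord k u a, f x = ∑ a, ∑ x ∈ u a, f x := by
  have hk : k.castSucc.succAbove k = k.succ := Fin.succAbove_castSucc_self k
  rw [Fin.sum_univ_succAbove _ k.castSucc, Fintype.sum_eq_add_sum_compl k,
    Fintype.sum_eq_add_sum_compl k (fun i => ∑ x ∈ u (k.castSucc.succAbove i), f x), hk,
    ← add_assoc, mergeWord, Function.update_self, Finset.sum_union h]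
  congr 1
  refine Finset.sum_congr rfl fun i hi => ?_
  rw [Function.update_of_ne (by simpa using hi)]

theorem wordWt_mergeWord {s : ℕ} (k : Fin s) (u : Fin (s + 1) → Finset Bit)
    (h : Disjoint (u k.castSucc) (u k.succ)) : wordWt (mergeWord k u) = wordWt u :=
  sum_mergeWord k u _ h

theorem wordDeg_mergeWord {s : ℕ} (k : Fin s) (u : Fin (s + 1) → Finset Bit)
    (h : Disjoint (u k.castSucc) (u k.succ)) : wordDeg (mergeWord k u) = wordDeg u :=
  sum_mergeWord k u _ h

theorem sCobarD_mem_wtLt {s N : ℕ} {z : SCobar (s + 1)} (hn : z ∈ normalized (s + 1))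
    (hz : z ∈ wtLt (s + 1) N) : sCobarD (s + 1) z ∈ wtLt (s + 2) N := by
  intro e he
  obtain ⟨u, rfl⟩ := expo_surjective _ e
  rw [wt_expo] at he
  by_cases hu : ∃ a, u a = ∅
  · exact mem_normalized_iff_coeff.1 (sCobarD_mem_normalized hn) u hu
  · rw [coeff_sCobarD z u (wtLt_mono (by omega) hz) (by push Not at hu; exact fun a => (hu a).ne_empty)]
    refine Finset.sum_eq_zero fun k _ => ?_
    split_ifs with h
    · refine hz _ ?_
      rwa [wt_expo, wordWt_mergeWord k u h]
    · rfl

theorem mergeWord_zero {s : ℕ} (A B : Finset Bit) (u : Fin s → Finset Bit) :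
    mergeWord 0 (Fin.cons (α := fun _ => Finset Bit) A (Fin.cons (α := fun _ => Finset Bit) B u)) =
      Fin.cons (α := fun _ => Finset Bit) (A ∪ B) u := by
  funext i
  refine Fin.cases ?_ (fun i => ?_) i
  · rw [mergeWord, Function.update_self]
    rfl
  · rw [mergeWord, Function.update_of_ne (Fin.succ_ne_zero i)]
    simp

theorem mergeWord_succ {s : ℕ} (k : Fin s) (A : Finset Bit) (u : Fin (s + 1) → Finset Bit) :
    mergeWord k.succ (Fin.cons (α := fun _ => Finset Bit) A u) =
      Fin.cons (α := fun _ => Finset Bit) A (mergeWord k u) := by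
  funext i
  refine Fin.cases ?_ (fun i => ?_) i
  · rw [mergeWord, Function.update_of_ne (Fin.succ_ne_zero k).symm]
    rfl
  · by_cases hi : i = k
    · subst hi
      simp only [mergeWord, Function.update_self, Fin.cons_succ, ← Fin.succ_castSucc]
    · rw [mergeWord, Function.update_of_ne (by simpa using hi), Fin.cons_succ, mergeWord,
        Function.update_of_ne hi, ← Fin.succ_castSucc, Fin.succ_succAbove_succ, Fin.cons_succ]

/-- Together with `coeff_sCobarD` this identifies the leading part of the differential with that of
the exterior algebra. -/
theorem extD_ofFn {s : ℕ} (z : List (Finset Bit) → ZMod 2) (u : Fin (s + 1) → Finset Bit) :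
    extD z (List.ofFn u) = ∑ k : Fin s,
      if Disjoint (u k.castSucc) (u k.succ) then z (List.ofFn (mergeWord k u)) else 0 := by
  induction s generalizing z with
  | zero => simp [extD_single]
  | succ s ih =>
    obtain ⟨A, u, rfl⟩ : ∃ A u', u = Fin.cons (α := fun _ => Finset Bit) A u' :=
      ⟨u 0, Fin.tail u, (Fin.cons_self_tail u).symm⟩
    have h1 := ih (fun l => z (A :: l)) u
    obtain ⟨B, u, rfl⟩ : ∃ B u', u = Fin.cons (α := fun _ => Finset Bit) B u' :=
      ⟨u 0, Fin.tail u, (Fin.cons_self_tail u).symm⟩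
    rw [List.ofFn_cons] at h1
    rw [Fin.sum_univ_succ, List.ofFn_cons, List.ofFn_cons, extD_cons_cons, h1,
      mergeWord_zero, List.ofFn_cons]
    simp only [mergeWord_succ, List.ofFn_cons]
    rfl

/-! ### Symmetric sums of coefficients -/

/-- The word whose blocks consist of a single element each. -/
def singles {s : ℕ} (v : Fin s → Bit) (a : Fin s) : Finset Bit := {v a}

theorem singles_injective (s : ℕ) : Function.Injective (singles (s := s)) := fun v v' h => by
  funext a
  exact Finset.singleton_injective (congrFun h a)

/-- The sum of the coefficients of `z` on the words that arise from `b` by a permutation of the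
tensor factors. -/
def symCoeff {s : ℕ} (b : Fin s → Bit) (z : SCobar s) : ZMod 2 :=
  ∑ v ∈ Finset.univ.image fun π : Equiv.Perm (Fin s) => b ∘ π, coeff (expo (singles v)) z

theorem symCoeff_add {s : ℕ} (b : Fin s → Bit) (z z' : SCobar s) :
    symCoeff b (z + z') = symCoeff b z + symCoeff b z' := by
  simp only [symCoeff, coeff_add, Finset.sum_add_distrib]

theorem symCoeff_smul {s : ℕ} (b : Fin s → Bit) (c : ZMod 2) (z : SCobar s) :
    symCoeff b (c • z) = c * symCoeff b z := by
  simp only [symCoeff, coeff_smul, Finset.mul_sum, smul_eq_mul]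

/-- `symCoeff` as a linear functional. -/
def symCoeffₗ {s : ℕ} (b : Fin s → Bit) : SCobar s →ₗ[ZMod 2] ZMod 2 where
  toFun := symCoeff b
  map_add' := symCoeff_add b
  map_smul' c z := by rw [symCoeff_smul]; rfl

theorem symCoeff_sub {s : ℕ} (b : Fin s → Bit) (z z' : SCobar s) :
    symCoeff b (z - z') = symCoeff b z - symCoeff b z' :=
  (symCoeffₗ b).map_sub z z'

theorem wordWt_singles_comp {s : ℕ} (b : Fin s → Bit) (π : Equiv.Perm (Fin s)) :
    wordWt (singles (b ∘ π)) = wordWt (singles b) := by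
  simp only [wordWt, singles, Finset.sum_singleton, Function.comp_apply]
  exact Equiv.sum_comp π fun a => 2 * (b a).1 + 1

theorem wordDeg_singles_comp {s : ℕ} (b : Fin s → Bit) (π : Equiv.Perm (Fin s)) :
    wordDeg (singles (b ∘ π)) = wordDeg (singles b) := by
  simp only [wordDeg, singles, Finset.sum_singleton, Function.comp_apply]
  exact Equiv.sum_comp π fun a => 2 ^ (b a).2 * (2 ^ ((b a).1 + 1) - 1)

theorem symCoeff_eq_zero_of_homog {s D : ℕ} {b : Fin s → Bit} {z : SCobar s} (hz : z ∈ homog s D)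
    (h : wordDeg (singles b) ≠ D) : symCoeff b z = 0 := by
  refine Finset.sum_eq_zero fun v hv => ?_
  obtain ⟨π, -, rfl⟩ := Finset.mem_image.1 hv
  by_contra hne
  exact h (by rw [← wordDeg_singles_comp b π]; exact wordDeg_eq_of_coeff_ne_zero hz hne)

theorem symCoeff_mon {s : ℕ} (b v : Fin s → Bit) :
    symCoeff b (mon (singles v)) =
      if v ∈ Finset.univ.image fun π : Equiv.Perm (Fin s) => b ∘ π then 1 else 0 := by
  simp only [symCoeff, coeff_mon, (singles_injective s).eq_iff]
  exact Finset.sum_ite_eq _ _ _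

theorem symCoeff_comp {s : ℕ} (b : Fin s → Bit) (ρ : Equiv.Perm (Fin s)) (z : SCobar s) :
    symCoeff (b ∘ ρ) z = symCoeff b z := by
  rw [symCoeff, symCoeff]
  congr 1
  ext v
  simp only [Finset.mem_image, Finset.mem_univ, true_and]
  constructor
  · rintro ⟨π, rfl⟩
    exact ⟨π.trans ρ, rfl⟩
  · rintro ⟨π, rfl⟩
    exact ⟨π.trans ρ.symm, by ext; simp⟩

theorem mergeWord_swap {s : ℕ} (k : Fin s) (u : Fin (s + 1) → Finset Bit) :
    mergeWord k (u ∘ Equiv.swap k.castSucc k.succ) = mergeWord k u := by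
  have hk : k.castSucc.succAbove k = k.succ := Fin.succAbove_castSucc_self k
  funext i
  by_cases hi : i = k
  · subst hi
    simp only [mergeWord, Function.update_self, Function.comp_apply, Equiv.swap_apply_left,
      Equiv.swap_apply_right]
    exact Finset.union_comm _ _
  · rw [mergeWord, mergeWord, Function.update_of_ne hi, Function.update_of_ne hi,
      Function.comp_apply, Equiv.swap_apply_of_ne_of_ne]
    · exact Fin.succAbove_ne _ _
    · rw [← hk]
      exact (Fin.succAbove_right_injective).ne hi

/-- For each k the terms cancel in pairs: exchanging the two bits that are merged gives another
rearrangement of b with the same merged word. When these two bits are equal the term is absent, as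
they are not disjoint. -/
theorem symCoeff_sCobarD {s : ℕ} (b : Fin (s + 1) → Bit) {z : SCobar s}
    (hz : z ∈ wtLt s (wordWt (singles b) + 1)) : symCoeff b (sCobarD s z) = 0 := by
  have h1 : ∀ v ∈ Finset.univ.image fun π : Equiv.Perm (Fin (s + 1)) => b ∘ π,
      coeff (expo (singles v)) (sCobarD s z) = ∑ k : Fin s,
        if v k.castSucc ≠ v k.succ then coeff (expo (mergeWord k (singles v))) z else 0 := by
    intro v hv
    obtain ⟨π, -, rfl⟩ := Finset.mem_image.1 hv
    rw [coeff_sCobarD z (singles (b ∘ π)) (by rwa [wordWt_singles_comp])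
      fun a => Finset.singleton_ne_empty _]
    refine Finset.sum_congr rfl fun k _ => if_congr ?_ rfl rfl
    simp only [singles]
    rw [Finset.disjoint_singleton]
  rw [symCoeff, Finset.sum_congr rfl h1, Finset.sum_comm]
  refine Finset.sum_eq_zero fun k _ => ?_
  refine Finset.sum_involution (fun v _ => v ∘ Equiv.swap k.castSucc k.succ) ?_ ?_ ?_ ?_
  · intro v hv
    simp only [Function.comp_apply, Equiv.swap_apply_left, Equiv.swap_apply_right]
    have : singles (v ∘ Equiv.swap k.castSucc k.succ) =
      singles v ∘ Equiv.swap k.castSucc k.succ := rfl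
    rw [this, mergeWord_swap, if_congr (ne_comm (a := v k.succ)) rfl rfl]
    exact CharTwo.add_self_eq_zero _
  · intro v hv hne h
    have h2 : v k.castSucc ≠ v k.succ := by
      by_contra h3
      rw [if_neg (by simpa using h3)] at hne
      exact hne rfl
    have h3 := congrFun h k.castSucc
    simp only [Function.comp_apply, Equiv.swap_apply_left] at h3
    exact h2 h3.symm
  · intro v hv
    obtain ⟨π, -, rfl⟩ := Finset.mem_image.1 hv
    exact Finset.mem_image.2 ⟨(Equiv.swap k.castSucc k.succ).trans π, Finset.mem_univ _, rfl⟩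
  · intro v hv
    ext a
    simp

/-! ### Removing the leading part of a cochain -/

/-- The binary digits of an exponent. -/
def digits {s : ℕ} (e : Fin s × ℕ →₀ ℕ) : Fin s → Finset Bit := (expo_surjective s e).choose

theorem digits_expo {s : ℕ} (w : Fin s → Finset Bit) : digits (expo w) = w :=
  expo_injective s (expo_surjective s (expo w)).choose_spec

theorem exists_subset_of_coeff_ne_zero {s : ℕ} (z : SCobar s) :
    ∃ L : Finset Bit, ∀ w, coeff (expo w) z ≠ 0 → ∀ a, w a ⊆ L := by
  classical
  refine ⟨z.support.biUnion fun e => Finset.univ.biUnion fun a => digits e a, fun w hw a => ?_⟩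
  refine subset_trans ?_ (Finset.subset_biUnion_of_mem _ (mem_support_iff.2 hw))
  rw [digits_expo]
  exact Finset.subset_biUnion_of_mem w (Finset.mem_univ a)

/-- The cochain with given coefficients on the words of weight `N` and degree `D` over `L`. -/
def ofCoeffs (s N D : ℕ) (L : Finset Bit) (f : (Fin s → Finset Bit) → ZMod 2) : SCobar s :=
  ∑ v ∈ (Fintype.piFinset fun _ : Fin s => L.powerset.erase ∅).filter
    fun v => wordWt v = N ∧ wordDeg v = D, f v • mon v

theorem coeff_ofCoeffs {s N D : ℕ} {L : Finset Bit} {f : (Fin s → Finset Bit) → ZMod 2}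
    (u : Fin s → Finset Bit) : coeff (expo u) (ofCoeffs s N D L f) =
      if (∀ a, u a ≠ ∅ ∧ u a ⊆ L) ∧ wordWt u = N ∧ wordDeg u = D then f u else 0 := by
  simp only [ofCoeffs, coeff_sum, coeff_smul, coeff_mon, smul_eq_mul, mul_ite, mul_one, mul_zero]
  rw [Finset.sum_ite_eq']
  refine if_congr ?_ rfl rfl
  simp [Fintype.mem_piFinset]

theorem ofCoeffs_mem_wtLt (s N D : ℕ) (L : Finset Bit) (f : (Fin s → Finset Bit) → ZMod 2) :
    ofCoeffs s N D L f ∈ wtLt s (N + 1) := by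
  intro e he
  obtain ⟨u, rfl⟩ := expo_surjective _ e
  rw [wt_expo] at he
  rw [coeff_ofCoeffs, if_neg]
  omega

theorem ofCoeffs_mem_homog (s N D : ℕ) (L : Finset Bit) (f : (Fin s → Finset Bit) → ZMod 2) :
    ofCoeffs s N D L f ∈ homog s D := by
  refine sum_mem fun v hv => Submodule.smul_mem _ _ ?_
  have := mon_mem_homog v
  rwa [(Finset.mem_filter.1 hv).2.2] at this

theorem ofCoeffs_mem_normalized (s N D : ℕ) (L : Finset Bit)
    (f : (Fin (s + 1) → Finset Bit) → ZMod 2) : ofCoeffs (s + 1) N D L f ∈ normalized (s + 1) := by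
  refine mem_normalized_iff_coeff.2 fun w hw => ?_
  obtain ⟨a, ha⟩ := hw
  rw [coeff_ofCoeffs, if_neg]
  intro h
  exact (h.1 a).1 ha

/-- The leading part of z is a cocycle for the exterior algebra, hence a coboundary away from sorted
words of single bits. At a sorted word the coefficient that is left is a symmetric sum, which is
zero by assumption. -/
theorem exists_sub_sCobarD_mem_wtLt {s N D : ℕ} {z : SCobar (s + 2)} (hn : z ∈ normalized (s + 2))
    (hD : z ∈ homog (s + 2) D) (hz : z ∈ wtLt (s + 2) (N + 1))
    (hdz : sCobarD (s + 2) z ∈ wtLt (s + 3) N)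
    (hsym : ∀ b, wordWt (singles b) = N → wordDeg (singles b) = D → symCoeff b z = 0) :
    ∃ U ∈ normalized (s + 1), U ∈ homog (s + 1) D ∧
      z - sCobarD (s + 1) U ∈ wtLt (s + 2) N := by
  classical
  obtain ⟨L, hL⟩ := exists_subset_of_coeff_ne_zero z
  -- The default ∅ is not read on lists of length s + 2, the only ones for which the value matters.
  let word : List (Finset Bit) → Fin (s + 2) → Finset Bit := fun l a => l.getD a ∅
  have hword : ∀ u : Fin (s + 2) → Finset Bit, word (List.ofFn u) = u := by
    intro u
    funext a
    simp only [word]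
    rw [List.getD_eq_getElem _ _ (by rw [List.length_ofFn]; exact a.2), List.getElem_ofFn]
  -- Only the part of weight exactly N is kept. Merging preserves weight, so this is a cocycle
  -- because dz has no part of weight N.
  let c : List (Finset Bit) → ZMod 2 := fun l =>
    if wordWt (word l) = N then coeff (expo (word l)) z else 0
  have hc : ∀ u, c (List.ofFn u) = if wordWt u = N then coeff (expo u) z else 0 := fun u => by
    simp only [c, hword]
  have hcoc : ∀ l, IsWord L (s + 2 + 1) l → extD c l = 0 := by
    intro l hl
    obtain ⟨u, rfl⟩ : ∃ u : Fin (s + 3) → Finset Bit, l = List.ofFn u :=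
      ⟨fun a => l.get (a.cast hl.1.symm), by
        refine List.ext_getElem (by rw [List.length_ofFn]; exact hl.1) fun i h1 h2 => ?_
        rw [List.getElem_ofFn]
        rfl⟩
    have hu : ∀ a, u a ≠ ∅ := fun a => (hl.2 _ (List.mem_ofFn.2 ⟨a, rfl⟩)).1.ne_empty
    rw [extD_ofFn]
    by_cases hN : wordWt u = N
    · have h1 := coeff_sCobarD z u (by rwa [hN]) hu
      rw [hdz _ (by rw [wt_expo, hN])] at h1
      refine Eq.trans (Finset.sum_congr rfl fun k _ => ?_) h1.symm
      split_ifs with h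
      · rw [hc, wordWt_mergeWord k u h, if_pos hN]
      · rfl
    · refine Finset.sum_eq_zero fun k _ => ?_
      split_ifs with h
      · rw [hc, wordWt_mergeWord k u h, if_neg hN]
      · rfl
  obtain ⟨f, hf⟩ := exists_eq_extD L (s + 2) c hcoc
  let U := ofCoeffs (s + 1) N D L fun v => f (List.ofFn v)
  have hUn : U ∈ normalized (s + 1) := ofCoeffs_mem_normalized _ _ _ _ _
  have hUN : U ∈ wtLt (s + 1) (N + 1) := ofCoeffs_mem_wtLt _ _ _ _ _
  have hUD : U ∈ homog (s + 1) D := ofCoeffs_mem_homog _ _ _ _ _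
  refine ⟨U, hUn, hUD, ?_⟩
  set z' := z - sCobarD (s + 1) U with hz'
  have hn' : z' ∈ normalized (s + 2) := sub_mem hn (sCobarD_mem_normalized hUn)
  have hN' : z' ∈ wtLt (s + 2) (N + 1) := sub_mem hz (sCobarD_mem_wtLt hUn hUN)
  have hD' : z' ∈ homog (s + 2) D := sub_mem hD (sCobarD_mem_homog hUD)
  have key : ∀ u, wordWt u = N → (¬ ∃ b : Fin (s + 2) → Bit, Monotone b ∧ u = singles b) →
      coeff (expo u) z' = 0 := by
    intro u hu hb
    by_contra hne
    have hemp : ∀ a, u a ≠ ∅ := by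
      intro a ha
      exact hne (mem_normalized_iff_coeff.1 hn' u ⟨a, ha⟩)
    have hdeg : wordDeg u = D := wordDeg_eq_of_coeff_ne_zero hD' hne
    have hcU := coeff_sCobarD U u (by rwa [hu]) hemp
    by_cases huL : ∀ a, u a ⊆ L
    · have hw : IsWord L (s + 2) (List.ofFn u) := by
        refine ⟨List.length_ofFn, fun A hA => ?_⟩
        obtain ⟨a, rfl⟩ := List.mem_ofFn.1 hA
        exact ⟨Finset.nonempty_iff_ne_empty.2 (hemp a), huL a⟩
      have h1 := hf _ hw <| by
        rintro ⟨m, hm, he⟩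
        have hlen : m.length = s + 2 := by
          have := congrArg List.length he
          simpa using this.symm
        refine hb ⟨fun a => m.get (a.cast hlen.symm), ?_, ?_⟩
        · intro i j hij
          rcases hij.lt_or_eq with h | rfl
          · exact List.pairwise_iff_get.1 hm _ _ h
          · exact le_rfl
        · funext a
          have h2 : (List.ofFn u)[(a : ℕ)]? = (m.map fun b => ({b} : Finset Bit))[(a : ℕ)]? := by
            rw [he]
          rw [List.getElem?_eq_getElem (by rw [List.length_ofFn]; exact a.2), List.getElem_ofFn,
            List.getElem?_eq_getElem (by rw [List.length_map, hlen]; exact a.2),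
            List.getElem_map] at h2
          exact Option.some_injective _ h2
      rw [hc, if_pos hu, extD_ofFn] at h1
      refine hne ?_
      rw [hz', coeff_sub, h1, hcU, sub_eq_zero]
      refine Finset.sum_congr rfl fun k _ => ?_
      split_ifs with h
      · rw [coeff_ofCoeffs, if_pos]
        refine ⟨fun a => ?_, by rw [wordWt_mergeWord k u h, hu],
          by rw [wordDeg_mergeWord k u h, hdeg]⟩
        rw [mergeWord]
        by_cases ha : a = k
        · subst ha
          rw [Function.update_self]
          refine ⟨?_, Finset.union_subset (huL _) (huL _)⟩
          exact ((Finset.nonempty_iff_ne_empty.2 (hemp _)).mono Finset.subset_union_left).ne_empty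
        · rw [Function.update_of_ne ha]
          exact ⟨hemp _, huL _⟩
      · rfl
    -- A word with a bit outside L has coefficient zero in z, and merging does not remove that bit,
    -- so U does not contribute either.
    · refine hne ?_
      rw [hz', coeff_sub, hcU, sub_eq_zero]
      have h1 : coeff (expo u) z = 0 := by
        by_contra h
        exact huL (hL u h)
      rw [h1]
      symm
      refine Finset.sum_eq_zero fun k _ => ?_
      split_ifs with h
      · rw [coeff_ofCoeffs, if_neg]
        rintro ⟨h2, -⟩
        refine huL fun a => ?_
        have hk : k.castSucc.succAbove k = k.succ := Fin.succAbove_castSucc_self k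
        have hkk := (h2 k).2
        rw [mergeWord, Function.update_self] at hkk
        rcases Fin.eq_self_or_eq_succAbove k.castSucc a with rfl | ⟨i, rfl⟩
        · exact Finset.subset_union_left.trans hkk
        · by_cases hi : i = k
          · subst hi
            rw [hk]
            exact Finset.subset_union_right.trans hkk
          · have := (h2 i).2
            rwa [mergeWord, Function.update_of_ne hi] at this
      · rfl
  intro e he
  obtain ⟨u, rfl⟩ := expo_surjective _ e
  rw [wt_expo] at he
  rcases he.lt_or_eq with h | h
  · exact hN' _ (by rw [wt_expo]; omega)
  by_cases hb : ∃ b : Fin (s + 2) → Bit, Monotone b ∧ u = singles b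
  swap
  · exact key u h.symm hb
  obtain ⟨b, hb, rfl⟩ := hb
  -- Among the rearrangements of b only b itself is sorted, and z' vanishes at the others.
  have h1 : symCoeff b z' = coeff (expo (singles b)) z' := by
    refine Finset.sum_eq_single b (fun v hv hne => ?_) fun hnot => ?_
    · obtain ⟨π, -, rfl⟩ := Finset.mem_image.1 hv
      refine key _ (by rw [wordWt_singles_comp, h]) ?_
      rintro ⟨b', hb', he⟩
      have he' := singles_injective _ he
      refine hne ?_
      have hp := Equiv.Perm.ofFn_comp_perm π b
      rw [he'] at hp ⊢
      exact List.ofFn_injective (hp.eq_of_sortedLE hb'.sortedLE_ofFn hb.sortedLE_ofFn)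
    · exact absurd (Finset.mem_image.2 ⟨1, Finset.mem_univ _, rfl⟩) hnot
  rw [← h1, hz', symCoeff_sub, symCoeff_sCobarD b (by rwa [← h]), sub_zero]
  by_cases hdeg : wordDeg (singles b) = D
  · exact hsym b h.symm hdeg
  · exact symCoeff_eq_zero_of_homog hD hdeg

/-! ### The differential of a word of single bits -/

theorem ofFn_perm_iff {s : ℕ} {v b : Fin s → Bit} :
    (List.ofFn v).Perm (List.ofFn b) ↔ ∃ π : Equiv.Perm (Fin s), b ∘ π = v := by
  constructor
  · intro h
    refine ⟨(Tuple.sort v).symm.trans (Tuple.sort b), ?_⟩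
    have h1 : (List.ofFn (v ∘ Tuple.sort v)).Perm (List.ofFn (b ∘ Tuple.sort b)) :=
      (Equiv.Perm.ofFn_comp_perm _ v).trans (h.trans (Equiv.Perm.ofFn_comp_perm _ b).symm)
    have h2 := List.ofFn_injective (h1.eq_of_sortedLE (Tuple.monotone_sort v).sortedLE_ofFn
      (Tuple.monotone_sort b).sortedLE_ofFn)
    funext a
    have := congrFun h2 ((Tuple.sort v).symm a)
    simp only [Function.comp_apply, Equiv.apply_symm_apply] at this
    simp [this]
  · rintro ⟨π, rfl⟩
    exact Equiv.Perm.ofFn_comp_perm π b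

theorem symCoeff_mon_singles {s : ℕ} (b v : Fin s → Bit) :
    symCoeff b (mon (singles v)) = if (List.ofFn v).Perm (List.ofFn b) then 1 else 0 := by
  rw [symCoeff_mon]
  refine if_congr ?_ rfl rfl
  rw [ofFn_perm_iff]
  simp

theorem symCoeff_mon_eq_zero {s : ℕ} (b : Fin s → Bit) {w : Fin s → Finset Bit}
    (h : ∀ v, w ≠ singles v) : symCoeff b (mon w) = 0 := by
  simp only [symCoeff, coeff_mon, h, if_false, Finset.sum_const_zero]

/-- The word that arises from `v` by replacing the `k`-th entry with two entries. -/
def splice {s : ℕ} (k : Fin s) (v : Fin s → Bit) (x y : Bit) : Fin (s + 1) → Bit :=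
  Fin.insertNth (α := fun _ => Bit) k.castSucc x (Function.update v k y)

theorem splice_zero {s : ℕ} (A : Bit) (v : Fin s → Bit) (x y : Bit) :
    splice 0 (Fin.cons (α := fun _ => Bit) A v) x y =
      Fin.cons (α := fun _ => Bit) x (Fin.cons (α := fun _ => Bit) y v) := by
  rw [splice, Fin.castSucc_zero, Fin.insertNth_zero', Fin.update_cons_zero]

theorem splice_succ {s : ℕ} (k : Fin s) (A : Bit) (v : Fin s → Bit) (x y : Bit) :
    splice k.succ (Fin.cons (α := fun _ => Bit) A v) x y =
      Fin.cons (α := fun _ => Bit) A (splice k v x y) := by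
  rw [splice, splice, ← Fin.cons_update, Fin.insertNth_eq_iff]
  constructor
  · rw [← Fin.succ_castSucc, Fin.cons_succ, Fin.insertNth_apply_same]
  · funext i
    refine Fin.cases ?_ (fun i => ?_) i
    · rfl
    · rw [Fin.cons_succ, Fin.removeNth, ← Fin.succ_castSucc, Fin.succ_succAbove_succ, Fin.cons_succ,
        Fin.insertNth_apply_succAbove]

/-- The left factor of the `i`-th summand of the reduced coproduct of the bit `x`. -/
def leftBit (x : Bit) (i : ℕ) : Bit := toLex (i, x.2)

/-- The right factor of the `i`-th summand of the reduced coproduct of the bit `x`. -/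
def rightBit (x : Bit) (i : ℕ) : Bit := toLex (x.1 - 1 - i, i + 1 + x.2)

theorem blk_singleton {s : ℕ} (a : Fin s) (x : Bit) : blk a {x} = X (a, x.1) ^ 2 ^ x.2 := by
  rw [blk, Finset.prod_singleton]

theorem mon_insertNth {s : ℕ} (k : Fin s) (A : Finset Bit) (w : Fin s → Finset Bit) :
    mon (Fin.insertNth (α := fun _ => Finset Bit) k.castSucc A w) =
      (blk k.castSucc A * blk k.succ (w k)) *
        ∏ i ∈ {k}ᶜ, blk (k.castSucc.succAbove i) (w i) := by
  have hk : k.castSucc.succAbove k = k.succ := Fin.succAbove_castSucc_self k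
  rw [mon, Fin.prod_univ_succAbove _ k.castSucc, Fintype.prod_eq_mul_prod_compl k, mul_assoc]
  simp only [Fin.insertNth_apply_same, Fin.insertNth_apply_succAbove]
  rw [hk]

theorem mon_insertNth_update {s : ℕ} (k : Fin s) (A B : Finset Bit) (w : Fin s → Finset Bit) :
    mon (Fin.insertNth (α := fun _ => Finset Bit) k.castSucc A (Function.update w k B)) =
      (blk k.castSucc A * blk k.succ B) *
        ∏ i ∈ {k}ᶜ, blk (k.castSucc.succAbove i) (w i) := by
  rw [mon_insertNth, Function.update_self]
  congr 1
  refine Finset.prod_congr rfl fun i hi => ?_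
  rw [Function.update_of_ne (by simpa using hi)]

theorem insertNth_succ_empty {s : ℕ} (k : Fin s) (w : Fin s → Finset Bit) :
    Fin.insertNth (α := fun _ => Finset Bit) k.succ ∅ w =
      Fin.insertNth (α := fun _ => Finset Bit) k.castSucc (w k) (Function.update w k ∅) := by
  rw [Fin.insertNth_eq_iff]
  have hk : k.castSucc.succAbove k = k.succ := Fin.succAbove_castSucc_self k
  constructor
  · rw [← hk, Fin.insertNth_apply_succAbove, Function.update_self]
  · funext i
    rw [Fin.removeNth]
    rcases lt_trichotomy i k with h | rfl | h
    · have h1 : k.succ.succAbove i = k.castSucc.succAbove i := by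
        rw [Fin.succAbove_of_castSucc_lt _ _ (by
            rw [Fin.lt_def] at h ⊢; simp; omega),
          Fin.succAbove_of_castSucc_lt _ _ (by
            rw [Fin.lt_def] at h ⊢; simp; omega)]
      rw [h1, Fin.insertNth_apply_succAbove, Function.update_of_ne h.ne]
    · have h1 : i.succ.succAbove i = i.castSucc := Fin.succAbove_succ_self i
      rw [h1, Fin.insertNth_apply_same]
    · have h1 : k.succ.succAbove i = k.castSucc.succAbove i := by
        rw [Fin.succAbove_of_le_castSucc _ _ (by rw [Fin.le_def]; rw [Fin.lt_def] at h; simp; omega),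
          Fin.succAbove_of_le_castSucc _ _ (by rw [Fin.le_def]; rw [Fin.lt_def] at h; simp; omega)]
      rw [h1, Fin.insertNth_apply_succAbove, Function.update_of_ne h.ne']

theorem sCoface_X_pow {s : ℕ} (k : Fin s) (x : Bit) :
    sCoface s k.succ.castSucc (X (k, x.1) ^ 2 ^ x.2) =
      (X (k.castSucc, x.1) ^ 2 ^ x.2 + X (k.succ, x.1) ^ 2 ^ x.2) +
      ∑ i ∈ Finset.range x.1, X (k.castSucc, (leftBit x i).1) ^ 2 ^ (leftBit x i).2 *
        X (k.succ, (rightBit x i).1) ^ 2 ^ (rightBit x i).2 := by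
  obtain ⟨n, j⟩ := x
  have h0 : sCoface s k.succ.castSucc (X (k, n)) = ∑ q ∈ antidiagonal (n + 1),
      zeta (s + 1) k.castSucc q.1 * zeta (s + 1) k.succ q.2 ^ 2 ^ q.1 := by
    rw [sCoface, aeval_X]
    dsimp only
    rw [if_neg (by simp), if_pos (by simp)]
  dsimp only [leftBit, rightBit]
  rw [map_pow, h0]
  have h1 := Finset.Nat.sum_antidiagonal_eq_sum_range_succ
    (fun a b => (zeta (s + 1) k.castSucc a * zeta (s + 1) k.succ b ^ 2 ^ a : SCobar (s + 1))) (n + 1)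
  rw [h1, Finset.sum_range_succ', Finset.sum_range_succ, add_pow_char_pow, add_pow_char_pow,
    sum_pow_char_pow]
  have h2 : ∀ i ∈ Finset.range n, (zeta (s + 1) k.castSucc (i + 1) *
      zeta (s + 1) k.succ (n + 1 - (i + 1)) ^ 2 ^ (i + 1)) ^ 2 ^ j =
      X (k.castSucc, i) ^ 2 ^ j * X (k.succ, n - 1 - i) ^ 2 ^ (i + 1 + j) := by
    intro i hi
    have hi' := Finset.mem_range.1 hi
    rw [show n + 1 - (i + 1) = (n - 1 - i) + 1 by omega, zeta, zeta, mul_pow, ← pow_mul, ← pow_add]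
  rw [Finset.sum_congr rfl h2]
  simp only [Nat.sub_self, Nat.sub_zero, zeta, pow_zero, pow_one, one_pow, mul_one, one_mul]
  rw [add_assoc]
  exact add_comm _ _

theorem sCoface_mon_singles {s : ℕ} (k : Fin s) (v : Fin s → Bit) :
    sCoface s k.succ.castSucc (mon (singles v)) =
      (mon (Fin.insertNth (α := fun _ => Finset Bit) k.succ ∅ (singles v)) +
        mon (Fin.insertNth (α := fun _ => Finset Bit) k.castSucc ∅ (singles v))) +
      ∑ i ∈ Finset.range (v k).1,
        mon (singles (splice k v (leftBit (v k) i) (rightBit (v k) i))) := by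
  have h1 : sCoface s k.succ.castSucc (mon (singles v)) =
      sCoface s k.succ.castSucc (blk k (singles v k)) *
      ∏ i ∈ {k}ᶜ, blk (k.castSucc.succAbove i) (singles v i) := by
    rw [mon, map_prod, Fintype.prod_eq_mul_prod_compl k]
    congr 1
    refine Finset.prod_congr rfl fun i hi => ?_
    exact sCoface_blk_of_ne (by simpa using hi) _
  have h2 : ∀ x y, singles (splice k v x y) = Fin.insertNth (α := fun _ => Finset Bit) k.castSucc
      {x} (Function.update (singles v) k {y}) := by
    intro x y
    symm
    rw [Fin.insertNth_eq_iff]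
    constructor
    · rw [singles, splice, Fin.insertNth_apply_same]
    · funext i
      rw [Fin.removeNth, singles, splice, Fin.insertNth_apply_succAbove]
      by_cases hi : i = k
      · subst hi
        rw [Function.update_self, Function.update_self]
      · rw [Function.update_of_ne hi, Function.update_of_ne hi, singles]
  have h3 : ∀ a : Fin (s + 1), blk a ∅ = 1 := fun a => Finset.prod_empty
  simp only [h1, h2, mon_insertNth_update, insertNth_succ_empty]
  rw [mon_insertNth, h3, h3, mul_one, one_mul]
  rw [← Finset.sum_mul, ← add_mul, ← add_mul]
  congr 1
  simp only [singles, blk_singleton]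
  exact sCoface_X_pow k (v k)

/-- This holds in all weights. The words with an empty entry inserted occur twice for each of the s
+ 1 positions, counting those from the outer cofaces, so they cancel and only the reduced coproducts
remain. -/
theorem sCobarD_mon_singles {s : ℕ} (v : Fin s → Bit) :
    sCobarD s (mon (singles v)) = ∑ k, ∑ i ∈ Finset.range (v k).1,
        mon (singles (splice k v (leftBit (v k) i) (rightBit (v k) i))) := by
  rw [sCobarD_apply, Fin.sum_univ_castSucc, Fin.sum_univ_succ, Fin.castSucc_zero, sCoface_zero_mon,
    sCoface_last_mon]
  simp only [sCoface_mon_singles, Finset.sum_add_distrib]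
  have h0 : Fin.cons (α := fun _ => Finset Bit) ∅ (singles v) =
      Fin.insertNth (α := fun _ => Finset Bit) 0 ∅ (singles v) := (Fin.insertNth_zero' _ _).symm
  have h1 : Fin.snoc (α := fun _ => Finset Bit) (singles v) ∅ =
      Fin.insertNth (α := fun _ => Finset Bit) (Fin.last s) ∅ (singles v) :=
    (Fin.insertNth_last' _ _).symm
  have h2 := Fin.sum_univ_succ fun k : Fin (s + 1) =>
    mon (Fin.insertNth (α := fun _ => Finset Bit) k ∅ (singles v))
  have h3 := Fin.sum_univ_castSucc fun k : Fin (s + 1) =>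
    mon (Fin.insertNth (α := fun _ => Finset Bit) k ∅ (singles v))
  rw [h0, h1]
  generalize (∑ k : Fin s, ∑ i ∈ Finset.range (v k).1,
        mon (singles (splice k v (leftBit (v k) i) (rightBit (v k) i)))) = c
  rw [show ∀ a b d e : SCobar (s + 1), a + (b + d + c) + e = (a + b) + (d + e) + c from
    fun a b d e => by ring, ← h2, ← h3, CharTwo.add_self_eq_zero, zero_add]

/-! ### Words as lists -/

/-- All words obtained from a list of bits by replacing one of them by a summand of its reduced
coproduct. -/
def splices : List (ℕ × ℕ) → List (List (ℕ × ℕ))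
  | [] => []
  | x :: l => ((List.range x.1).map fun i => (i, x.2) :: (x.1 - 1 - i, i + 1 + x.2) :: l) ++
      (splices l).map fun l' => x :: l'

/-- The word with the bits in the list `l`. -/
def bitWord (s : ℕ) (l : List (ℕ × ℕ)) (a : Fin s) : Bit := toLex (l.getD a (0, 0))

theorem bitWord_cons (s : ℕ) (x : ℕ × ℕ) (l : List (ℕ × ℕ)) :
    bitWord (s + 1) (x :: l) = Fin.cons (α := fun _ => Bit) (toLex x) (bitWord s l) := by
  funext a
  refine Fin.cases ?_ (fun a => ?_) a
  · rfl
  · simp [bitWord]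

/-- Passing to lists of pairs of natural numbers makes the differential of an explicit word
computable by evaluation. -/
theorem sum_splices {s : ℕ} {M : Type} [AddCommMonoid M] (f : (Fin (s + 1) → Bit) → M)
    {l : List (ℕ × ℕ)} (hl : l.length = s) :
    ∑ k, ∑ i ∈ Finset.range (bitWord s l k).1,
      f (splice k (bitWord s l) (leftBit (bitWord s l k) i) (rightBit (bitWord s l k) i)) =
      ((splices l).map fun l' => f (bitWord (s + 1) l')).sum := by
  induction l generalizing s with
  | nil =>
    subst hl
    simp [splices]
  | cons x l ih =>
    obtain ⟨s, rfl⟩ : ∃ t, s = t + 1 := ⟨s - 1, by simp at hl; omega⟩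
    have hl' : l.length = s := by simpa using hl
    have h1 := ih (fun v => f (Fin.cons (α := fun _ => Bit) (toLex x) v)) hl'
    simp only [splices, List.map_append, List.sum_append, List.map_map, Function.comp_def,
      bitWord_cons] at h1 ⊢
    rw [Fin.sum_univ_succ, ← h1]
    simp only [splice_succ, Fin.cons_succ, splice_zero, Fin.cons_zero]
    congr 1

theorem sCobarD_mon_bitWord {s : ℕ} {l : List (ℕ × ℕ)} (hl : l.length = s) :
    sCobarD s (mon (singles (bitWord s l))) =
      ((splices l).map fun l' => mon (singles (bitWord (s + 1) l'))).sum := by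
  rw [sCobarD_mon_singles, sum_splices (fun v => mon (singles v)) hl]

/-- The word whose blocks are the lists in `w`. -/
def blockWord (s : ℕ) (w : List (List (ℕ × ℕ))) (a : Fin s) : Finset Bit :=
  ((w.getD a []).map toLex).toFinset

/-- The sum of the monomials with the given blocks. -/
def ofWords (s : ℕ) (P : List (List (List (ℕ × ℕ)))) : SCobar s :=
  (P.map fun w => mon (blockWord s w)).sum

/-- The blocks of a word are nonempty and have no repetitions. -/
def IsProper (s : ℕ) (w : List (List (ℕ × ℕ))) : Prop :=
  w.length = s ∧ ∀ A ∈ w, A ≠ [] ∧ A.Nodup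

instance (s : ℕ) (w : List (List (ℕ × ℕ))) : Decidable (IsProper s w) :=
  inferInstanceAs (Decidable (_ ∧ _))

theorem sum_blockWord {s : ℕ} {w : List (List (ℕ × ℕ))} (h : IsProper s w) (f : ℕ × ℕ → ℕ) :
    ∑ a, ∑ x ∈ blockWord s w a, f (ofLex x) = (w.map fun A => (A.map f).sum).sum := by
  obtain ⟨rfl, h⟩ := h
  have h1 : ∀ a : Fin w.length, ∑ x ∈ blockWord w.length w a, f (ofLex x) =
      (w[a].map f).sum := by
    intro a
    have h2 : w.getD a [] = w[a] := List.getD_eq_getElem _ _ a.2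
    have h3 := (h w[a] (List.getElem_mem a.2)).2
    rw [blockWord, h2, List.sum_toFinset _ (h3.map toLex.injective), List.map_map]
    rfl
  rw [Finset.sum_congr rfl fun a _ => h1 a, ← List.sum_ofFn]
  congr 1
  refine List.ext_getElem (by simp) fun i h1 h2 => ?_
  simp

/-- The weight of a list of blocks. -/
def listWt (w : List (List (ℕ × ℕ))) : ℕ := (w.map fun A => (A.map fun x => 2 * x.1 + 1).sum).sum

/-- The internal degree of a list of blocks. -/
def listDeg (w : List (List (ℕ × ℕ))) : ℕ :=
  (w.map fun A => (A.map fun x => 2 ^ x.2 * (2 ^ (x.1 + 1) - 1)).sum).sum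

theorem wordWt_blockWord {s : ℕ} {w : List (List (ℕ × ℕ))} (h : IsProper s w) :
    wordWt (blockWord s w) = listWt w := sum_blockWord h fun x => 2 * x.1 + 1

theorem wordDeg_blockWord {s : ℕ} {w : List (List (ℕ × ℕ))} (h : IsProper s w) :
    wordDeg (blockWord s w) = listDeg w := sum_blockWord h fun x => 2 ^ x.2 * (2 ^ (x.1 + 1) - 1)

theorem ofWords_mem {s : ℕ} {P : List (List (List (ℕ × ℕ)))} (S : Submodule (ZMod 2) (SCobar s))
    (h : ∀ w ∈ P, mon (blockWord s w) ∈ S) : ofWords s P ∈ S :=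
  list_sum_mem fun z hz => by
    obtain ⟨w, hw, rfl⟩ := List.mem_map.1 hz
    exact h w hw

theorem ofWords_mem_wtLt {s N : ℕ} {P : List (List (List (ℕ × ℕ)))}
    (h : ∀ w ∈ P, IsProper s w ∧ listWt w < N) : ofWords s P ∈ wtLt s N :=
  ofWords_mem _ fun w hw => mon_mem_wtLt (by rw [wordWt_blockWord (h w hw).1]; exact (h w hw).2)

theorem ofWords_mem_homog {s D : ℕ} {P : List (List (List (ℕ × ℕ)))}
    (h : ∀ w ∈ P, IsProper s w ∧ listDeg w = D) : ofWords s P ∈ homog s D :=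
  ofWords_mem _ fun w hw => by
    rw [← (h w hw).2, ← wordDeg_blockWord (h w hw).1]
    exact mon_mem_homog _

theorem ofWords_mem_normalized {s : ℕ} {P : List (List (List (ℕ × ℕ)))}
    (h : ∀ w ∈ P, IsProper (s + 1) w) : ofWords (s + 1) P ∈ normalized (s + 1) :=
  ofWords_mem _ fun w hw => mon_mem_normalized fun a ha => by
    obtain ⟨h1, h2⟩ := h w hw
    have ha' : (a : ℕ) < w.length := by rw [h1]; exact a.2
    refine (h2 _ (List.getElem_mem ha')).1 ?_
    rwa [blockWord, List.getD_eq_getElem _ _ ha', List.toFinset_eq_empty_iff,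
      List.map_eq_nil_iff] at ha

theorem blockWord_singletons (s : ℕ) {l : List (ℕ × ℕ)} (hl : l.length = s) :
    blockWord s (l.map fun x => [x]) = singles (bitWord s l) := by
  subst hl
  funext a
  rw [blockWord, singles, bitWord, List.getD_eq_getElem _ _ (by rw [List.length_map]; exact a.2),
    List.getD_eq_getElem _ _ a.2, List.getElem_map]
  rfl

theorem ofFn_bitWord {s : ℕ} {l : List (ℕ × ℕ)} (hl : l.length = s) :
    List.ofFn (bitWord s l) = l.map toLex := by
  subst hl
  refine List.ext_getElem (by simp) fun i h1 h2 => ?_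
  rw [List.getElem_ofFn, List.getElem_map, bitWord, List.getD_eq_getElem]

theorem symCoeff_mon_blockWord {s : ℕ} {b : List (ℕ × ℕ)} {w : List (List (ℕ × ℕ))}
    (hb : b.length = s) (hw : IsProper s w) :
    symCoeff (bitWord s b) (mon (blockWord s w)) =
      if w.Perm (b.map fun x => [x]) then 1 else 0 := by
  have hinj : Function.Injective fun x : ℕ × ℕ => [x] := fun x y h => by simpa using h
  by_cases h : ∃ l : List (ℕ × ℕ), w = l.map fun x => [x]
  · obtain ⟨l, rfl⟩ := h
    have hl : l.length = s := by simpa using hw.1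
    rw [blockWord_singletons s hl, symCoeff_mon_singles, ofFn_bitWord hl, ofFn_bitWord hb]
    refine if_congr ?_ rfl rfl
    rw [List.map_perm_map_iff toLex.injective, List.map_perm_map_iff hinj]
  · rw [if_neg]
    · refine symCoeff_mon_eq_zero _ fun v hv => h ?_
      obtain ⟨rfl, h2⟩ := hw
      refine ⟨(List.ofFn v).map ofLex, List.ext_getElem (by simp) fun i h3 h4 => ?_⟩
      have h5 := congrFun hv ⟨i, h3⟩
      rw [blockWord, List.getD_eq_getElem _ _ h3, singles] at h5
      have h6 := (h2 _ (List.getElem_mem h3)).2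
      have h7 : (w[i].map toLex).Perm [v ⟨i, h3⟩] := by
        refine List.perm_of_nodup_nodup_toFinset_eq (h6.map toLex.injective) (by simp) ?_
        rw [h5]
        rfl
      rw [List.perm_singleton] at h7
      have h8 := congrArg (List.map ofLex) h7
      rw [List.map_map] at h8
      simpa using h8
    · intro h1
      refine h ⟨w.map fun A => A.headD (0, 0), ?_⟩
      rw [List.map_map]
      symm
      refine (List.map_congr_left fun A hA => ?_).trans (List.map_id _)
      obtain ⟨x, -, rfl⟩ := List.mem_map.1 (h1.subset hA)
      rfl

theorem symCoeff_ofWords {s : ℕ} {b : List (ℕ × ℕ)} {P : List (List (List (ℕ × ℕ)))}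
    (hb : b.length = s) (hP : ∀ w ∈ P, IsProper s w) :
    symCoeff (bitWord s b) (ofWords s P) =
      (P.map fun w => if w.Perm (b.map fun x => [x]) then (1 : ZMod 2) else 0).sum := by
  have h1 := map_list_sum (symCoeffₗ (bitWord s b)) (P.map fun w => mon (blockWord s w))
  refine h1.trans ?_
  rw [List.map_map]
  congr 1
  exact List.map_congr_left fun w hw => symCoeff_mon_blockWord hb (hP w hw)

/-! ### The cochains that account for the symmetric words of degree 24 -/

theorem length_of_mem_splices {l l' : List (ℕ × ℕ)} (h : l' ∈ splices l) :
    l'.length = l.length + 1 := by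
  induction l generalizing l' with
  | nil => simp [splices] at h
  | cons x l ih =>
    simp only [splices, List.mem_append, List.mem_map] at h
    rcases h with ⟨i, -, rfl⟩ | ⟨l'', h, rfl⟩
    · simp
    · simp [ih h]

/-- The word with single bits in all blocks. -/
def toWord (l : List (ℕ × ℕ)) : List (List (ℕ × ℕ)) := l.map fun x => [x]

theorem sCobarD_ofWords_toWord {s : ℕ} {l : List (ℕ × ℕ)} (hl : l.length = s) :
    sCobarD s (ofWords s [toWord l]) = ofWords (s + 1) ((splices l).map toWord) := by
  rw [ofWords, ofWords, List.map_singleton, List.sum_singleton, toWord, blockWord_singletons s hl,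
    sCobarD_mon_bitWord hl, List.map_map]
  congr 1
  refine List.map_congr_left fun l' hl' => ?_
  rw [Function.comp_apply, toWord,
    blockWord_singletons _ (by rw [length_of_mem_splices hl', hl])]

/-- A cochain with a leading term `key`, whose differential has a leading term `tag`. -/
structure TaggedCochain where
  key : List (ℕ × ℕ)
  tag : List (ℕ × ℕ)
  words : List (List (List (ℕ × ℕ)))
  dWords : List (List (List (ℕ × ℕ)))

/-- The word with the bits `key`. -/
def ofSingle (key tag : List (ℕ × ℕ)) : TaggedCochain :=
  ⟨key, tag, [toWord key], (splices key).map toWord⟩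

/-- The cochain with the given words. -/
def TaggedCochain.elt (y : TaggedCochain) : SCobar 4 := ofWords 4 y.words


/-- A representative of the bracket `ζ_1^16 | ζ_1^2 | b_{20}`. -/
def tagged14 : TaggedCochain where
  key := [(0, 1), (0, 4), (1, 0), (1, 0)]
  tag := [(0, 1), (0, 1), (0, 1), (0, 1), (0, 4)]
  words := [[[(0, 4)], [(0, 1)], [(1, 0)], [(1, 0)]],
    [[(0, 4)], [(0, 1)], [(0, 0), (1, 0)], [(0, 1)]],
    [[(0, 4)], [(0, 1)], [(0, 0)], [(0, 1), (1, 0)]]]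
  dWords := [[[(0, 4)], [(0, 1)], [(0, 0)], [(0, 0)], [(0, 2)]],
    [[(0, 4)], [(0, 1)], [(0, 1)], [(0, 1)], [(0, 1)]]]

/-- A cochain with the leading term `ζ_1^8 | ζ_1^2 | ζ_3 | ζ_3`. -/
def tagged13 : TaggedCochain where
  key := [(0, 1), (0, 3), (2, 0), (2, 0)]
  tag := [(0, 1), (0, 3), (0, 3), (1, 0), (1, 0)]
  words := [[[(0, 3)], [(0, 1)], [(2, 0)], [(2, 0)]],
    [[(0, 3)], [(0, 1)], [(0, 0), (2, 0)], [(1, 1)]],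
    [[(0, 3)], [(0, 1)], [(0, 0)], [(1, 1), (2, 0)]],
    [[(0, 3)], [(0, 1)], [(1, 0), (2, 0)], [(0, 2)]],
    [[(0, 3)], [(0, 1)], [(1, 0)], [(0, 2), (2, 0)]],
    [[(0, 3)], [(0, 1)], [(0, 0), (1, 0)], [(0, 2), (1, 1)]]]
  dWords := [[[(0, 3)], [(0, 1)], [(1, 0)], [(1, 0)], [(0, 3)]],
    [[(0, 3)], [(0, 1)], [(0, 1)], [(1, 1)], [(1, 1)]],
    [[(0, 3)], [(0, 1)], [(0, 1)], [(0, 1), (1, 1)], [(0, 2)]],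
    [[(0, 3)], [(0, 1)], [(0, 0), (1, 0)], [(0, 1)], [(0, 3)]],
    [[(0, 3)], [(0, 1)], [(0, 0)], [(0, 1), (1, 0)], [(0, 3)]],
    [[(0, 3)], [(0, 1)], [(0, 1)], [(0, 1)], [(0, 2), (1, 1)]],
    [[(0, 3)], [(0, 1)], [(0, 0)], [(0, 0)], [(1, 2)]],
    [[(0, 3)], [(0, 1)], [(1, 1)], [(0, 2)], [(0, 2)]]]

/-- Cochains whose differentials are linearly independent. -/
def tagged : List TaggedCochain :=
  [ofSingle [(0, 0), (0, 0), (0, 4), (1, 1)]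
      [(0, 0), (0, 0), (0, 1), (0, 2), (0, 4)],
    ofSingle [(0, 1), (0, 1), (0, 3), (1, 2)]
      [(0, 1), (0, 1), (0, 2), (0, 3), (0, 3)],
    ofSingle [(0, 2), (0, 2), (0, 2), (1, 2)]
      [(0, 2), (0, 2), (0, 2), (0, 2), (0, 3)],
    tagged14,
    ofSingle [(0, 0), (0, 0), (0, 3), (2, 1)]
      [(0, 0), (0, 0), (0, 1), (0, 3), (1, 2)],
    ofSingle [(0, 0), (0, 3), (0, 3), (2, 0)]
      [(0, 0), (0, 2), (0, 3), (0, 3), (1, 0)],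
    ofSingle [(0, 1), (0, 2), (0, 2), (2, 1)]
      [(0, 1), (0, 1), (0, 2), (0, 2), (1, 2)],
    ofSingle [(0, 0), (0, 2), (0, 2), (3, 0)]
      [(0, 0), (0, 0), (0, 2), (0, 2), (2, 1)],
    ofSingle [(0, 0), (0, 2), (1, 2), (2, 0)]
      [(0, 0), (0, 0), (0, 2), (1, 1), (1, 2)],
    ofSingle [(0, 1), (0, 1), (1, 1), (2, 1)]
      [(0, 1), (0, 1), (0, 1), (0, 2), (2, 1)],
    tagged13,
    ofSingle [(0, 1), (1, 0), (1, 2), (2, 0)]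
      [(0, 1), (0, 2), (0, 3), (1, 0), (2, 0)],
    ofSingle [(0, 1), (0, 2), (1, 0), (3, 0)]
      [(0, 0), (0, 1), (0, 1), (0, 2), (3, 0)],
    ofSingle [(0, 0), (0, 1), (2, 0), (2, 1)]
      [(0, 0), (0, 1), (0, 3), (1, 1), (2, 0)],
    ofSingle [(0, 0), (1, 0), (1, 1), (2, 1)]
      [(0, 0), (0, 3), (1, 0), (1, 1), (1, 1)],
    ofSingle [(0, 3), (1, 0), (1, 1), (2, 0)]
      [(0, 2), (0, 3), (1, 0), (1, 0), (1, 1)],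
    ofSingle [(0, 0), (0, 0), (2, 0), (3, 0)]
      [(0, 0), (0, 0), (0, 0), (1, 1), (3, 0)],
    ofSingle [(0, 2), (1, 1), (2, 0), (2, 0)]
      [(0, 1), (0, 2), (0, 2), (2, 0), (2, 0)],
    ofSingle [(1, 0), (1, 0), (1, 0), (3, 0)]
      [(0, 0), (0, 1), (1, 0), (1, 0), (3, 0)],
    ofSingle [(1, 0), (2, 0), (2, 0), (2, 0)]
      [(0, 0), (0, 1), (2, 0), (2, 0), (2, 0)]]


/-- Words of three bits, each with a leading term of its differential. -/
def bounding : List (List (ℕ × ℕ) × List (ℕ × ℕ)) :=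
  [([(0, 1), (0, 4), (1, 1)], [(0, 1), (0, 1), (0, 2), (0, 4)]),
    ([(0, 2), (0, 3), (1, 2)], [(0, 2), (0, 2), (0, 3), (0, 3)]),
    ([(0, 0), (0, 4), (2, 0)], [(0, 0), (0, 2), (0, 4), (1, 0)]),
    ([(0, 1), (0, 3), (2, 1)], [(0, 1), (0, 3), (0, 3), (1, 1)]),
    ([(0, 0), (0, 3), (3, 0)], [(0, 0), (0, 3), (1, 0), (1, 2)]),
    ([(0, 2), (1, 1), (2, 1)], [(0, 1), (0, 2), (1, 1), (1, 2)]),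
    ([(1, 1), (1, 1), (1, 2)], [(0, 2), (0, 3), (1, 1), (1, 1)]),
    ([(1, 0), (1, 1), (3, 0)], [(1, 0), (1, 0), (1, 1), (1, 2)]),
    ([(0, 1), (2, 0), (3, 0)], [(0, 0), (0, 1), (1, 1), (3, 0)]),
    ([(1, 0), (2, 0), (2, 1)], [(0, 2), (1, 0), (1, 0), (2, 1)])]

/-! ### Finite checks on lists of bits -/

/-- The multiplicity, mod 2, of a word of single bits up to permutation. -/
def parity (P : List (List (List (ℕ × ℕ)))) (b : List (ℕ × ℕ)) : ZMod 2 :=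
  (P.map fun w => if w.Perm (toWord b) then (1 : ZMod 2) else 0).sum

theorem symCoeff_ofWords_eq {s : ℕ} {b : List (ℕ × ℕ)} {P : List (List (List (ℕ × ℕ)))}
    (hb : b.length = s) (hP : ∀ w ∈ P, IsProper s w) :
    symCoeff (bitWord s b) (ofWords s P) = parity P b := symCoeff_ofWords hb hP

theorem wordWt_bitWord {s : ℕ} {b : List (ℕ × ℕ)} (hb : b.length = s) :
    wordWt (singles (bitWord s b)) = listWt (toWord b) := by
  rw [← blockWord_singletons s hb]
  refine wordWt_blockWord ⟨by simpa using hb, fun A hA => ?_⟩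
  obtain ⟨x, -, rfl⟩ := List.mem_map.1 hA
  simp

-- The weight of the tag bounds that of all terms of the differential and is smaller than the weight
-- of the key. In terms of the weight filtration, the key survives the first differential and is
-- sent to the tag by a later one.
set_option maxRecDepth 100000 in
theorem tagged_spec : ∀ y ∈ tagged, y.key.length = 4 ∧ y.tag.length = 5 ∧
    listWt (toWord y.tag) < listWt (toWord y.key) ∧
    (∀ w ∈ y.words, IsProper 4 w ∧ listDeg w = 24 ∧ listWt w < listWt (toWord y.key) + 1) ∧
    (∀ w ∈ y.dWords, IsProper 5 w ∧ listWt w < listWt (toWord y.tag) + 1) := by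
  decide +kernel

/-- In the chosen order a tag does not occur, up to permutation and mod 2, in the differential of an
earlier cochain, and the weights of the tags do not decrease. So the differentials are triangular
with respect to the tags. -/
theorem tagged_pairwise : tagged.Pairwise fun i k =>
    parity i.dWords k.tag = 0 ∧ listWt (toWord i.tag) ≤ listWt (toWord k.tag) := by
  decide +kernel

theorem tagged_diagonal : ∀ y ∈ tagged, parity y.dWords y.tag = 1 := by
  decide +kernel

/-- The leading terms of the `tagged` cochains and of the differentials of the `bounding` ones. -/
def leading : List (List (ℕ × ℕ) × List (List (List (ℕ × ℕ)))) :=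
  (bounding.map fun p => (p.2, (splices p.1).map toWord)) ++ tagged.map fun y => (y.key, y.words)

/-- Here the triangularity goes the other way: the leading term of an earlier entry does not occur
in a later one. This is what `exists_mem_span_of_triangular` needs. -/
theorem leading_pairwise : leading.Pairwise fun i k => parity k.2 i.1 = 0 := by
  decide +kernel

theorem leading_diagonal : ∀ p ∈ leading, parity p.2 p.1 = 1 := by
  decide +kernel

/-- The last condition ensures that subtracting these cochains does not affect `squareCoeff`. -/
theorem leading_spec : ∀ p ∈ leading, p.1.length = 4 ∧
    (∀ w ∈ p.2, IsProper 4 w ∧ listDeg w = 24 ∧ listWt w < listWt (toWord p.1) + 1) ∧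
    parity p.2 [(1, 1), (1, 1), (1, 1), (1, 1)] = 0 := by
  decide +kernel

/-- The bits of degree at most 21. -/
def smallBits : List (ℕ × ℕ) :=
  [(0, 0), (0, 1), (0, 2), (0, 3), (0, 4), (1, 0), (1, 1), (1, 2), (2, 0), (2, 1), (3, 0)]

/-- Apart from ζ_2² taken four times, every candidate for a class of degree 24 in the cohomology of
the associated graded complex is accounted for. -/
theorem leading_complete : ∀ a ∈ smallBits, ∀ b ∈ smallBits, ∀ c ∈ smallBits, ∀ d ∈ smallBits,
    listDeg (toWord [a, b, c, d]) = 24 →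
      [a, b, c, d] = [(1, 1), (1, 1), (1, 1), (1, 1)] ∨ ∃ p ∈ leading, [a, b, c, d].Perm p.1 := by
  decide +kernel

theorem mem_leading {p : List (ℕ × ℕ) × List (List (List (ℕ × ℕ)))} :
    p ∈ leading ↔ (∃ q ∈ bounding, (q.2, (splices q.1).map toWord) = p) ∨
      ∃ y ∈ tagged, (y.key, y.words) = p := by
  rw [leading, List.mem_append, List.mem_map, List.mem_map]

attribute [irreducible] tagged leading

theorem toLex_fst (n j : ℕ) : (toLex (n, j) : Bit).1 = n := rfl

theorem toLex_snd (n j : ℕ) : (toLex (n, j) : Bit).2 = j := rfl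

/-- The first two factors are primitive, and the bracket is the usual cochain with leading term
ζ_2|ζ_2, whose coboundary is ζ_1|ζ_1|ζ_1^4 + ζ_1²|ζ_1²|ζ_1². The single word with the same key would
not be enough: its differential has terms of higher weight than the tag. -/
theorem sCobarD_tagged14 :
    sCobarD 4 (ofWords 4 tagged14.words) = ofWords 5 tagged14.dWords := by
  have h2 : (2 : SCobar 5) = 0 := CharTwo.two_eq_zero
  have e16 : ∀ a b : SCobar 5, (a + b) ^ 16 = a ^ 16 + b ^ 16 :=
    fun a b => add_pow_char_pow (p := 2) (n := 4) a b
  have e2 : ∀ a b : SCobar 5, (a + b) ^ 2 = a ^ 2 + b ^ 2 :=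
    fun a b => add_pow_char_pow (p := 2) (n := 1) a b
  have h : ofWords 4 tagged14.words = X (0, 0) ^ 16 * X (1, 0) ^ 2 * (X (2, 1) * X (3, 1) +
      X (2, 0) * X (3, 0) ^ 2 * X (3, 1) + X (2, 0) * X (2, 1) * X (3, 0) ^ 2) := by
    simp [ofWords, tagged14, mon, blockWord, blk, Fin.prod_univ_succ, toLex_fst, toLex_snd]
    ring
  have h' : ofWords 5 tagged14.dWords = X (0, 0) ^ 16 * X (1, 0) ^ 2 *
      (X (2, 0) * X (3, 0) * X (4, 0) ^ 4 + X (2, 0) ^ 2 * X (3, 0) ^ 2 * X (4, 0) ^ 2) := by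
    simp [ofWords, tagged14, mon, blockWord, blk, Fin.prod_univ_succ, toLex_fst, toLex_snd]
    ring
  rw [h, h', sCobarD_apply]
  simp only [Fin.sum_univ_succ, map_mul, map_add, map_pow, sCoface, aeval_X]
  simp [zeta, Finset.Nat.antidiagonal_succ]
  simp only [e16, e2]
  ring_nf
  simp only [h2, mul_zero, add_zero, zero_add]

theorem sCobarD_tagged13 :
    sCobarD 4 (ofWords 4 tagged13.words) = ofWords 5 tagged13.dWords := by
  have h2 : (2 : SCobar 5) = 0 := CharTwo.two_eq_zero
  have e8 : ∀ a b : SCobar 5, (a + b) ^ 8 = a ^ 8 + b ^ 8 :=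
    fun a b => add_pow_char_pow (p := 2) (n := 3) a b
  have e4 : ∀ a b : SCobar 5, (a + b) ^ 4 = a ^ 4 + b ^ 4 :=
    fun a b => add_pow_char_pow (p := 2) (n := 2) a b
  have e2 : ∀ a b : SCobar 5, (a + b) ^ 2 = a ^ 2 + b ^ 2 :=
    fun a b => add_pow_char_pow (p := 2) (n := 1) a b
  have h : ofWords 4 tagged13.words = X (0, 0) ^ 8 * X (1, 0) ^ 2 * (X (2, 2) * X (3, 2) +
      X (2, 0) * X (2, 2) * X (3, 1) ^ 2 + X (2, 0) * (X (3, 1) ^ 2 * X (3, 2)) +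
      X (2, 1) * X (2, 2) * X (3, 0) ^ 4 + X (2, 1) * (X (3, 0) ^ 4 * X (3, 2)) +
      X (2, 0) * X (2, 1) * (X (3, 0) ^ 4 * X (3, 1) ^ 2)) := by
    simp [ofWords, tagged13, mon, blockWord, blk, Fin.prod_univ_succ, toLex_fst, toLex_snd]
    ring
  have h' : ofWords 5 tagged13.dWords = X (0, 0) ^ 8 * X (1, 0) ^ 2 *
      (X (2, 1) * X (3, 1) * X (4, 0) ^ 8 + X (2, 0) ^ 2 * X (3, 1) ^ 2 * X (4, 1) ^ 2 +
      X (2, 0) ^ 2 * (X (3, 0) ^ 2 * X (3, 1) ^ 2) * X (4, 0) ^ 4 +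
      X (2, 0) * X (2, 1) * X (3, 0) ^ 2 * X (4, 0) ^ 8 +
      X (2, 0) * (X (3, 0) ^ 2 * X (3, 1)) * X (4, 0) ^ 8 +
      X (2, 0) ^ 2 * X (3, 0) ^ 2 * (X (4, 0) ^ 4 * X (4, 1) ^ 2) +
      X (2, 0) * X (3, 0) * X (4, 1) ^ 4 + X (2, 1) ^ 2 * X (3, 0) ^ 4 * X (4, 0) ^ 4) := by
    simp [ofWords, tagged13, mon, blockWord, blk, Fin.prod_univ_succ, toLex_fst, toLex_snd]
    ring
  rw [h, h', sCobarD_apply]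
  simp only [Fin.sum_univ_succ, map_mul, map_add, map_pow, sCoface, aeval_X]
  simp [zeta, Finset.Nat.antidiagonal_succ]
  simp only [e8, e4, e2]
  ring_nf
  simp only [h2, mul_zero, add_zero, zero_add]

theorem sCobarD_tagged : ∀ y ∈ tagged, sCobarD 4 y.elt = ofWords 5 y.dWords := by
  have h : ∀ key tag, key.length = 4 →
      sCobarD 4 (ofSingle key tag).elt = ofWords 5 (ofSingle key tag).dWords :=
    fun key tag hl => sCobarD_ofWords_toWord hl
  simp only [tagged, List.forall_mem_cons]
  refine ⟨h _ _ rfl, h _ _ rfl, h _ _ rfl, sCobarD_tagged14, h _ _ rfl, h _ _ rfl, h _ _ rfl,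
    h _ _ rfl, h _ _ rfl, h _ _ rfl, sCobarD_tagged13, h _ _ rfl, h _ _ rfl, h _ _ rfl, h _ _ rfl,
    h _ _ rfl, h _ _ rfl, h _ _ rfl, h _ _ rfl, h _ _ rfl, by simp⟩

theorem sCobarD_bounding {p : List (ℕ × ℕ) × List (ℕ × ℕ)} (hp : p ∈ bounding) :
    ofWords 4 ((splices p.1).map toWord) ∈ (sCobarD 3).range := by
  have : ∀ p ∈ bounding, p.1.length = 3 := by decide
  exact ⟨_, sCobarD_ofWords_toWord (this p hp)⟩

/-! ### Triangular systems of functionals -/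

section Triangular

variable {ι V : Type} [AddCommGroup V] [Module (ZMod 2) V]

/-- Solve for the initial segment first; correcting by the last vector does not disturb the earlier
functionals. -/
theorem exists_mem_span_of_triangular (l : List ι) (e : ι → V) (g : ι → V →ₗ[ZMod 2] ZMod 2)
    (h : l.Pairwise fun i k => g i (e k) = 0) (h1 : ∀ i ∈ l, g i (e i) = 1) (z : V) :
    ∃ x ∈ Submodule.span (ZMod 2) (e '' {i | i ∈ l}), ∀ i ∈ l, g i (z - x) = 0 := by
  induction l using List.reverseRecOn with
  | nil => exact ⟨0, zero_mem _, by simp⟩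
  | append_singleton l k ih =>
    rw [List.pairwise_append] at h
    obtain ⟨x, hx, hx'⟩ := ih h.1 fun i hi => h1 i (by simp [hi])
    refine ⟨x + g k (z - x) • e k, add_mem (Submodule.span_mono ?_ hx)
      (Submodule.smul_mem _ _ (Submodule.subset_span ⟨k, by simp, rfl⟩)), fun i hi => ?_⟩
    · exact Set.image_mono fun i hi => List.mem_append_left _ hi
    · rw [← sub_sub, map_sub, map_smul, smul_eq_mul]
      rcases List.mem_append.1 hi with hi | hi
      · rw [hx' i hi, h.2.2 i hi k (by simp), mul_zero, sub_zero]
      · rw [List.mem_singleton.1 hi, h1 k (by simp), mul_one, sub_self]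

/-- The last functional sees only the last vector, so its vanishing removes that vector. The
condition p is inherited by later entries, so once it fails at the end of the list it fails
throughout. -/
theorem mem_span_of_triangular (l : List ι) (e : ι → V) (g : ι → V →ₗ[ZMod 2] ZMod 2)
    (p : ι → Prop) (h : l.Pairwise fun i k => g k (e i) = 0 ∧ (p i → p k))
    (h1 : ∀ i ∈ l, g i (e i) = 1) {x : V}
    (hx : x ∈ Submodule.span (ZMod 2) (e '' {i | i ∈ l}))
    (hp : ∀ i ∈ l, p i → g i x = 0) :
    x ∈ Submodule.span (ZMod 2) (e '' {i | i ∈ l ∧ ¬ p i}) := by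
  induction l using List.reverseRecOn generalizing x with
  | nil => simpa using hx
  | append_singleton l k ih =>
    rw [List.pairwise_append] at h
    by_cases hk : p k
    · have hset : {i | i ∈ l ++ [k]} = insert k {i | i ∈ l} := by
        ext i
        simp [or_comm]
      rw [hset, Set.image_insert_eq, Submodule.mem_span_insert] at hx
      obtain ⟨c, x', hx', rfl⟩ := hx
      have h2 : g k x' = 0 := by
        have : Submodule.span (ZMod 2) (e '' {i | i ∈ l}) ≤ LinearMap.ker (g k) := by
          refine Submodule.span_le.2 ?_
          rintro _ ⟨i, hi, rfl⟩
          exact (h.2.2 i hi k (by simp)).1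
        exact this hx'
      have h3 := hp k (by simp) hk
      rw [map_add, map_smul, h1 k (by simp), h2, smul_eq_mul, mul_one, add_zero] at h3
      rw [h3, zero_smul, zero_add]
      rw [h3] at hp
      refine Submodule.span_mono ?_ (ih h.1 (fun i hi => h1 i (by simp [hi])) hx' fun i hi hpi => ?_)
      · exact Set.image_mono fun i hi => ⟨List.mem_append_left _ hi.1, hi.2⟩
      · simpa using hp i (by simp [hi]) hpi
    · refine Submodule.span_mono (Set.image_mono fun i hi => ?_) hx
      refine ⟨hi, fun hpi => ?_⟩
      rcases List.mem_append.1 hi with h4 | h4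
      · exact hk ((h.2.2 i h4 k (by simp)).2 hpi)
      · rw [List.mem_singleton.1 h4] at hpi
        exact hk hpi

end Triangular

/-! ### Cocycles of degree 24 -/

/-- The coefficient of `ζ_2² | ζ_2² | ζ_2² | ζ_2²`. -/
def squareCoeff : SCobar 4 →ₗ[ZMod 2] ZMod 2 :=
  symCoeffₗ (bitWord 4 [(1, 1), (1, 1), (1, 1), (1, 1)])

theorem squareCoeff_apply (z : SCobar 4) :
    squareCoeff z = symCoeff (bitWord 4 [(1, 1), (1, 1), (1, 1), (1, 1)]) z := rfl

/-- The differential as a linear map. -/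
def sCobarDₗ (s : ℕ) : SCobar s →ₗ[ZMod 2] SCobar (s + 1) := (sCobarD s).toZModLinearMap 2

theorem sCobarDₗ_apply (s : ℕ) (z : SCobar s) : sCobarDₗ s z = sCobarD s z := rfl

theorem symCoeff_zero {s : ℕ} (b : Fin s → Bit) : symCoeff b 0 = 0 := (symCoeffₗ b).map_zero

/-- The functional `x ↦ symCoeff b (d x)`. -/
def symCoeffD {s : ℕ} (b : Fin (s + 1) → Bit) : SCobar s →ₗ[ZMod 2] ZMod 2 :=
  (symCoeffₗ b).comp (sCobarDₗ s)

theorem symCoeffD_apply {s : ℕ} (b : Fin (s + 1) → Bit) (x : SCobar s) :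
    symCoeffD b x = symCoeff b (sCobarD s x) := rfl

theorem symCoeffₗ_apply {s : ℕ} (b : Fin s → Bit) (x : SCobar s) :
    symCoeffₗ b x = symCoeff b x := rfl

/-- The span of the `tagged` cochains. -/
abbrev taggedSpan : Submodule (ZMod 2) (SCobar 4) :=
  Submodule.span (ZMod 2) (TaggedCochain.elt '' {y | y ∈ tagged})

theorem symCoeff_tagged {y y' : TaggedCochain} (hy : y ∈ tagged) (hy' : y' ∈ tagged) :
    symCoeff (bitWord 5 y'.tag) (sCobarD 4 y.elt) = parity y.dWords y'.tag := by
  rw [sCobarD_tagged y hy]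
  exact symCoeff_ofWords_eq (tagged_spec y' hy').2.1 fun w hw =>
    ((tagged_spec y hy).2.2.2.2 w hw).1

/-- A combination of tagged cochains is controlled by the symmetric sums of its differential at the
tags: where these vanish, the corresponding cochains do not occur. The condition p is meant to say
that the tag is heavy enough. -/
theorem mem_span_of_tags (p : TaggedCochain → Prop)
    (hmono : ∀ y y' : TaggedCochain, listWt (toWord y.tag) ≤ listWt (toWord y'.tag) → p y → p y')
    {x : SCobar 4} (hx : x ∈ taggedSpan)
    (hp : ∀ y ∈ tagged, p y → symCoeff (bitWord 5 y.tag) (sCobarD 4 x) = 0) :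
    x ∈ Submodule.span (ZMod 2) (TaggedCochain.elt '' {y | y ∈ tagged ∧ ¬ p y}) := by
  refine mem_span_of_triangular tagged TaggedCochain.elt
    (fun y => symCoeffD (s := 4) (bitWord 5 y.tag)) p ?_ (fun y hy => ?_) hx fun y hy h =>
      (symCoeffD_apply (s := 4) _ _).trans (hp y hy h)
  · refine tagged_pairwise.imp_of_mem fun {y y'} hy hy' h => ?_
    exact ⟨((symCoeffD_apply (s := 4) _ _).trans (symCoeff_tagged hy hy')).trans h.1, hmono _ _ h.2⟩
  · exact ((symCoeffD_apply (s := 4) _ _).trans (symCoeff_tagged hy hy)).trans (tagged_diagonal y hy)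

theorem eq_zero_of_sCobarD_eq_zero {x : SCobar 4} (hx : x ∈ taggedSpan)
    (h : sCobarD 4 x = 0) : x = 0 := by
  have := mem_span_of_tags (fun _ => True) (fun _ _ _ h => h) hx fun y _ _ => by
    rw [h, symCoeff_zero]
  simpa using this

theorem sCobarD_mem_wtLt_of_tagged {N : ℕ} {x : SCobar 4}
    (hx : x ∈ Submodule.span (ZMod 2)
      (TaggedCochain.elt '' {y | y ∈ tagged ∧ ¬ N ≤ listWt (toWord y.tag)})) :
    sCobarD 4 x ∈ wtLt 5 N := by
  have : Submodule.span (ZMod 2) (TaggedCochain.elt '' {y | y ∈ tagged ∧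
      ¬ N ≤ listWt (toWord y.tag)}) ≤ (wtLt 5 N).comap (sCobarDₗ 4) := by
    refine Submodule.span_le.2 ?_
    rintro _ ⟨y, ⟨hy, hN⟩, rfl⟩
    rw [SetLike.mem_coe, Submodule.mem_comap, sCobarDₗ_apply, sCobarD_tagged y hy]
    refine ofWords_mem_wtLt fun w hw => ?_
    have := (tagged_spec y hy).2.2.2.2 w hw
    exact ⟨this.1, by omega⟩
  exact this hx

/-- Either kind of leading cochain is a tagged one up to a coboundary, and its differential is
lighter than its leading term. -/
theorem leading_mem {p : List (ℕ × ℕ) × List (List (List (ℕ × ℕ)))} (hp : p ∈ leading) :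
    (∃ x ∈ taggedSpan, ∃ U, ofWords 4 p.2 = x + sCobarD 3 U) ∧
      sCobarD 4 (ofWords 4 p.2) ∈ wtLt 5 (listWt (toWord p.1)) := by
  rcases mem_leading.1 hp with ⟨q, hq, rfl⟩ | ⟨y, hy, rfl⟩
  · obtain ⟨U, hU⟩ := sCobarD_bounding hq
    refine ⟨⟨0, zero_mem _, U, by rw [hU, zero_add]⟩, ?_⟩
    rw [← hU, sCobarD_sCobarD]
    exact zero_mem _
  · refine ⟨⟨y.elt, Submodule.subset_span ⟨y, hy, rfl⟩, 0, by rw [map_zero, add_zero]; rfl⟩, ?_⟩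
    refine sCobarD_mem_wtLt_of_tagged (Submodule.subset_span ⟨y, ⟨hy, ?_⟩, rfl⟩)
    have := (tagged_spec y hy).2.2.1
    simpa using this

theorem symCoeff_leading {p q : List (ℕ × ℕ) × List (List (List (ℕ × ℕ)))} (hp : p ∈ leading)
    (hq : q ∈ leading) : symCoeff (bitWord 4 q.1) (ofWords 4 p.2) = parity p.2 q.1 :=
  symCoeff_ofWords_eq (leading_spec q hq).1 fun w hw => ((leading_spec p hp).2.1 w hw).1

theorem listWt_toWord (l : List (ℕ × ℕ)) : listWt (toWord l) = (l.map fun x => 2 * x.1 + 1).sum := by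
  simp [listWt, toWord, Function.comp_def]

theorem listDeg_toWord (l : List (ℕ × ℕ)) :
    listDeg (toWord l) = (l.map fun x => 2 ^ x.2 * (2 ^ (x.1 + 1) - 1)).sum := by
  simp [listDeg, toWord, Function.comp_def]

theorem mem_smallBits {x : ℕ × ℕ} (h : 2 ^ x.2 * (2 ^ (x.1 + 1) - 1) ≤ 21) : x ∈ smallBits := by
  obtain ⟨n, j⟩ := x
  simp only at h
  have h1 : 1 ≤ 2 ^ j := Nat.one_le_two_pow
  have h2 : 2 ≤ 2 ^ (n + 1) := by
    rw [pow_succ]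
    have : 1 ≤ 2 ^ n := Nat.one_le_two_pow
    omega
  have hn : n < 4 := by
    by_contra hn
    have h3 : 2 ^ 5 ≤ 2 ^ (n + 1) := Nat.pow_le_pow_right (by norm_num) (by omega)
    have h4 : 1 * 31 ≤ 2 ^ j * (2 ^ (n + 1) - 1) := Nat.mul_le_mul h1 (by omega)
    omega
  have hj : j < 5 := by
    by_contra hj
    have h3 : 2 ^ 5 ≤ 2 ^ j := Nat.pow_le_pow_right (by norm_num) (by omega)
    have h4 : 32 * 1 ≤ 2 ^ j * (2 ^ (n + 1) - 1) := Nat.mul_le_mul h3 (by omega)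
    omega
  clear h1 h2
  interval_cases n <;> interval_cases j <;> simp_all [smallBits]

theorem exists_leading_of_deg (b : Fin 4 → Bit) (hb : wordDeg (singles b) = 24) (z : SCobar 4) :
    symCoeff b z = squareCoeff z ∨ ∃ p ∈ leading,
      symCoeff b z = symCoeff (bitWord 4 p.1) z ∧ wordWt (singles b) = listWt (toWord p.1) := by
  have hpos : ∀ x : Bit, 1 ≤ 2 ^ x.2 * (2 ^ (x.1 + 1) - 1) := by
    intro x
    have h1 : 1 ≤ 2 ^ x.2 := Nat.one_le_two_pow
    have h2 : 1 ≤ 2 ^ (x.1 + 1) - 1 := by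
      rw [pow_succ]
      have : 1 ≤ 2 ^ x.1 := Nat.one_le_two_pow
      omega
    exact Nat.mul_le_mul h1 h2
  let l : List (ℕ × ℕ) := [ofLex (b 0), ofLex (b 1), ofLex (b 2), ofLex (b 3)]
  have hbl : b = bitWord 4 l := by
    funext a
    fin_cases a <;> rfl
  have hsum : wordDeg (singles b) = listDeg (toWord l) := by
    rw [listDeg_toWord]
    simp only [wordDeg, singles, Finset.sum_singleton, Fin.sum_univ_four, l, List.map_cons,
      List.map_nil, List.sum_cons, List.sum_nil]
    change _ = 2 ^ (b 0).2 * (2 ^ ((b 0).1 + 1) - 1) + (2 ^ (b 1).2 * (2 ^ ((b 1).1 + 1) - 1) +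
      (2 ^ (b 2).2 * (2 ^ ((b 2).1 + 1) - 1) + (2 ^ (b 3).2 * (2 ^ ((b 3).1 + 1) - 1) + 0)))
    omega
  have hdeg := hsum
  rw [hb] at hdeg
  -- Each bit has degree at least 1, so in total degree 24 none of the four exceeds 21.
  have hb4 := hb
  simp only [wordDeg, singles, Finset.sum_singleton, Fin.sum_univ_four] at hb4
  have h0 := hpos (b 0)
  have h1 := hpos (b 1)
  have h2 := hpos (b 2)
  have h3 := hpos (b 3)
  rcases leading_complete (ofLex (b 0)) (mem_smallBits (x := ofLex (b 0)) (by
      change 2 ^ (b 0).2 * (2 ^ ((b 0).1 + 1) - 1) ≤ 21; omega))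
    (ofLex (b 1)) (mem_smallBits (x := ofLex (b 1)) (by
      change 2 ^ (b 1).2 * (2 ^ ((b 1).1 + 1) - 1) ≤ 21; omega))
    (ofLex (b 2)) (mem_smallBits (x := ofLex (b 2)) (by
      change 2 ^ (b 2).2 * (2 ^ ((b 2).1 + 1) - 1) ≤ 21; omega))
    (ofLex (b 3)) (mem_smallBits (x := ofLex (b 3)) (by
      change 2 ^ (b 3).2 * (2 ^ ((b 3).1 + 1) - 1) ≤ 21; omega)) hdeg.symm with h | ⟨p, hp, h⟩
  · left
    rw [hbl, show l = _ from h, squareCoeff_apply]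
  · right
    have hp4 : p.1.length = 4 := (leading_spec p hp).1
    refine ⟨p, hp, ?_, ?_⟩
    · have h5 : (List.ofFn b).Perm (List.ofFn (bitWord 4 p.1)) := by
        rw [hbl, ofFn_bitWord (show l.length = 4 from rfl), ofFn_bitWord hp4]
        exact h.map _
      obtain ⟨π, hπ⟩ := ofFn_perm_iff.1 h5
      rw [← hπ, symCoeff_comp]
    · rw [hbl, wordWt_bitWord (show l.length = 4 from rfl), listWt_toWord, listWt_toWord]
      exact (h.map _).sum_eq

/-- Induction on the weight. Subtracting tagged cochains destroys the cocycle condition, so the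
induction carries the weaker condition that dz is the differential of some combination x of tagged
cochains. -/
theorem eq_add_sCobarD_of_wtLt (hsq : ∀ U, squareCoeff (sCobarD 3 U) = 0) (N : ℕ) (z : SCobar 4)
    (hn : z ∈ normalized 4) (hD : z ∈ homog 4 24) (hz : z ∈ wtLt 4 N)
    (hφ : squareCoeff z = 0) (x : SCobar 4) (hx : x ∈ taggedSpan)
    (hzx : sCobarD 4 z = sCobarD 4 x) : ∃ x' ∈ taggedSpan, ∃ U, z = x' + sCobarD 3 U := by
  induction N generalizing z x with
  | zero =>
    refine ⟨0, zero_mem _, 0, ?_⟩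
    rw [map_zero, add_zero]
    ext e
    exact hz e (Nat.zero_le _)
  | succ N ih =>
    -- The symmetric sums of dz vanish at all tags of weight at least N, because z itself has weight
    -- at most N. Hence x involves only lighter tags, and dz = dx has weight less than N.
    have hx' : sCobarD 4 x ∈ wtLt 5 N := by
      refine sCobarD_mem_wtLt_of_tagged (mem_span_of_tags (fun y => N ≤ listWt (toWord y.tag))
        (fun y y' h h' => h'.trans h) hx fun y hy hN => ?_)
      rw [← hzx]
      refine symCoeff_sCobarD _ (wtLt_mono ?_ hz)
      rw [wordWt_bitWord (tagged_spec y hy).2.1]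
      omega
    let L := leading.filter fun p => listWt (toWord p.1) = N
    have hL : ∀ {p}, p ∈ L → p ∈ leading ∧ listWt (toWord p.1) = N := fun hp => by
      simpa [L] using hp
    -- The combination c of leading cochains of weight N matches the symmetric sums of z at their
    -- leading terms. As `squareCoeff` is also zero, all symmetric sums of z - c of weight N and
    -- degree 24 vanish.
    obtain ⟨c, hc, hcz⟩ := exists_mem_span_of_triangular L (fun p => ofWords 4 p.2)
      (fun p => symCoeffₗ (bitWord 4 p.1))
      ((leading_pairwise.filter _).imp_of_mem fun {p q} hp hq h => by
        rw [symCoeffₗ_apply, symCoeff_leading (hL hq).1 (hL hp).1, h])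
      (fun p hp => by
        rw [symCoeffₗ_apply, symCoeff_leading (hL hp).1 (hL hp).1, leading_diagonal p (hL hp).1]) z
    have hspan : ∀ S : Submodule (ZMod 2) (SCobar 4), (∀ p ∈ L, ofWords 4 p.2 ∈ S) → c ∈ S := by
      intro S hS
      refine Submodule.span_le.2 ?_ hc
      rintro _ ⟨p, hp, rfl⟩
      exact hS p hp
    have hcn : c ∈ normalized 4 := hspan _ fun p hp => ofWords_mem_normalized fun w hw =>
      ((leading_spec p (hL hp).1).2.1 w hw).1
    have hcD : c ∈ homog 4 24 := hspan _ fun p hp => ofWords_mem_homog fun w hw =>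
      ⟨((leading_spec p (hL hp).1).2.1 w hw).1, ((leading_spec p (hL hp).1).2.1 w hw).2.1⟩
    have hcN : c ∈ wtLt 4 (N + 1) := hspan _ fun p hp => ofWords_mem_wtLt fun w hw =>
      ⟨((leading_spec p (hL hp).1).2.1 w hw).1, by
        rw [← (hL hp).2]; exact ((leading_spec p (hL hp).1).2.1 w hw).2.2⟩
    have hcφ : c ∈ LinearMap.ker squareCoeff :=
      hspan _ fun p hp => by
        rw [LinearMap.mem_ker, squareCoeff_apply]
        refine (symCoeff_ofWords_eq rfl fun w hw => ?_).trans (leading_spec p (hL hp).1).2.2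
        exact ((leading_spec p (hL hp).1).2.1 w hw).1
    have hcd : sCobarD 4 c ∈ wtLt 5 N := hspan ((wtLt 5 N).comap (sCobarDₗ 4)) fun p hp => by
      have := (leading_mem (hL hp).1).2
      rwa [(hL hp).2] at this
    obtain ⟨x₁, hx₁, U₁, hU₁⟩ : ∃ x ∈ taggedSpan, ∃ U, c = x + sCobarD 3 U := by
      have : c ∈ taggedSpan ⊔ LinearMap.range (sCobarDₗ 3) := hspan _ fun p hp => by
        obtain ⟨⟨x, hx, U, h⟩, -⟩ := leading_mem (hL hp).1
        rw [h]
        exact Submodule.add_mem_sup hx ⟨U, rfl⟩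
      obtain ⟨x, hx, y, ⟨U, rfl⟩, h⟩ := Submodule.mem_sup.1 this
      exact ⟨x, hx, U, h.symm⟩
    have hφ' : squareCoeff (z - c) = 0 := by
      rw [map_sub, hφ, zero_sub, neg_eq_zero]
      exact hcφ
    have hcz' : ∀ p ∈ L, symCoeff (bitWord 4 p.1) (z - c) = 0 := fun p hp =>
      (symCoeffₗ_apply _ _).symm.trans (hcz p hp)
    have hsym : ∀ b : Fin 4 → Bit, wordWt (singles b) = N → wordDeg (singles b) = 24 →
        symCoeff b (z - c) = 0 := fun b hbN hbD => by
      rcases exists_leading_of_deg b hbD (z - c) with h | ⟨p, hp, h, hw⟩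
      · rw [h, hφ']
      · rw [h]
        refine hcz' p (List.mem_filter.2 ⟨hp, ?_⟩)
        rw [← hw, hbN]
        exact decide_eq_true rfl
    have hdz : sCobarD 4 (z - c) ∈ wtLt 5 N := by
      rw [map_sub, hzx]
      exact sub_mem hx' hcd
    obtain ⟨U, hUn, hUD, hU⟩ := exists_sub_sCobarD_mem_wtLt (s := 2) (N := N) (D := 24)
      (sub_mem hn hcn) (sub_mem hD hcD) (sub_mem hz hcN) hdz hsym
    obtain ⟨x₂, hx₂, U₂, hU₂⟩ := ih (z - c - sCobarD 3 U)
      (sub_mem (sub_mem hn hcn) (sCobarD_mem_normalized hUn))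
      (sub_mem (sub_mem hD hcD) (sCobarD_mem_homog hUD)) hU
      (by rw [map_sub, hφ', hsq, sub_zero]) (x - x₁) (sub_mem hx hx₁) (by
        rw [map_sub, map_sub, sCobarD_sCobarD, sub_zero, hU₁, map_add, sCobarD_sCobarD, add_zero,
          hzx, map_sub])
    refine ⟨x₁ + x₂, add_mem hx₁ hx₂, U₁ + U + U₂, ?_⟩
    have : z = c + sCobarD 3 U + (z - c - sCobarD 3 U) := by abel
    rw [this, hU₂, hU₁, map_add, map_add]
    abel

theorem exists_mem_wtLt {s : ℕ} (z : SCobar s) : ∃ N, z ∈ wtLt s N := by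
  refine ⟨z.support.sup wt + 1, fun e he => ?_⟩
  by_contra h
  have := Finset.le_sup (f := wt) (mem_support_iff.2 h)
  omega

/-- After normalization the weight induction starts from x = 0 and leaves a combination of tagged
cochains plus a coboundary. The combination is a cocycle, and d is injective on the span of the
tagged cochains. -/
theorem mem_range_sCobarD (hsq : ∀ U, squareCoeff (sCobarD 3 U) = 0) {z : SCobar 4}
    (hD : z ∈ homog 4 24) (hz : sCobarD 4 z = 0) (hφ : squareCoeff z = 0) :
    z ∈ (sCobarD 3).range := by
  obtain ⟨u, huD, hu⟩ := exists_sub_sCobarD_mem_normalized hz hD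
  obtain ⟨N, hN⟩ := exists_mem_wtLt (z - sCobarD 3 u)
  obtain ⟨x, hx, U, hU⟩ := eq_add_sCobarD_of_wtLt hsq N _ hu (sub_mem hD (sCobarD_mem_homog huD)) hN
    (by rw [map_sub, hφ, hsq, sub_zero]) 0 (zero_mem _)
    (by rw [map_sub, hz, sCobarD_sCobarD, sub_zero, map_zero])
  have hx0 : x = 0 := by
    refine eq_zero_of_sCobarD_eq_zero hx ?_
    have := congrArg (sCobarD 4) hU
    rwa [map_sub, hz, sCobarD_sCobarD, sub_zero, map_add, sCobarD_sCobarD, add_zero,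
      eq_comm] at this
  rw [hx0, zero_add, sub_eq_iff_eq_add] at hU
  exact ⟨U + u, by rw [map_add, hU]⟩

/-! ### The coefficient of `ζ_2² | ζ_2² | ζ_2² | ζ_2²` in a coboundary -/

theorem coeff_killCompl {σ τ R : Type} [CommRing R] {f : σ → τ} (hf : f.Injective) (d : σ →₀ ℕ)
    (z : MvPolynomial τ R) : coeff d (killCompl hf z) = coeff (d.mapDomain f) z := by
  classical
  induction z using MvPolynomial.induction_on' with
  | monomial e c =>
    by_cases he : (e.support : Set τ) ⊆ Set.range f
    · have h : (e.comapDomain f hf.injOn).mapDomain f = e :=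
        Finsupp.mapDomain_comapDomain f hf e he
      rw [killCompl_monomial_eq_monomial_comapDomain_of_subset hf c he, coeff_monomial,
        coeff_monomial]
      refine if_congr ⟨fun h' => ?_, fun h' => ?_⟩ rfl rfl
      · rw [← h, h']
      · rw [h', Finsupp.comapDomain_mapDomain f hf]
    · rw [killCompl_monomial_eq_zero_of_not_subset hf c he, coeff_zero, coeff_monomial, if_neg]
      rintro rfl
      refine he fun x hx => ?_
      obtain ⟨a, -, rfl⟩ := Finset.mem_image.1 (Finsupp.mapDomain_support hx)
      exact ⟨a, rfl⟩
  | add p q hp hq => rw [map_add, coeff_add, coeff_add, hp, hq]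

/-- The inclusion of the variables `ζ_2`. -/
def zetaTwo (s : ℕ) (a : Fin s) : Fin s × ℕ := (a, 1)

theorem zetaTwo_injective (s : ℕ) : Function.Injective (zetaTwo s) := fun _ _ h =>
  congrArg Prod.fst h

/-- The ring map that sends all `ζ_n` with `n ≠ 2` to zero. -/
abbrev toZetaTwo (s : ℕ) : SCobar s →ₐ[ZMod 2] MvPolynomial (Fin s) (ZMod 2) :=
  killCompl (zetaTwo_injective s)

/-- The exponent `2` in each variable. -/
def twos (s : ℕ) : Fin s →₀ ℕ := Finsupp.equivFunOnFinite.symm fun _ => 2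

theorem twos_apply {s : ℕ} (a : Fin s) : twos s a = 2 := rfl

/-- The word is constant, so it has a single rearrangement, and its coefficient is not changed by
setting the variables other than ζ_2 to zero. -/
theorem squareCoeff_eq (z : SCobar 4) : squareCoeff z = coeff (twos 4) (toZetaTwo 4 z) := by
  have hb : bitWord 4 [(1, 1), (1, 1), (1, 1), (1, 1)] = fun _ => (toLex (1, 1) : Bit) := by
    funext a
    fin_cases a <;> rfl
  rw [coeff_killCompl, squareCoeff_apply, symCoeff, hb]
  have h1 : (Finset.univ.image fun π : Equiv.Perm (Fin 4) =>
      (fun _ : Fin 4 => (toLex (1, 1) : Bit)) ∘ π) = {fun _ => (toLex (1, 1) : Bit)} := by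
    ext v
    simp [Function.comp_def, eq_comm]
  rw [h1, Finset.sum_singleton]
  congr 1
  ext ⟨a, n⟩
  rw [expo_apply]
  by_cases hn : n = 1
  · subst hn
    rw [show (a, 1) = zetaTwo 4 a from rfl, Finsupp.mapDomain_apply (zetaTwo_injective 4),
      twos_apply]
    simp [singles, Finset.filter_singleton, toLex_fst, toLex_snd]
  · rw [Finsupp.mapDomain_of_notMem_range]
    · simp [singles, Finset.filter_singleton, toLex_fst, Ne.symm hn]
    · rintro ⟨b, hb⟩
      exact hn (congrArg Prod.snd hb).symm

theorem toZetaTwo_zeta {s : ℕ} (a : Fin s) (n : ℕ) : toZetaTwo s (zeta s a n) =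
    if n = 0 then 1 else if n = 2 then X a else 0 := by
  rcases n with - | n
  · simp [zeta]
  · rw [if_neg (Nat.succ_ne_zero n), zeta]
    by_cases hn : n = 1
    · subst hn
      rw [if_pos rfl, show (X (a, 1) : SCobar s) = rename (zetaTwo s) (X a) by
        rw [rename_X]; rfl, killCompl_rename_app]
    · rw [if_neg (by omega)]
      refine (aeval_X _ _).trans (dif_neg ?_)
      rintro ⟨b, hb⟩
      exact hn (congrArg Prod.snd hb).symm

theorem toZetaTwo_sCoface_X {s : ℕ} (k : Fin (s + 2)) (a : Fin s) :
    toZetaTwo (s + 1) (sCoface s k (X (a, 1))) =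
      if (k : ℕ) ≤ a then X a.succ else if (k : ℕ) = a + 1 then X a.castSucc + X a.succ
        else X a.castSucc := by
  rw [sCoface, aeval_X]
  dsimp only
  split_ifs with h1 h2
  · rw [toZetaTwo_zeta, if_neg (by norm_num), if_pos rfl]
  · simp only [map_sum, map_mul, map_pow, toZetaTwo_zeta]
    simp [Finset.Nat.antidiagonal_succ, add_comm]
  · rw [toZetaTwo_zeta, if_neg (by norm_num), if_pos rfl]

/-- Of the coproduct of ζ_m with m ≠ 2 only ζ_2 ⊗ ζ_2^4, for m = 4, survives. The exponent 3 in the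
statement is enough, as it exceeds the exponent 2 that is looked for. -/
theorem toZetaTwo_sCoface_X_of_ne {s : ℕ} (k : Fin (s + 2)) (a : Fin s) {n : ℕ} (hn : n ≠ 1) :
    ∃ b q, toZetaTwo (s + 1) (sCoface s k (X (a, n))) = X b ^ 3 * q := by
  rw [sCoface, aeval_X]
  dsimp only
  split_ifs with h1 h2
  · refine ⟨a.succ, 0, ?_⟩
    rw [toZetaTwo_zeta, if_neg (by omega), if_neg (by omega), mul_zero]
  · suffices h : X a.succ ^ 3 ∣ toZetaTwo (s + 1) (∑ q ∈ antidiagonal (n + 1),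
        zeta (s + 1) a.castSucc q.1 * zeta (s + 1) a.succ q.2 ^ 2 ^ q.1) by
      exact ⟨a.succ, h⟩
    rw [map_sum]
    refine Finset.dvd_sum fun q hq => ?_
    have hq' := mem_antidiagonal.1 hq
    rw [map_mul, map_pow, toZetaTwo_zeta, toZetaTwo_zeta]
    split_ifs with h3 h4 h5 h6 h7 h8 h9
    · omega
    · omega
    · simp
    · omega
    · refine Dvd.dvd.mul_left (pow_dvd_pow _ ?_) _
      rw [h6]
      norm_num
    all_goals simp
  · refine ⟨a.succ, 0, ?_⟩
    rw [toZetaTwo_zeta, if_neg (by omega), if_neg (by omega), mul_zero]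

theorem coeff_twos_X_pow_mul {s : ℕ} (b : Fin s) (q : MvPolynomial (Fin s) (ZMod 2)) :
    coeff (twos s) (X b ^ 3 * q) = 0 := by
  rw [X_pow_eq_monomial, coeff_monomial_mul', if_neg]
  intro h
  have := h b
  rw [Finsupp.single_eq_same, twos_apply] at this
  omega

/-- The exponent 2 in both variables forces p = 4, and the binomial coefficient 6 is even. -/
theorem coeff_twos_add_pow_mul {s : ℕ} {a b : Fin s} (hab : a ≠ b) (p : ℕ) (e : Fin s →₀ ℕ)
    (ha : e a = 0) (hb : e b = 0) (c : ZMod 2) :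
    coeff (twos s) ((X a + X b) ^ p * monomial e c) = 0 := by
  rw [add_pow, Finset.sum_mul, coeff_sum]
  refine Finset.sum_eq_zero fun i hi => ?_
  rw [X_pow_eq_monomial, X_pow_eq_monomial, monomial_mul, mul_right_comm, monomial_mul,
    ← map_natCast (C : ZMod 2 →+* MvPolynomial (Fin s) (ZMod 2)), mul_comm, coeff_C_mul,
    coeff_monomial]
  split_ifs with h
  · have h1 := DFunLike.congr_fun h a
    have h2 := DFunLike.congr_fun h b
    simp only [Finsupp.add_apply, Finsupp.single_eq_same, Finsupp.single_eq_of_ne hab,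
      Finsupp.single_eq_of_ne hab.symm, ha, hb, twos_apply] at h1 h2
    obtain rfl : i = 2 := by omega
    obtain rfl : p = 4 := by omega
    rw [show ((Nat.choose 4 2 : ℕ) : ZMod 2) = 0 by decide, zero_mul]
  · exact mul_zero _

theorem squareCoeff_sCoface_monomial (k : Fin 5) (e : Fin 3 × ℕ →₀ ℕ) (c : ZMod 2) :
    squareCoeff (sCoface 3 k (monomial e c)) = 0 := by
  rw [squareCoeff_eq]
  by_cases he : (e.support : Set (Fin 3 × ℕ)) ⊆ Set.range (zetaTwo 3)
  · have h : (e.comapDomain (zetaTwo 3) (zetaTwo_injective 3).injOn).mapDomain (zetaTwo 3) = e :=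
      Finsupp.mapDomain_comapDomain _ (zetaTwo_injective 3) e he
    have h1 : toZetaTwo 4 (sCoface 3 k (monomial e c)) = C c *
        (toZetaTwo 4 (sCoface 3 k (X (0, 1))) ^ e (0, 1) *
          toZetaTwo 4 (sCoface 3 k (X (1, 1))) ^ e (1, 1) *
          toZetaTwo 4 (sCoface 3 k (X (2, 1))) ^ e (2, 1)) := by
      rw [← h, ← rename_monomial, monomial_eq, Finsupp.prod_fintype _ _ (by simp)]
      simp only [Fin.prod_univ_three, map_mul, map_pow, rename_X, rename_C, h]
      simp [zetaTwo, algHom_C]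
    rw [h1, coeff_C_mul]
    simp only [toZetaTwo_sCoface_X]
    have key : ∀ a b u v : Fin 4, ∀ p q r : ℕ, a ≠ b → u ≠ a → u ≠ b → v ≠ a → v ≠ b →
        coeff (twos 4) ((X a + X b) ^ p * (X u ^ q * X v ^ r) :
          MvPolynomial (Fin 4) (ZMod 2)) = 0 := by
      intro a b u v p q r hab hua hub hva hvb
      rw [X_pow_eq_monomial, X_pow_eq_monomial, monomial_mul]
      refine coeff_twos_add_pow_mul hab _ _ ?_ ?_ _
      · simp [Finsupp.single_eq_of_ne hua.symm, Finsupp.single_eq_of_ne hva.symm]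
      · simp [Finsupp.single_eq_of_ne hub.symm, Finsupp.single_eq_of_ne hvb.symm]
    have key' : ∀ a u v w : Fin 4, ∀ p q r : ℕ, u ≠ a → v ≠ a → w ≠ a →
        coeff (twos 4) (X u ^ p * X v ^ q * X w ^ r : MvPolynomial (Fin 4) (ZMod 2)) = 0 := by
      intro a u v w p q r hu hv hw
      rw [X_pow_eq_monomial, X_pow_eq_monomial, X_pow_eq_monomial, monomial_mul, monomial_mul,
        coeff_monomial, if_neg]
      intro h
      have := DFunLike.congr_fun h a
      simp [Finsupp.single_eq_of_ne hu.symm, Finsupp.single_eq_of_ne hv.symm,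
        Finsupp.single_eq_of_ne hw.symm, twos_apply] at this
    -- The outer cofaces leave one of the four variables unused. An inner one gives a power of X_a +
    -- X_b times powers of the other two variables.
    fin_cases k
    · exact mul_eq_zero_of_right _ (key' 0 1 2 3 _ _ _ (by decide) (by decide) (by decide))
    · refine mul_eq_zero_of_right _ (Eq.trans (congrArg _ ?_)
        (key 0 1 2 3 (e (0, 1)) (e (1, 1)) (e (2, 1)) (by decide) (by decide) (by decide)
          (by decide) (by decide)))
      exact mul_assoc _ _ _
    · refine mul_eq_zero_of_right _ (Eq.trans (congrArg _ ?_)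
        (key 1 2 0 3 (e (1, 1)) (e (0, 1)) (e (2, 1)) (by decide) (by decide) (by decide)
          (by decide) (by decide)))
      exact (mul_assoc _ _ _).trans (mul_left_comm _ _ _)
    · refine mul_eq_zero_of_right _ (Eq.trans (congrArg _ ?_)
        (key 2 3 0 1 (e (2, 1)) (e (0, 1)) (e (1, 1)) (by decide) (by decide) (by decide)
          (by decide) (by decide)))
      exact mul_comm _ _
    · exact mul_eq_zero_of_right _ (key' 3 0 1 2 _ _ _ (by decide) (by decide) (by decide))
  · obtain ⟨⟨a, n⟩, hp, hn⟩ := Set.not_subset.1 he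
    have hn1 : n ≠ 1 := by
      rintro rfl
      exact hn ⟨a, rfl⟩
    obtain ⟨b, q, h⟩ := toZetaTwo_sCoface_X_of_ne k a hn1
    have h1 : (monomial e c : SCobar 3) = X (a, n) * monomial (e - Finsupp.single (a, n) 1) c := by
      rw [X, monomial_mul, one_mul, add_tsub_cancel_of_le]
      exact Finsupp.single_le_iff.2 (Nat.one_le_iff_ne_zero.2 (Finsupp.mem_support_iff.1 hp))
    rw [h1, map_mul, map_mul, h, mul_assoc]
    exact coeff_twos_X_pow_mul _ _

/-- The coefficient vanishes on each coface separately and without a bound on the weight of U, which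
`symCoeff_sCobarD` would require. -/
theorem squareCoeff_sCobarD (U : SCobar 3) : squareCoeff (sCobarD 3 U) = 0 := by
  induction U using MvPolynomial.induction_on' with
  | monomial e c =>
    rw [sCobarD_apply, map_sum]
    exact Finset.sum_eq_zero fun k _ => squareCoeff_sCoface_monomial k e c
  | add p q hp hq => rw [map_add, map_add, hp, hq, add_zero]

/-! ### An integral cochain whose powers lift `h_j³` -/

section Correction

variable {R S : Type} [CommRing R] [CommRing S]

/-- With `x = ζ_1` this is the cochain `ζ_1 | ζ_1 | ζ_1`. -/
def cubeTerm (x : Fin 3 → R) : R := x 0 * x 1 * x 2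

/-- The first correction term, with `x = ζ_1` and `y = ζ_2`. -/
def corrOne (x y : Fin 3 → R) : R :=
  x 0 * y 1 * x 2 ^ 2 + x 0 ^ 2 * x 1 * x 2 ^ 3 + x 0 ^ 2 * x 1 ^ 2 * x 2 ^ 2
  + x 0 ^ 2 * x 1 ^ 3 * x 2

/-- The second correction term, with `x = ζ_1` and `y = ζ_2`. -/
def corrTwo (x y : Fin 3 → R) : R :=
  x 0 * x 1 * x 2 ^ 4 * y 2 ^ 2 + x 0 * y 1 * x 2 ^ 8 + x 0 * x 1 ^ 2 * y 1 * y 2 ^ 2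
  + x 0 * x 1 ^ 4 * y 1 * x 2 ^ 4 + x 0 ^ 2 * x 1 ^ 2 * x 2 ^ 2 * y 2 ^ 2
  + x 0 ^ 2 * x 1 ^ 4 * y 2 ^ 2 + x 0 ^ 2 * x 1 ^ 2 * y 1 ^ 2 * x 2 ^ 2
  + x 0 ^ 3 * x 1 * y 1 * x 2 ^ 5 + x 0 ^ 3 * x 1 ^ 3 * y 1 * x 2 ^ 3 + y 0 * y 1 * y 2 ^ 2
  + y 0 * x 1 ^ 2 * y 1 * x 2 ^ 4 + x 0 ^ 4 * x 1 * x 2 ^ 7 + x 0 ^ 4 * x 1 ^ 6 * x 2 ^ 2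
  + x 0 ^ 4 * x 1 ^ 7 * x 2 + x 0 * y 0 * x 1 ^ 2 * y 2 ^ 2 + x 0 * y 0 * x 1 ^ 4 * x 2 ^ 4
  + x 0 ^ 2 * y 0 * y 1 * x 2 ^ 4 + x 0 ^ 6 * x 1 ^ 4 * x 2 ^ 2
  + x 0 ^ 3 * y 0 * x 1 ^ 2 * x 2 ^ 4

theorem map_cubeTerm (φ : R →+* S) (x : Fin 3 → R) :
    φ (cubeTerm x) = cubeTerm fun a => φ (x a) := by
  simp only [cubeTerm, map_mul]

theorem map_corrOne (φ : R →+* S) (x y : Fin 3 → R) :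
    φ (corrOne x y) = corrOne (fun a => φ (x a)) fun a => φ (y a) := by
  simp only [corrOne, map_add, map_mul, map_pow]

theorem map_corrTwo (φ : R →+* S) (x y : Fin 3 → R) :
    φ (corrTwo x y) = corrTwo (fun a => φ (x a)) fun a => φ (y a) := by
  simp only [corrTwo, map_add, map_mul, map_pow]

/-- `A^{4m} + 2 B^{2m} + 4 C^m`. -/
def powSum (m : ℕ) (A B C : R) : R := A ^ (4 * m) + 2 * B ^ (2 * m) + 4 * C ^ m

theorem map_powSum (φ : R →+* S) (m : ℕ) (A B C : R) :
    φ (powSum m A B C) = powSum m (φ A) (φ B) (φ C) := by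
  simp only [powSum, map_add, map_mul, map_pow, map_ofNat]

/-- A power of `ζ_1 | ζ_1 | ζ_1`, corrected by multiples of `2`. -/
def corrPow (m : ℕ) (x y : Fin 3 → R) : R :=
  powSum m (cubeTerm x) (corrOne x y) (corrTwo x y)

theorem map_corrPow (φ : R →+* S) (m : ℕ) (x y : Fin 3 → R) :
    φ (corrPow m x y) = corrPow m (fun a => φ (x a)) fun a => φ (y a) := by
  rw [corrPow, map_powSum, map_cubeTerm, map_corrOne, map_corrTwo]
  rfl

-- The letters a, b, c, d and u, v, w, z are ζ_1 and ζ_2 in the four factors, and the arguments are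
-- their images under the five cofaces. The term 2B² cancels the alternating sum of A^4 modulo 4,
-- and 4C cancels what is then left modulo 8.
set_option maxRecDepth 10000 in
set_option maxHeartbeats 1000000 in
theorem corrPow_one_cobar (h8 : (8 : R) = 0) (a b c d u v w z : R) :
    corrPow 1 ![b, c, d] ![v, w, z] -
        corrPow 1 ![a + b, c, d] ![u + v + a * b ^ 2, w, z] +
        corrPow 1 ![a, b + c, d] ![u, v + w + b * c ^ 2, z] -
        corrPow 1 ![a, b, c + d] ![u, v, w + z + c * d ^ 2] +
        corrPow 1 ![a, b, c] ![u, v, w] = 0 := by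
  have h (n : ℕ) : ((8 * n : ℕ) : R) = 0 := by
    rw [Nat.cast_mul, Nat.cast_ofNat, h8, zero_mul]
  have h2 : (16 : R) = 0 := by exact_mod_cast h 2
  have h3 : (24 : R) = 0 := by exact_mod_cast h 3
  have h4 : (32 : R) = 0 := by exact_mod_cast h 4
  have h5 : (40 : R) = 0 := by exact_mod_cast h 5
  have h6 : (48 : R) = 0 := by exact_mod_cast h 6
  have h7 : (56 : R) = 0 := by exact_mod_cast h 7
  have h9 : (72 : R) = 0 := by exact_mod_cast h 9
  have h10 : (80 : R) = 0 := by exact_mod_cast h 10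
  have h14 : (112 : R) = 0 := by exact_mod_cast h 14
  have h15 : (120 : R) = 0 := by exact_mod_cast h 15
  have h28 : (224 : R) = 0 := by exact_mod_cast h 28
  have h35 : (280 : R) = 0 := by exact_mod_cast h 35
  simp only [corrPow, powSum, mul_one, pow_one, cubeTerm, corrOne, corrTwo, Matrix.cons_val]
  ring_nf
  simp only [h8, h2, h3, h4, h5, h6, h7, h9, h10, h14, h15, h28, h35, mul_zero, add_zero,
    sub_zero]

end Correction

/-! ### Integral lifts of the cochains of `A` -/

/-- An integral form of the `s`-cochains of the cobar complex of `A`. -/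
abbrev ICobar (s : ℕ) : Type := MvPolynomial (Fin s × ℕ) ℤ

/-- The integral form of `zeta`. -/
def iZeta (s : ℕ) (a : Fin s) : ℕ → ICobar s
  | 0 => 1
  | n + 1 => X (a, n)

/-- The integral form of the coface maps, given by the same formulas. -/
def iCoface (s : ℕ) (i : Fin (s + 2)) : ICobar s →ₐ[ℤ] ICobar (s + 1) :=
  aeval fun p =>
    if (i : ℕ) ≤ p.1 then iZeta (s + 1) p.1.succ (p.2 + 1)
    else if (i : ℕ) = p.1 + 1 then
      ∑ q ∈ antidiagonal (p.2 + 1),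
        iZeta (s + 1) p.1.castSucc q.1 * iZeta (s + 1) p.1.succ q.2 ^ 2 ^ q.1
    else iZeta (s + 1) p.1.castSucc (p.2 + 1)

/-- The reduction modulo 2. -/
def redTwo (s : ℕ) : ICobar s →+* SCobar s := map (Int.castRingHom (ZMod 2))

theorem redTwo_iZeta {s : ℕ} (a : Fin s) (n : ℕ) : redTwo s (iZeta s a n) = zeta s a n := by
  cases n with
  | zero => exact map_one _
  | succ n => exact map_X _ _

theorem redTwo_iCoface {s : ℕ} (i : Fin (s + 2)) (f : ICobar s) :
    redTwo (s + 1) (iCoface s i f) = sCoface s i (redTwo s f) := by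
  suffices h : (redTwo (s + 1)).comp (iCoface s i : ICobar s →+* ICobar (s + 1)) =
      (sCoface s i : SCobar s →+* SCobar (s + 1)).comp (redTwo s) from DFunLike.congr_fun h f
  refine MvPolynomial.ringHom_ext' (Subsingleton.elim _ _) fun p => ?_
  simp only [RingHom.comp_apply, redTwo, map_X, RingHom.coe_coe, iCoface, sCoface, aeval_X]
  change redTwo (s + 1) _ = _
  split_ifs with h1 h2
  · exact redTwo_iZeta _ _
  · simp only [map_sum, map_mul, map_pow, redTwo_iZeta]
  · exact redTwo_iZeta _ _

/-- The map `ζ_n ↦ t_n` to the cobar complex of `BP_*BP`. -/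
def toCobar (s : ℕ) : ICobar s →+* Cobar s :=
  eval₂Hom (Int.castRingHom _) fun p => t ZLoc s p.1 (p.2 + 1)

theorem mk_toCobar {s : ℕ} (f : ICobar s) :
    Ideal.Quotient.mk (augI s) (toCobar s f) = frobeniusName s (redTwo s f) := by
  suffices h : (Ideal.Quotient.mk (augI s)).comp (toCobar s) =
      (frobeniusName s).comp (redTwo s) from DFunLike.congr_fun h f
  refine MvPolynomial.ringHom_ext' (Subsingleton.elim _ _) fun p => ?_
  simp [toCobar, redTwo, frobeniusName]

theorem coface_toCobar_sub_mem {s : ℕ} (i : Fin (s + 2)) (f : ICobar s) :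
    coface s i (toCobar s f) - toCobar (s + 1) (iCoface s i f) ∈ augI (s + 1) := by
  rw [← Ideal.Quotient.eq, quot_coface i (mk_toCobar f), mk_toCobar, redTwo_iCoface]

theorem isWeightedHomogeneous_iZeta {s : ℕ} (a : Fin s) (n : ℕ) :
    IsWeightedHomogeneous (dg s) (iZeta s a n) (2 ^ n - 1) := by
  cases n with
  | zero => exact isWeightedHomogeneous_one _ _
  | succ n => exact isWeightedHomogeneous_X _ _ (a, n)

theorem isWeightedHomogeneous_iCoface {s : ℕ} (i : Fin (s + 2)) {z : ICobar s} {D : ℕ}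
    (hz : IsWeightedHomogeneous (dg s) z D) :
    IsWeightedHomogeneous (dg (s + 1)) (iCoface s i z) D := by
  refine isWeightedHomogeneous_aeval (fun p => ?_) hz
  split_ifs with h1 h2
  · exact isWeightedHomogeneous_iZeta _ _
  · refine IsWeightedHomogeneous.sum _ _ _ fun q hq => ?_
    have := (isWeightedHomogeneous_iZeta (s := s + 1) p.1.castSucc q.1).mul
      ((isWeightedHomogeneous_iZeta (s := s + 1) p.1.succ q.2).pow (2 ^ q.1))
    rwa [smul_eq_mul, degree_coproduct (mem_antidiagonal.1 hq)] at this
  · exact isWeightedHomogeneous_iZeta _ _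

/-! ### Congruences between powers -/

theorem two_dvd_sq_sub_expand {σ : Type} (A : MvPolynomial σ ℤ) : 2 ∣ A ^ 2 - expand 2 A := by
  have h := (C_dvd_iff_zmod 2 (A ^ 2 - expand 2 A)).2 (by
    rw [map_sub, map_pow, map_expand, expand_zmod, sub_self])
  rwa [Nat.cast_ofNat, map_ofNat] at h

/-- The congruence of A² with the substitution of squares holds modulo 2, and every squaring gains a
factor 2. -/
theorem dvd_pow_sub_expand {σ : Type} (A : MvPolynomial σ ℤ) (k : ℕ) :
    2 ^ (k + 1) ∣ A ^ (2 * 2 ^ k) - expand 2 (A ^ 2 ^ k) := by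
  have h := dvd_sub_pow_of_dvd_sub (p := 2) (R := MvPolynomial σ ℤ)
    (by exact_mod_cast two_dvd_sq_sub_expand A) k
  rw [pow_mul, map_pow]
  exact_mod_cast h

/-- The exponents 4m, 2m, m are matched with the coefficients 1, 2, 4, so that all three terms
satisfy the congruence modulo the same power of 2. -/
theorem dvd_powSum_sub_expand {σ : Type} (n : ℕ) (A B D : MvPolynomial σ ℤ) :
    2 ^ (n + 3) ∣ powSum (2 ^ (n + 1)) A B D - expand 2 (powSum (2 ^ n) A B D) := by
  obtain ⟨a, ha⟩ := dvd_pow_sub_expand A (n + 2)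
  obtain ⟨b, hb⟩ := dvd_pow_sub_expand B (n + 1)
  obtain ⟨d, hd⟩ := dvd_pow_sub_expand D n
  refine ⟨a + b + d, ?_⟩
  have e1 : 2 * 2 ^ (n + 2) = 4 * 2 ^ (n + 1) := by ring
  have e2 : 2 ^ (n + 2) = 4 * 2 ^ n := by ring
  have e3 : 2 ^ (n + 1) = 2 * 2 ^ n := by ring
  rw [e1, e2] at ha
  simp only [powSum, map_add, map_mul, map_ofNat] at *
  have e4 : (2 : MvPolynomial σ ℤ) ^ (n + 2 + 1) = 4 * 2 ^ (n + 1) := by ring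
  have e5 : (2 : MvPolynomial σ ℤ) ^ (n + 3) = 4 * 2 ^ (n + 1) := by ring
  have e6 : (2 : MvPolynomial σ ℤ) ^ (n + 1 + 1) = 2 * 2 ^ (n + 1) := by ring
  rw [e4] at ha
  rw [e6] at hb
  rw [e5]
  have hb' : B ^ (2 * 2 ^ (n + 1)) - expand 2 (B ^ (2 * 2 ^ n)) = 2 * 2 ^ (n + 1) * b := by
    rw [← e3]; exact hb
  have hd' : D ^ 2 ^ (n + 1) - expand 2 (D ^ 2 ^ n) = 2 ^ (n + 1) * d := by
    rw [e3]; exact hd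
  linear_combination ha + 2 * hb' + 4 * hd'

/-! ### The differential of the corrected powers of `ζ_1 | ζ_1 | ζ_1` -/

/-- The integral form of the differential of the corrected power. -/
def altPow (m : ℕ) : ICobar 4 :=
  ∑ i : Fin 5, (-1 : ℤ) ^ (i : ℕ) •
    iCoface 3 i (corrPow m (fun a => X (a, 0)) fun a => X (a, 1))

theorem iCoface_zetaOne (i : Fin 5) : (fun a : Fin 3 => iCoface 3 i (X (a, 0))) =
    (![![X (1, 0), X (2, 0), X (3, 0)], ![X (0, 0) + X (1, 0), X (2, 0), X (3, 0)],
      ![X (0, 0), X (1, 0) + X (2, 0), X (3, 0)], ![X (0, 0), X (1, 0), X (2, 0) + X (3, 0)],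
      ![X (0, 0), X (1, 0), X (2, 0)]] : Fin 5 → Fin 3 → ICobar 4) i := by
  funext a
  fin_cases i <;> fin_cases a <;>
    simp [iCoface, iZeta, Finset.Nat.antidiagonal_succ]
  all_goals exact add_comm _ _

theorem iCoface_zetaTwo (i : Fin 5) : (fun a : Fin 3 => iCoface 3 i (X (a, 1))) =
    (![![X (1, 1), X (2, 1), X (3, 1)],
      ![X (0, 1) + X (1, 1) + X (0, 0) * X (1, 0) ^ 2, X (2, 1), X (3, 1)],
      ![X (0, 1), X (1, 1) + X (2, 1) + X (1, 0) * X (2, 0) ^ 2, X (3, 1)],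
      ![X (0, 1), X (1, 1), X (2, 1) + X (3, 1) + X (2, 0) * X (3, 0) ^ 2],
      ![X (0, 1), X (1, 1), X (2, 1)]] : Fin 5 → Fin 3 → ICobar 4) i := by
  funext a
  fin_cases i <;> fin_cases a <;>
    simp [iCoface, iZeta, Finset.Nat.antidiagonal_succ] <;> ring

theorem iCoface_corrPow (i : Fin 5) (m : ℕ) :
    iCoface 3 i (corrPow m (fun a => X (a, 0)) fun a => X (a, 1)) =
      corrPow m (fun a => iCoface 3 i (X (a, 0))) fun a => iCoface 3 i (X (a, 1)) :=
  map_corrPow (iCoface 3 i : ICobar 3 →+* ICobar 4) m _ _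

theorem altPow_eq (m : ℕ) : altPow m =
    corrPow m ![X (1, 0), X (2, 0), X (3, 0)] ![X (1, 1), X (2, 1), X (3, 1)] -
    corrPow m ![X (0, 0) + X (1, 0), X (2, 0), X (3, 0)]
      ![X (0, 1) + X (1, 1) + X (0, 0) * X (1, 0) ^ 2, X (2, 1), X (3, 1)] +
    corrPow m ![X (0, 0), X (1, 0) + X (2, 0), X (3, 0)]
      ![X (0, 1), X (1, 1) + X (2, 1) + X (1, 0) * X (2, 0) ^ 2, X (3, 1)] -
    corrPow m ![X (0, 0), X (1, 0), X (2, 0) + X (3, 0)]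
      ![X (0, 1), X (1, 1), X (2, 1) + X (3, 1) + X (2, 0) * X (3, 0) ^ 2] +
    corrPow m ![X (0, 0), X (1, 0), X (2, 0)] ![X (0, 1), X (1, 1), X (2, 1)] := by
  simp only [altPow, Fin.sum_univ_five, iCoface_corrPow, iCoface_zetaOne, iCoface_zetaTwo]
  simp [sub_eq_add_neg, pow_succ]

theorem eight_dvd_altPow_one : 8 ∣ altPow 1 := by
  have h := (C_dvd_iff_zmod 8 (altPow 1)).2 ?_
  · rwa [Nat.cast_ofNat, map_ofNat] at h
  · rw [altPow_eq]
    have h8 : (8 : MvPolynomial (Fin 4 × ℕ) (ZMod 8)) = 0 := by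
      rw [← map_ofNat (C : ZMod 8 →+* _), show (OfNat.ofNat 8 : ZMod 8) = 0 from rfl, map_zero]
    have hv : ∀ (x y z : ICobar 4) (a : Fin 3), map (Int.castRingHom (ZMod 8)) (![x, y, z] a) =
        ![map (Int.castRingHom (ZMod 8)) x, map (Int.castRingHom (ZMod 8)) y,
          map (Int.castRingHom (ZMod 8)) z] a := by
      intro x y z a
      fin_cases a <;> rfl
    simp only [map_add, map_sub, map_corrPow, hv, map_mul, map_pow, map_X]
    exact corrPow_one_cobar h8 _ _ _ _ _ _ _ _

/-- A coface is a ring map, so each summand is again of the form `powSum` and the previous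
congruence applies to it. No compatibility of the cofaces with the substitution of squares is
needed. -/
theorem dvd_altPow_sub_expand (n : ℕ) :
    2 ^ (n + 3) ∣ altPow (2 ^ (n + 1)) - expand 2 (altPow (2 ^ n)) := by
  rw [altPow, altPow, map_sum, ← Finset.sum_sub_distrib]
  refine Finset.dvd_sum fun i _ => ?_
  rw [map_zsmul, ← smul_sub]
  rw [zsmul_eq_mul]
  refine Dvd.dvd.mul_left ?_ _
  rw [iCoface_corrPow, iCoface_corrPow]
  exact dvd_powSum_sub_expand n _ _ _

/-- The case m = 1 is divisible by 8, and passing to m = 2 is controlled modulo 8. From m = 2 on the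
control is modulo 16, which is why G is defined there. -/
theorem exists_altPow_two : ∃ G : ICobar 4, altPow 2 = 8 * G := by
  obtain ⟨Q, hQ⟩ := eight_dvd_altPow_one
  obtain ⟨q, hq⟩ := dvd_altPow_sub_expand 0
  rw [zero_add, zero_add, pow_one, pow_zero, hQ, map_mul, map_ofNat] at hq
  exact ⟨q + expand 2 Q, by linear_combination hq⟩

/-- In the inductive step the substitution of squares is exact modulo 2^{n+4}, and it agrees modulo
2 with squaring G^{2^n}, which the factor 8 turns into a congruence modulo 16. -/
theorem sixteen_dvd_altPow_sub {G : ICobar 4} (hG : altPow 2 = 8 * G) (n : ℕ) :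
    16 ∣ altPow (2 ^ (n + 1)) - 8 * G ^ 2 ^ n := by
  induction n with
  | zero => simp [hG]
  | succ n ih =>
    obtain ⟨a, ha⟩ := ih
    obtain ⟨b, hb⟩ := dvd_altPow_sub_expand (n + 1)
    obtain ⟨c, hc⟩ := dvd_pow_sub_expand G n
    have ha' := congrArg (expand 2) ha
    rw [map_sub, map_mul, map_mul, map_ofNat, map_ofNat] at ha'
    refine ⟨2 ^ n * b + expand 2 a - 2 ^ n * c, ?_⟩
    rw [show 2 * 2 ^ n = 2 ^ (n + 1) by ring] at hc
    linear_combination hb + ha' - 8 * hc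

/-! ### The cocycle of degree 24 -/

theorem isWeightedHomogeneous_corrPow {σ : Type} {w : σ → ℕ} {x y : Fin 3 → MvPolynomial σ ℤ}
    (hx : ∀ a, IsWeightedHomogeneous w (x a) 1) (hy : ∀ a, IsWeightedHomogeneous w (y a) 3) :
    IsWeightedHomogeneous w (corrPow 2 x y) 24 := by
  have heq : ∀ {p : MvPolynomial σ ℤ} {m n : ℕ}, IsWeightedHomogeneous w p m → m = n →
      IsWeightedHomogeneous w p n := fun h e => e ▸ h
  have h0 : IsWeightedHomogeneous w (cubeTerm x) 3 := ((hx 0).mul (hx 1)).mul (hx 2)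
  have h1 : IsWeightedHomogeneous w (corrOne x y) 6 := by
    unfold corrOne
    repeat' with_reducible refine IsWeightedHomogeneous.add ?_ ?_
    all_goals
      apply heq
      · repeat' first
          | with_reducible exact hx _
          | with_reducible exact hy _
          | with_reducible apply IsWeightedHomogeneous.pow
          | with_reducible apply IsWeightedHomogeneous.mul
      · rfl
  have h2 : IsWeightedHomogeneous w (corrTwo x y) 12 := by
    unfold corrTwo
    repeat' with_reducible refine IsWeightedHomogeneous.add ?_ ?_
    all_goals
      apply heq
      · repeat' first
          | with_reducible exact hx _
          | with_reducible exact hy _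
          | with_reducible apply IsWeightedHomogeneous.pow
          | with_reducible apply IsWeightedHomogeneous.mul
      · rfl
  exact ((h0.pow 8).add ((h1.pow 4).C_mul 2)).add ((h2.pow 2).C_mul 4)

theorem redTwo_mem_homog {G : ICobar 4} (hG : altPow 2 = 8 * G) : redTwo 4 G ∈ homog 4 24 := by
  have h : IsWeightedHomogeneous (dg 4) (altPow 2) 24 := by
    refine IsWeightedHomogeneous.sum _ _ _ fun i _ => ?_
    have h1 := (isWeightedHomogeneous_iCoface i (isWeightedHomogeneous_corrPow
        (fun a => isWeightedHomogeneous_X ℤ (dg 3) (a, 0))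
        fun a => isWeightedHomogeneous_X ℤ (dg 3) (a, 1))).C_mul
      ((-1 : ℤ) ^ (i : ℕ))
    rwa [← smul_eq_C_mul] at h1
  intro e he
  refine h (d := e) fun h0 => he ?_
  rw [hG, ← map_ofNat (C : ℤ →+* ICobar 4), coeff_C_mul] at h0
  rw [redTwo, coeff_map, (mul_eq_zero.1 h0).resolve_left (by norm_num), map_zero]

/-- With the other variables set to zero, only y_0 y_1 y_2² remains of the corrections, and it
enters as 4(y_0 y_1 y_2²)². The essential coefficient -3 is -4·6/8: it comes from the fourth power
of X_2 + X_3 in the coface that splits the last factor. -/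
theorem iKill_eq {G : ICobar 4} (hG : altPow 2 = 8 * G) :
    killCompl (zetaTwo_injective 4) G =
      X 3 ^ 3 * (X 0 ^ 2 * X 1 * X 2 * X 3 - X 0 * X 1 * X 2 ^ 2 * X 3) -
        3 * (X 0 ^ 2 * X 1 ^ 2 * X 2 ^ 2 * X 3 ^ 2) -
        2 * (X 0 ^ 2 * X 1 ^ 2 * (X 2 ^ 3 * X 3 + X 2 * X 3 ^ 3)) := by
  have h0 : ∀ a : Fin 4, killCompl (R := ℤ) (zetaTwo_injective 4) (X (a, 0)) = 0 := fun a => by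
    refine (aeval_X _ _).trans (dif_neg ?_)
    rintro ⟨b, hb⟩
    exact one_ne_zero (congrArg Prod.snd hb)
  have h1 : ∀ a : Fin 4, killCompl (R := ℤ) (zetaTwo_injective 4) (X (a, 1)) = X a := fun a => by
    rw [show (X (a, 1) : ICobar 4) = rename (zetaTwo 4) (X a) by rw [rename_X]; rfl,
      killCompl_rename_app]
  have h2 : (8 : MvPolynomial (Fin 4) ℤ) ≠ 0 := by norm_num
  refine mul_left_cancel₀ h2 ?_
  have h3 := congrArg (killCompl (R := ℤ) (zetaTwo_injective 4)) hG
  rw [map_mul, map_ofNat] at h3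
  rw [← h3, altPow_eq]
  simp only [corrPow, powSum, cubeTerm, corrOne, corrTwo, Matrix.cons_val, map_add, map_sub,
    map_mul, map_pow, h0, h1, map_ofNat]
  ring

theorem squareCoeff_redTwo {G : ICobar 4} (hG : altPow 2 = 8 * G) :
    squareCoeff (redTwo 4 G) = 1 := by
  have h2 : (2 : MvPolynomial (Fin 4) (ZMod 2)) = 0 := CharTwo.two_eq_zero
  have h : toZetaTwo 4 (redTwo 4 G) =
      X 3 ^ 3 * (X 0 ^ 2 * X 1 * X 2 * X 3 - X 0 * X 1 * X 2 ^ 2 * X 3) +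
        monomial (twos 4) 1 := by
    have h3 : (monomial (twos 4) 1 : MvPolynomial (Fin 4) (ZMod 2)) =
        X 0 ^ 2 * X 1 ^ 2 * X 2 ^ 2 * X 3 ^ 2 := by
      rw [monomial_eq, Finsupp.prod_fintype _ _ (by simp), Fin.prod_univ_four, map_one, one_mul]
      rfl
    rw [h3, toZetaTwo, redTwo, killCompl_map, iKill_eq hG]
    simp only [map_sub, map_mul, map_pow, map_add, map_X, map_ofNat]
    linear_combination (-2 * (X 0 ^ 2 * X 1 ^ 2 * X 2 ^ 2 * X 3 ^ 2) -
      (X 0 ^ 2 * X 1 ^ 2 * (X 2 ^ 3 * X 3 + X 2 * X 3 ^ 3))) * h2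
  rw [squareCoeff_eq, h, coeff_add, coeff_twos_X_pow_mul, coeff_monomial, if_pos rfl, zero_add]

/-! ### Lifts of `h_j³` to the cobar complex of `BP_*BP` -/

/-- If a and b agree modulo I, then a + b = (a - b) + 2b lies in I, so each squaring gains a factor
in I. -/
theorem pow_sub_pow_mem {R : Type} [CommRing R] {I : Ideal R} (h2 : 2 ∈ I) {a b : R}
    (h : a - b ∈ I) (k : ℕ) : a ^ 2 ^ k - b ^ 2 ^ k ∈ I ^ (k + 1) := by
  induction k with
  | zero => simpa using h
  | succ k ih =>
    have h1 : a ^ 2 ^ k + b ^ 2 ^ k ∈ I := by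
      have : a ^ 2 ^ k + b ^ 2 ^ k = (a ^ 2 ^ k - b ^ 2 ^ k) + 2 * b ^ 2 ^ k := by ring
      rw [this]
      exact add_mem (Ideal.pow_le_self (Nat.succ_ne_zero k) ih) (Ideal.mul_mem_right _ _ h2)
    have : a ^ 2 ^ (k + 1) - b ^ 2 ^ (k + 1) =
        (a ^ 2 ^ k - b ^ 2 ^ k) * (a ^ 2 ^ k + b ^ 2 ^ k) := by ring
    rw [this, pow_succ I]
    exact Ideal.mul_mem_mul ih h1

/-- The three terms lie in I to the powers n+4, 1+(n+3) and 2+(n+2), where the factors 2 and 4 make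
up for the smaller exponents. -/
theorem powSum_sub_mem {R : Type} [CommRing R] {I : Ideal R} (h2 : 2 ∈ I) {A A' B B' D D' : R}
    (hA : A - A' ∈ I) (hB : B - B' ∈ I) (hD : D - D' ∈ I) (n : ℕ) :
    powSum (2 ^ (n + 1)) A B D - powSum (2 ^ (n + 1)) A' B' D' ∈ I ^ 4 := by
  have e : powSum (2 ^ (n + 1)) A B D - powSum (2 ^ (n + 1)) A' B' D' =
      (A ^ 2 ^ (n + 3) - A' ^ 2 ^ (n + 3)) + 2 * (B ^ 2 ^ (n + 2) - B' ^ 2 ^ (n + 2)) +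
        2 ^ 2 * (D ^ 2 ^ (n + 1) - D' ^ 2 ^ (n + 1)) := by
    rw [powSum, powSum, show 4 * 2 ^ (n + 1) = 2 ^ (n + 3) by ring,
      show 2 * 2 ^ (n + 1) = 2 ^ (n + 2) by ring]
    ring
  rw [e]
  refine add_mem (add_mem ?_ ?_) ?_
  · exact Ideal.pow_le_pow_right (by omega) (pow_sub_pow_mem h2 hA (n + 3))
  · refine Ideal.pow_le_pow_right (show 4 ≤ 1 + (n + 2 + 1) by omega) ?_
    rw [pow_add, pow_one]
    exact Ideal.mul_mem_mul h2 (pow_sub_pow_mem h2 hB (n + 2))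
  · refine Ideal.pow_le_pow_right (show 4 ≤ 2 + (n + 1 + 1) by omega) ?_
    rw [pow_add]
    exact Ideal.mul_mem_mul (Ideal.pow_mem_pow h2 2) (pow_sub_pow_mem h2 hD (n + 1))

theorem two_mem_augI (s : ℕ) : (2 : Cobar s) ∈ augI s := Ideal.subset_span (Set.mem_insert _ _)

/-- A cochain that represents the class named `h_{n+3}³`. -/
def cubeLift (n : ℕ) : Cobar 3 :=
  toCobar 3 (corrPow (2 ^ (n + 1)) (fun a => X (a, 0)) fun a => X (a, 1))

theorem cobarD_cubeLift_sub_altPow_mem (n : ℕ) :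
    cobarD 3 (cubeLift n) - toCobar 4 (altPow (2 ^ (n + 1))) ∈ augI 4 ^ 4 := by
  rw [cobarD_apply, altPow, map_sum, ← Finset.sum_sub_distrib]
  refine sum_mem fun i _ => ?_
  rw [map_zsmul, ← smul_sub]
  refine zsmul_mem ?_ _
  rw [cubeLift, corrPow, map_powSum (toCobar 3), ← RingHom.coe_coe (coface 3 i), map_powSum,
    ← RingHom.coe_coe (iCoface 3 i), map_powSum, map_powSum]
  exact powSum_sub_mem (two_mem_augI 4) (coface_toCobar_sub_mem i _) (coface_toCobar_sub_mem i _)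
    (coface_toCobar_sub_mem i _) n

/-- The two errors are the difference between the cofaces of BP_*BP and their integral models, and
the multiple of 16 = 2^4; both lie in I^4. -/
theorem cobarD_cubeLift_sub_mem {G : ICobar 4} (hG : altPow 2 = 8 * G) (n : ℕ) :
    cobarD 3 (cubeLift n) - 8 * toCobar 4 G ^ 2 ^ n ∈ augI 4 ^ 4 := by
  obtain ⟨q, hq⟩ := sixteen_dvd_altPow_sub hG n
  have h1 := congrArg (toCobar 4) hq
  rw [map_sub, map_mul, map_mul, map_ofNat, map_ofNat, map_pow] at h1
  have h2 : cobarD 3 (cubeLift n) - 8 * toCobar 4 G ^ 2 ^ n =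
      (cobarD 3 (cubeLift n) - toCobar 4 (altPow (2 ^ (n + 1)))) + 2 ^ 4 * toCobar 4 q := by
    linear_combination h1
  rw [h2]
  exact add_mem (cobarD_cubeLift_sub_altPow_mem n)
    (Ideal.mul_mem_right _ _ (Ideal.pow_mem_pow (two_mem_augI 4) 4))

theorem mk_cubeLift (n : ℕ) : Ideal.Quotient.mk (augI 3) (cubeLift n) =
    frobeniusName 3 (zeta 3 0 1 ^ 2 ^ (n + 3) * zeta 3 1 1 ^ 2 ^ (n + 3) *
      zeta 3 2 1 ^ 2 ^ (n + 3)) := by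
  have h2 : (2 : SCobar 3) = 0 := CharTwo.two_eq_zero
  rw [cubeLift, mk_toCobar, map_corrPow]
  congr 1
  simp only [redTwo, map_X]
  rw [corrPow, powSum, show 4 * 2 ^ (n + 1) = 2 ^ (n + 3) by ring, cubeTerm, mul_pow, mul_pow]
  simp only [zeta]
  linear_combination (corrOne (R := SCobar 3) (fun a => X (a, 0)) (fun a => X (a, 1)) ^
      (2 * 2 ^ (n + 1)) +
    2 * corrTwo (fun a => X (a, 0)) (fun a => X (a, 1)) ^ 2 ^ (n + 1)) * h2

/-! ### Division by 8 -/

/-- The reduction modulo the `v_n`. -/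
def killV (s : ℕ) : Cobar s →+* MvPolynomial (Fin s × ℕ) ZLoc :=
  eval₂Hom C (Sum.elim (fun _ => 0) X)

theorem map_residue_killV {s : ℕ} (x : Cobar s) : map residue (killV s x) = redI s x := by
  suffices h : (map residue).comp (killV s) = redI s from DFunLike.congr_fun h x
  refine MvPolynomial.ringHom_ext (fun c => ?_) fun g => ?_
  · simp [killV, redI]
  · rcases g with n | p <;> simp [killV, redI]

/-- Setting all v_n to zero sends I^4 into the ideal generated by 16, and in a torsion-free ring 8x
∈ (16) gives x ∈ (2). -/
theorem redI_eq_zero_of_eight_mul_mem {s : ℕ} {x : Cobar s} (h : 8 * x ∈ augI s ^ 4) :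
    redI s x = 0 := by
  have h1 : augI s ≤ (Ideal.span {2}).comap (killV s) := by
    refine Ideal.span_le.2 ?_
    rintro y (rfl | ⟨n, rfl⟩)
    · rw [SetLike.mem_coe, Ideal.mem_comap, map_ofNat]
      exact Ideal.mem_span_singleton_self 2
    · simp [killV, v]
  have h2 : killV s (8 * x) ∈ Ideal.span {2} ^ 4 :=
    Ideal.le_comap_pow (killV s) 4 (Ideal.pow_right_mono h1 4 h)
  rw [Ideal.span_singleton_pow, Ideal.mem_span_singleton, map_mul, map_ofNat] at h2
  obtain ⟨q, hq⟩ := h2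
  have h3 : killV s x = 2 * q := by
    refine mul_left_cancel₀ (show (8 : MvPolynomial (Fin s × ℕ) ZLoc) ≠ 0 by norm_num) ?_
    linear_combination hq
  rw [← map_residue_killV, h3, map_mul, map_ofNat]
  exact mul_eq_zero_of_left CharTwo.two_eq_zero _

/-- Applying d to the congruence for `cubeLift 0` gives 8 dG ∈ I^4, hence dG = 0 in the cobar
complex of A. -/
theorem sCobarD_redTwo {G : ICobar 4} (hG : altPow 2 = 8 * G) : sCobarD 4 (redTwo 4 G) = 0 := by
  have h1 := cobarD_mem (cobarD_cubeLift_sub_mem hG 0)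
  rw [pow_zero, pow_one, map_sub, cobarD_cobarD, zero_sub, neg_mem_iff] at h1
  have h2 : cobarD 4 (8 * toCobar 4 G) = 8 * cobarD 4 (toCobar 4 G) := by
    have := map_nsmul (cobarD 4) 8 (toCobar 4 G)
    simpa using this
  rw [h2] at h1
  rw [← redI_of_mk_eq (quot_cobarD (mk_toCobar G)), redI_eq_zero_of_eight_mul_mem h1]

/-! ### Classes on the pages -/

theorem pageMk_eq_of_sub_mem {r s k : ℕ} {x y : Cobar s} (hx : x ∈ pageZ r s k)
    (hy : y ∈ pageZ r s k) (h : x - y ∈ augI s ^ (k + 1)) : pageMk x hx = pageMk y hy := by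
  refine QuotientAddGroup.eq.2 ?_
  change -x + y ∈ pageB r s k
  refine AddSubgroup.mem_sup_left ⟨?_, (pageZ r s k).add_mem ((pageZ r s k).neg_mem hx) hy⟩
  change -x + y ∈ filt s (k + 1)
  rw [mem_filt, ← neg_mem_iff]
  convert h using 1
  ring

theorem q0_pageMk {r s k : ℕ} {x : Cobar s} (hx : x ∈ pageZ r s k)
    (hx' : 2 * x ∈ pageZ r s (k + 1)) : q0 (pageMk x hx) = pageMk (2 * x) hx' := rfl

theorem two_mul_mem_pageZ {r s k : ℕ} {x : Cobar s} (hx : x ∈ pageZ r s k) :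
    2 * x ∈ pageZ r s (k + 1) := by
  refine ⟨two_mul_mem_filt hx.1, ?_⟩
  change cobarD s (2 * x) ∈ filt (s + 1) (k + 1 + (r - 1))
  rw [two_mul, map_add, ← two_mul, show k + 1 + (r - 1) = k + (r - 1) + 1 by omega]
  exact two_mul_mem_filt hx.2

theorem mem_pageZ_of_cobarD_mem {r s : ℕ} {x : Cobar s} (h : cobarD s x ∈ augI (s + 1) ^ (r - 1)) :
    x ∈ pageZ r s 0 := by
  refine ⟨?_, ?_⟩
  · change x ∈ filt s 0
    rw [mem_filt, pow_zero, Ideal.one_eq_top]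
    trivial
  · change cobarD s x ∈ filt (s + 1) (0 + (r - 1))
    rwa [mem_filt, zero_add]

theorem cobarD_mem_pageZ_two {s k : ℕ} {x : Cobar s} (h : cobarD s x ∈ augI (s + 1) ^ k) :
    cobarD s x ∈ pageZ 2 (s + 1) k := by
  refine ⟨h, ?_⟩
  change cobarD (s + 1) (cobarD s x) ∈ filt (s + 1 + 1) (k + (2 - 1))
  rw [cobarD_cobarD]
  exact zero_mem _

/-- The same cochain x represents the class on the second and on the r-th page, and dx does so for
the target. -/
theorem hasDifferential_of_eq {r s : ℕ} {x : Cobar s} {y : Page 2 (s + 1) (0 + (r - 1))}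
    (h2 : x ∈ pageZ 2 s 0) (h : cobarD s x ∈ augI (s + 1) ^ (0 + (r - 1)))
    (hy : pageMk (cobarD s x) (cobarD_mem_pageZ_two h) = y) :
    HasDifferential r (pageMk x h2) y := by
  have hr : x ∈ pageZ r s 0 := mem_pageZ_of_cobarD_mem (by rwa [zero_add] at h)
  exact ⟨pageMk x hr, pageD r s 0 (pageMk x hr), ⟨x, h2, hr, rfl, rfl⟩,
    ⟨cobarD s x, cobarD_mem_pageZ_two h, cobarD_mem_pageZ hr, hy, rfl⟩, rfl⟩

theorem hasDifferential_zero {r s : ℕ} {x : Cobar s} (h2 : x ∈ pageZ 2 s 0)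
    (h : cobarD s x ∈ augI (s + 1) ^ (0 + (r - 1) + 1)) : HasDifferential r (pageMk x h2) 0 := by
  refine hasDifferential_of_eq h2 (Ideal.pow_le_pow_right (Nat.le_succ _) h) ?_
  refine (pageMk_eq_of_sub_mem _ (zero_mem _) ?_).trans rfl
  rwa [sub_zero]

/-! ### Classes in `Ext_A` -/

theorem extMk_congr {s : ℕ} {z z' : SCobar s} (h : z = z') (hz : sCobarD s z = 0) :
    extMk z hz = extMk z' (h ▸ hz) := by
  subst h
  rfl

theorem sCobarD_pow {s : ℕ} {z : SCobar s} (hz : sCobarD s z = 0) (n : ℕ) :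
    sCobarD s (z ^ 2 ^ n) = 0 := by
  induction n with
  | zero => simpa using hz
  | succ n ih => rw [pow_succ, pow_mul, sCobarD_sq, ih, zero_pow two_ne_zero]

theorem sq0_extMk {s : ℕ} {z : SCobar s} (hz : sCobarD s z = 0) (hz' : sCobarD s (z ^ 2) = 0) :
    sq0 s (extMk z hz) = extMk (z ^ 2) hz' := rfl

theorem iterate_sq0_extMk {s : ℕ} {z : SCobar s} (hz : sCobarD s z = 0) (n : ℕ) :
    (sq0 s)^[n] (extMk z hz) = extMk (z ^ 2 ^ n) (sCobarD_pow hz n) := by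
  induction n with
  | zero => exact extMk_congr (by simp) hz
  | succ n ih =>
    rw [Function.iterate_succ_apply', ih, sq0_extMk _ (by
      rw [sCobarD_sq, sCobarD_pow hz n, zero_pow two_ne_zero])]
    exact extMk_congr (by rw [← pow_mul, ← pow_succ]) _

theorem extMk_eq_extMk {s : ℕ} {z z' : SCobar (s + 1)} (hz : sCobarD (s + 1) z = 0)
    (hz' : sCobarD (s + 1) z' = 0) :
    extMk z hz = extMk z' hz' ↔ z - z' ∈ (sCobarD s).range := by
  rw [eq_comm]
  refine QuotientAddGroup.eq.trans ?_
  change -z' + z ∈ (sCobarD s).range ↔ _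
  rw [neg_add_eq_sub]

theorem extMk_zero (s : ℕ) : extMk (0 : SCobar s) (map_zero _) = 0 := rfl

theorem mem_extDegree {s D : ℕ} {x : ExtA s} :
    x ∈ extDegree s D ↔ ∃ (z : SCobar s) (hz : sCobarD s z = 0), z ∈ homog s D ∧ extMk z hz = x := by
  constructor
  · rintro ⟨⟨z, hz⟩, hz', rfl⟩
    exact ⟨z, hz, hz', rfl⟩
  · rintro ⟨z, hz, hz', rfl⟩
    exact ⟨⟨z, hz⟩, hz', rfl⟩

/-- `squareCoeff` induces an isomorphism from Ext^{4,24} to 𝔽_2 that takes the value 1 on G. -/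
theorem extMk_redTwo_unique {G : ICobar 4} (hG : altPow 2 = 8 * G) :
    extMk (redTwo 4 G) (sCobarD_redTwo hG) ∈ extDegree 4 24 ∧
      extMk (redTwo 4 G) (sCobarD_redTwo hG) ≠ 0 ∧
      ∀ x ∈ extDegree 4 24, x = 0 ∨ x = extMk (redTwo 4 G) (sCobarD_redTwo hG) := by
  refine ⟨mem_extDegree.2 ⟨_, _, redTwo_mem_homog hG, rfl⟩, fun h => ?_, fun x hx => ?_⟩
  · rw [← extMk_zero, extMk_eq_extMk, sub_zero] at h
    obtain ⟨U, hU⟩ := h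
    have h1 := squareCoeff_redTwo hG
    rw [← hU, squareCoeff_sCobarD] at h1
    exact zero_ne_one h1
  · obtain ⟨z, hz, hD, rfl⟩ := mem_extDegree.1 hx
    by_cases h : squareCoeff z = 0
    · left
      rw [← extMk_zero, extMk_eq_extMk, sub_zero]
      exact mem_range_sCobarD squareCoeff_sCobarD hD hz h
    · right
      rw [extMk_eq_extMk]
      refine mem_range_sCobarD squareCoeff_sCobarD (sub_mem hD (redTwo_mem_homog hG)) ?_ ?_
      · rw [map_sub, hz, sCobarD_redTwo hG, sub_zero]
      · rw [map_sub, squareCoeff_redTwo hG, sub_eq_zero]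
        generalize squareCoeff z = c at h
        revert h
        decide +revert

theorem hasDifferential_hCube {G : ICobar 4} (hG : altPow 2 = 8 * G) (n : ℕ) :
    HasDifferential 2 (ceName (hCube (n + 3))) 0 ∧ HasDifferential 3 (ceName (hCube (n + 3))) 0 ∧
      HasDifferential 4 (ceName (hCube (n + 3)))
        (q0 (q0 (q0 (ceName (sq0Family (extMk (redTwo 4 G) (sCobarD_redTwo hG)) (n + 1)))))) := by
  have h4 := cobarD_cubeLift_sub_mem hG n
  have h3 : cobarD 3 (cubeLift n) ∈ augI 4 ^ 3 := by
    have h := add_mem (Ideal.pow_le_pow_right (show 3 ≤ 4 by norm_num) h4)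
      (Ideal.mul_mem_right (toCobar 4 G ^ 2 ^ n) _ (Ideal.pow_mem_pow (two_mem_augI 4) 3))
    convert h using 1
    ring
  have hx : ceName (hCube (n + 3)) = pageMk (cubeLift n)
      (mem_pageZ_of_name (sCobarD_cube (n + 3)) (mk_cubeLift n)) := 
    ceName_extMk _ (mk_cubeLift n)
  rw [hx]
  refine ⟨hasDifferential_zero _ (Ideal.pow_le_pow_right (by norm_num) h3),
    -- Lying in I^3 is one more than d_3 needs to vanish and what d_4 needs to be read off; modulo
    -- I^4 the differential is 2·2·2·G^{2^n}.
    hasDifferential_zero _ h3, hasDifferential_of_eq _ h3 ?_⟩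
  have hy : sq0Family (extMk (redTwo 4 G) (sCobarD_redTwo hG)) (n + 1) =
      extMk (redTwo 4 G ^ 2 ^ n) (sCobarD_pow (sCobarD_redTwo hG) n) :=
    iterate_sq0_extMk _ n
  have hmk : Ideal.Quotient.mk (augI 4) (toCobar 4 G ^ 2 ^ n) =
      frobeniusName 4 (redTwo 4 G ^ 2 ^ n) := by rw [map_pow, map_pow, mk_toCobar]
  have hz := mem_pageZ_of_name (sCobarD_pow (sCobarD_redTwo hG) n) hmk
  rw [hy, ceName_extMk _ hmk, q0_pageMk hz (two_mul_mem_pageZ hz),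
    q0_pageMk _ (two_mul_mem_pageZ (two_mul_mem_pageZ hz)),
    q0_pageMk _ (two_mul_mem_pageZ (two_mul_mem_pageZ (two_mul_mem_pageZ hz)))]
  refine pageMk_eq_of_sub_mem (k := 3) _ _ ?_
  convert h4 using 1
  ring

end

end AlgNov

/-! ### The theorem -/

theorem proposition6p1 :
    ∃ g : AlgNov.ExtA 4,
      (g ∈ AlgNov.extDegree 4 24 ∧ g ≠ 0 ∧ ∀ x ∈ AlgNov.extDegree 4 24, x = 0 ∨ x = g) ∧
      ∀ j : ℕ, 5 ≤ j →
        AlgNov.HasDifferential 2 (AlgNov.ceName (AlgNov.hCube j)) 0 ∧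
        AlgNov.HasDifferential 3 (AlgNov.ceName (AlgNov.hCube j)) 0 ∧
        AlgNov.HasDifferential 4 (AlgNov.ceName (AlgNov.hCube j))
          (AlgNov.q0 (AlgNov.q0 (AlgNov.q0
            (AlgNov.ceName (AlgNov.sq0Family g (j - 2)))))) := by
  obtain ⟨G, hG⟩ := AlgNov.exists_altPow_two
  refine ⟨_, AlgNov.extMk_redTwo_unique hG, fun j hj => ?_⟩
  -- With j = n + 3 the target is g_{n+1}, the n-fold Sq^0 of g_1, in agreement with G^{2^n}.
  obtain ⟨n, rfl⟩ := Nat.exists_eq_add_of_le' (show 3 ≤ j by omega)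
  exact AlgNov.hasDifferential_hCube hG n
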